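/- **Setting.** A *Tanner square complex* $T$ consists of a finite vertex set $V=V_X\sqcup V_Q\sqcup V_Z$ ($X$-checks, qubits, $Z$-checks), a Tanner graph with edges only between $V_X$ and $V_Q$ and between $V_Q$ and $V_Z$, such that every $x\in V_X$ and $z\in V_Z$ have an even number of common neighbours in $V_Q$, and a set of square faces $(x,q,z,q')$, $q\ne q'$, whose sides are edges of the graph, such that every common neighbour $q$ of $x$ and $z$ is a corner of a face containing $x$ and $z$. Its code is the cochain complex $C(T):\ \mathbb F_2^{V_X}\to\mathbb F_2^{V_Q}\to\mathbb F_2^{V_Z}$ (degrees $0,1,2$) given by adjacency; the number of logical qubits is $\dim H^1(C(T))$. The dual $T^*$ is $T$ with $V_X$ and $V_Z$ exchanged; its code is the transposed complex. For a check $v$ let $X_v$ be the union of the closed squares containing $v$ and $\partial X_v\subset X_v$ the graph formed by the edges of these squares that do not contain $v$. We call $T$ *regular* if every $x\in V_X$ and $z\in V_Z$ lie in at most one common square, $\partial X_v$ is nonempty and connected for every $v\in V_X\cup V_Z$, and every qubit is adjacent to at least one $X$-check and at least one $Z$-check. **Replacement.** Let $\ell\ge 3$ be odd. For $x\in V_X$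 take $X_x\supset\partial X_x$ as above; for $q\in V_Q$ let $X_q$ be the union of the edges from $q$ to $V_Z$ and $\partial X_q$ the set of the $Z$-checks adjacent to $q$; for $z\in V_Z$ let $X_z=\{z\}$, $\partial X_z=\emptyset$. Let $X'_v,\partial X'_v$ be obtained by subdividing each edge into $(\ell-1)/2$ edges and each square into $\frac{\ell-1}2\times\frac{\ell-1}2$ squares, and let $$Y_v=\big(X'_v\times\{0\}\big)\sqcup\big(X'_v\times\{1\}\big)\sqcup\big(\partial X'_v\times[0,1]\big)/\!\sim .$$ Let $C_v^\bullet$ be the cellular cochain complex of $Y_v$ over $\mathbb F_2$, shifted up by $0,1,2$ for $v\in V_X,V_Q,V_Z$ respectively. The code $C'=\mathcal R_X(C(T))$ is $\bigoplus_{v\in V}C_v^\bullet$ with coboundary $\delta=\delta_{\rm loc}+g$, where $\delta_{\rm loc}$ is the sum of the coboundaries of the $C_v^\bullet$ and $g$ is the sum, over adjacent pairs $(x,q)$ and $(q,z)$, of the restriction maps $C(Y_x)\to C(Y_q)$ and $C(Y_q)\to C(Y_z)$ along the inclusions $Y_q\subset Y_x$ and $Y_z\subset Y_q$. It is the code of a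 Tanner square complex $\mathcal R_X(T)$ whose vertices of degree $0,1,2$ are the cells of cochain degree $0,1,2$; its faces are the pairs of different two-step paths $a\to b\to c$, $a\to b'\to c$ from a degree-$0$ to a degree-$2$ vertex, where, for paths running through three local complexes $Y_x,Y_q,Y_z$ and $Y_x,Y_{q'},Y_z$, one requires that $(x,q,z,q')$ is a face of $T$. Put $\mathcal R_Z(T)=\mathcal R_X(T^*)^*$, with the corresponding splitting $\delta=\delta_{\rm loc}+g$. In both cases $\delta_{\rm loc}^2=g^2=0$ and $\delta_{\rm loc}g=g\delta_{\rm loc}$, and the *induced complex* is $(H^\bullet(C',\delta_{\rm loc}),H(g))$, where $H(g)[a]=[ga]$. **Theorem.** Let $\ell\ge3$ be odd, and let $T$ be a regular Tanner square complex. Let $C'$ be the code of $\mathcal R_X(T)$ or of $\mathcal R_Z(T)$. Then there are a cochain map $F:C(T)\to C'$ that induces an isomorphism $H^1(C(T))\cong H^1(C')$, an injective cochain map $\iota:C(T)\to (H(C',\delta_{\rm loc}),H(g))$, and a homotopy equivalence $e:(H(C',\delta_{\rm loc}),H(g))\to C'$ such that $F=e\circ\iota$. For $\mathcal R_X$, $\iota$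 sends the basis vector of each vertex $v$ to the class of the sum of all $0$-cells of $Y_v$; for $\mathcal R_Z$, to the class of a single $0$-cell of $Y_v$. In particular $\dim H^1(C(T))=\dim H^1(C')$. The same holds at every level of the alternating construction $T_{(0)}=T$, $T_{(i+1)}=\mathcal R_X(T_{(i)})$ for even $i$, $T_{(i+1)}=\mathcal R_Z(T_{(i)})$ for odd $i$: for every $i$ there are such maps $F,\iota,e$ for $C(T_{(i)})$ and $C(T_{(i+1)})$, and $\dim H^1(C(T_{(i)}))=\dim H^1(C(T_{(0)}))$. The Tanner square complex of the $[\![5,1,2]\!]$ surface code is regular, so this applies to it as the seed. -/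

import Mathlib

/-- A Tanner square complex of a quantum CSS code: a finite set of vertices, where degree `0`, `1`, `2`
means `X`-check, qubit, `Z`-check; the edges of the Tanner graph, oriented from `X`-checks to qubits
and from qubits to `Z`-checks; and a collection of square faces `(x, q, z, q')`. -/
structure TannerComplex where
  V : Type
  finite_V : Finite V
  deg : V → ℕ
  deg_le : ∀ v, deg v ≤ 2
  adj : V → V → Prop
  adj_deg : ∀ v w, adj v w → deg w = deg v + 1
  -- an `X`-check and a `Z`-check share an even number of qubits (the two checks commute)
  even_common : ∀ x z, Even (Nat.card {q // adj x q ∧ adj q z})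
  face : V → V → V → V → Prop
  face_adj : ∀ x q z q', face x q z q' → adj x q ∧ adj q z ∧ adj x q' ∧ adj q' z
  face_ne : ∀ x q z q', face x q z q' → q ≠ q'
  face_symm : ∀ x q z q', face x q z q' → face x q' z q
  -- every qubit shared by `x` and `z` takes part in a face with corners `x` and `z`
  face_cover : ∀ x q z, adj x q → adj q z → ∃ q', face x q z q'

namespace TannerComplex

instance (T : TannerComplex) : Finite T.V := T.finite_V

/-- Exchange of the roles of `X`- and `Z`-checks (transposition of the cochain complex). -/
def dual (T : TannerComplex) : TannerComplex where
  V := T.V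
  finite_V := T.finite_V
  deg v := 2 - T.deg v
  deg_le v := Nat.sub_le _ _
  adj v w := T.adj w v
  adj_deg v w h := by
    have h1 := T.adj_deg _ _ h
    have h2 := T.deg_le v
    omega
  even_common x z := by
    have h := T.even_common z x
    simpa only [and_comm] using h
  face x q z q' := T.face z q x q'
  face_adj x q z q' h := by
    obtain ⟨h1, h2, h3, h4⟩ := T.face_adj _ _ _ _ h
    exact ⟨h2, h1, h4, h3⟩
  face_ne x q z q' h := T.face_ne _ _ _ _ h
  face_symm x q z q' h := T.face_symm _ _ _ _ h
  face_cover x q z h1 h2 := T.face_cover z q x h2 h1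

/-- The vertices of degree `n`: `X`-checks, qubits, `Z`-checks for `n = 0, 1, 2`. -/
abbrev Cells (T : TannerComplex) (n : ℕ) : Type := {v : T.V // T.deg v = n}

/-- The space of `n`-cochains. -/
abbrev Cochain (T : TannerComplex) (n : ℕ) : Type := T.Cells n → ZMod 2

end TannerComplex

open Classical in
/-- The linear map `𝔽₂^α → 𝔽₂^β` whose matrix is the indicator of a relation:
`(relMap r φ) b = ∑_{a, r a b} φ a`. -/
noncomputable def relMap {α β : Type} [Finite α] (r : α → β → Prop) :
    (α → ZMod 2) →ₗ[ZMod 2] (β → ZMod 2) :=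
  letI := Fintype.ofFinite α
  Matrix.mulVecLin (Matrix.of fun b a => if r a b then 1 else 0)

theorem relMap_apply {α β : Type} [Fintype α] (r : α → β → Prop) [DecidableRel r]
    (φ : α → ZMod 2) (b : β) : relMap r φ b = ∑ a, if r a b then φ a else 0 := by
  classical
  simp only [relMap, Matrix.mulVecLin_apply, Matrix.mulVec, dotProduct, Matrix.of_apply, ite_mul,
    one_mul, zero_mul]
  refine Finset.sum_congr (by ext; simp) fun a _ => ?_
  congr

theorem relMap_false {α β : Type} [Finite α] (r : α → β → Prop) (h : ∀ a b, ¬ r a b) :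
    relMap r = 0 := by
  classical
  let _ := Fintype.ofFinite α
  ext φ b
  simp [relMap_apply, h]

/-- Sums of compositions of `relMap`s count paths of length two modulo `2`. -/
theorem relMap_comp_apply {α β γ : Type} [Finite α] [Finite β] (r : α → β → Prop)
    (s : β → γ → Prop) (φ : α → ZMod 2) (c : γ) [Fintype α] :
    relMap s (relMap r φ) c = ∑ a, (Nat.card {b // r a b ∧ s b c} : ZMod 2) * φ a := by
  classical
  let _ := Fintype.ofFinite β
  simp only [relMap_apply]
  have : ∀ a, (Nat.card {b // r a b ∧ s b c} : ZMod 2) * φ a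
      = ∑ b, if r a b ∧ s b c then φ a else 0 := by
    intro a
    rw [Nat.card_eq_fintype_card, Fintype.card_subtype, Finset.sum_ite, Finset.sum_const_zero,
      add_zero, Finset.sum_const, nsmul_eq_mul]
  simp only [this]
  rw [Finset.sum_comm]
  refine Finset.sum_congr rfl fun b _ => ?_
  by_cases h : s b c <;> simp [h]

namespace TannerComplex

open CategoryTheory

/-- The coboundary map between cochains of degrees `i` and `j`; it is zero unless `j = i + 1`. -/
noncomputable def δ (T : TannerComplex) (i j : ℕ) : T.Cochain i →ₗ[ZMod 2] T.Cochain j :=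
  relMap fun a b => T.adj a.1 b.1

theorem card_cells (T : TannerComplex) (n : ℕ) (P : T.V → Prop) (hP : ∀ b, P b → T.deg b = n) :
    Nat.card {b : T.Cells n // P b.1} = Nat.card {b // P b} :=
  Nat.card_congr
    { toFun := fun b => ⟨b.1.1, b.2⟩
      invFun := fun b => ⟨⟨b.1, hP _ b.2⟩, b.2⟩
      left_inv := fun _ => rfl
      right_inv := fun _ => rfl }

theorem δ_comp (T : TannerComplex) (i j k : ℕ) : T.δ j k ∘ₗ T.δ i j = 0 := by
  classical
  by_cases hij : i + 1 = j
  · let _ := Fintype.ofFinite (T.Cells i)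
    refine LinearMap.ext fun φ => ?_
    funext c
    simp only [δ, LinearMap.comp_apply, LinearMap.zero_apply, Pi.zero_apply]
    rw [relMap_comp_apply]
    refine Finset.sum_eq_zero fun a _ => ?_
    rw [T.card_cells j (fun b => T.adj a.1 b ∧ T.adj b c.1)
      (fun b hb => by rw [T.adj_deg _ _ hb.1, a.2, hij]),
      (ZMod.natCast_eq_zero_iff_even).2 (T.even_common _ _), zero_mul]
  · have : T.δ i j = 0 := relMap_false _ fun a b h => hij (by
      rw [← b.2, T.adj_deg _ _ h, a.2])
    rw [this, LinearMap.comp_zero]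

/-- The cochain complex `𝔽₂^{V_X} → 𝔽₂^{V_Q} → 𝔽₂^{V_Z}` of the CSS code
(in degrees `0`, `1`, `2`, zero elsewhere). -/
noncomputable def complex (T : TannerComplex) : CochainComplex (ModuleCat (ZMod 2)) ℕ where
  X n := ModuleCat.of (ZMod 2) (T.Cochain n)
  d i j := ModuleCat.ofHom (T.δ i j)
  shape i j hij := by
    have : T.δ i j = 0 := relMap_false _ fun a b h => hij (by
      change i + 1 = j
      rw [← b.2, T.adj_deg _ _ h, a.2])
    rw [this]; rfl
  d_comp_d' i j k _ _ := by
    rw [← ModuleCat.ofHom_comp, T.δ_comp]; rfl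

/-- The number of logical qubits, `dim H¹`. -/
noncomputable def numLogical (T : TannerComplex) : ℕ :=
  Module.finrank (ZMod 2) (T.complex.homology 1)

end TannerComplex

/-- A code assembled from local codes that are indexed by the vertices of `T`: each cell of the
global code `tot` belongs to the local code of the vertex `own` of it, and the coboundary map connects
a local code only to itself and to the local codes at the upper neighbours of its vertex. -/
structure CodeEmbedding (T : TannerComplex) where
  tot : TannerComplex
  own : tot.V → T.V
  own_adj : ∀ a b, tot.adj a b → own a = own b ∨ T.adj (own a) (own b)

namespace CodeEmbedding

open CategoryTheory TannerComplex

variable {T : TannerComplex} (E : CodeEmbedding T)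

/-- The same code embedding with the roles of `X` and `Z` exchanged. -/
def dual {T : TannerComplex} (E : CodeEmbedding T.dual) : CodeEmbedding T where
  tot := E.tot.dual
  own := E.own
  own_adj a b h := (E.own_adj b a h).imp Eq.symm id

/-- The local part `δ_loc` of the coboundary map, acting within the local codes. -/
noncomputable def δloc (i j : ℕ) : E.tot.Cochain i →ₗ[ZMod 2] E.tot.Cochain j :=
  relMap fun a b => E.tot.adj a.1 b.1 ∧ E.own a.1 = E.own b.1

/-- The connecting part `g` of the coboundary map, acting between different local codes. -/
noncomputable def g (i j : ℕ) : E.tot.Cochain i →ₗ[ZMod 2] E.tot.Cochain j :=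
  relMap fun a b => E.tot.adj a.1 b.1 ∧ E.own a.1 ≠ E.own b.1

theorem δ_eq (i j : ℕ) : E.tot.δ i j = E.δloc i j + E.g i j := by
  classical
  let _ := Fintype.ofFinite (E.tot.Cells i)
  refine LinearMap.ext fun φ => ?_
  funext b
  simp only [TannerComplex.δ, δloc, g, LinearMap.add_apply, Pi.add_apply, relMap_apply,
    ← Finset.sum_add_distrib]
  refine Finset.sum_congr rfl fun a _ => ?_
  by_cases h : E.own a.1 = E.own b.1 <;> simp [h]

/-- Splitting a path count by an auxiliary condition that depends on the end points only. -/
theorem comp_zero_of (r s : E.tot.V → E.tot.V → Prop) (i j k : ℕ)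
    (hr : ∀ a b, r a b → E.tot.adj a b)
    (h : ∀ a c, Even (Nat.card {b // r a b ∧ s b c})) :
    (relMap fun (a : E.tot.Cells j) (b : E.tot.Cells k) => s a.1 b.1) ∘ₗ
      (relMap fun (a : E.tot.Cells i) (b : E.tot.Cells j) => r a.1 b.1) = 0 := by
  classical
  by_cases hij : i + 1 = j
  · let _ := Fintype.ofFinite (E.tot.Cells i)
    refine LinearMap.ext fun φ => ?_
    funext c
    simp only [LinearMap.comp_apply, LinearMap.zero_apply, Pi.zero_apply]
    rw [relMap_comp_apply]
    refine Finset.sum_eq_zero fun a _ => ?_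
    rw [E.tot.card_cells j (fun b => r a.1 b ∧ s b c.1)
      (fun b hb => by rw [E.tot.adj_deg _ _ (hr _ _ hb.1), a.2, hij]),
      (ZMod.natCast_eq_zero_iff_even).2 (h _ _), zero_mul]
  · rw [relMap_false (fun (a : E.tot.Cells i) (b : E.tot.Cells j) => r a.1 b.1), LinearMap.comp_zero]
    exact fun a b h => hij (by rw [← b.2, E.tot.adj_deg _ _ (hr _ _ h), a.2])

theorem own_ne_of_adj {v w : T.V} (h : T.adj v w) : v ≠ w := by
  rintro rfl
  have := T.adj_deg _ _ h
  omega

theorem δloc_comp (i j k : ℕ) : E.δloc j k ∘ₗ E.δloc i j = 0 := by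
  refine E.comp_zero_of (fun a b => E.tot.adj a b ∧ E.own a = E.own b)
    (fun a b => E.tot.adj a b ∧ E.own a = E.own b) i j k (fun _ _ h => h.1) fun a c => ?_
  by_cases h : E.own a = E.own c
  · convert E.tot.even_common a c using 4 with b
    constructor
    · exact fun hb => ⟨hb.1.1, hb.2.1⟩
    · rintro ⟨h1, h2⟩
      rcases E.own_adj _ _ h1 with h3 | h3
      · exact ⟨⟨h1, h3⟩, h2, h3 ▸ h⟩
      · rcases E.own_adj _ _ h2 with h4 | h4
        · exact absurd (h.trans h4.symm) (own_ne_of_adj h3)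
        · have := T.adj_deg _ _ h3
          have := T.adj_deg _ _ h4
          rw [h] at *
          omega
  · have : IsEmpty {b // (E.tot.adj a b ∧ E.own a = E.own b) ∧ E.tot.adj b c ∧ E.own b = E.own c} :=
      ⟨fun b => h (b.2.1.2.trans b.2.2.2)⟩
    simp

theorem g_comp (i j k : ℕ) : E.g j k ∘ₗ E.g i j = 0 := by
  refine E.comp_zero_of (fun a b => E.tot.adj a b ∧ E.own a ≠ E.own b)
    (fun a b => E.tot.adj a b ∧ E.own a ≠ E.own b) i j k (fun _ _ h => h.1) fun a c => ?_
  by_cases h : T.deg (E.own c) = T.deg (E.own a) + 2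
  · convert E.tot.even_common a c using 4 with b
    constructor
    · exact fun hb => ⟨hb.1.1, hb.2.1⟩
    · rintro ⟨h1, h2⟩
      rcases E.own_adj _ _ h1 with h3 | h3
      · rcases E.own_adj _ _ h2 with h4 | h4
        · rw [h3, h4] at h; omega
        · have := T.adj_deg _ _ h4
          rw [h3] at h; omega
      · rcases E.own_adj _ _ h2 with h4 | h4
        · have := T.adj_deg _ _ h3
          rw [h4] at this; omega
        · exact ⟨⟨h1, own_ne_of_adj h3⟩, h2, own_ne_of_adj h4⟩
  · have : IsEmpty {b // (E.tot.adj a b ∧ E.own a ≠ E.own b) ∧ E.tot.adj b c ∧ E.own b ≠ E.own c} := by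
      refine ⟨fun b => h ?_⟩
      have h3 := T.adj_deg _ _ ((E.own_adj _ _ b.2.1.1).resolve_left b.2.1.2)
      have h4 := T.adj_deg _ _ ((E.own_adj _ _ b.2.2.1).resolve_left b.2.2.2)
      omega
    simp

theorem δloc_g (i j k : ℕ) (φ : E.tot.Cochain i) :
    E.δloc j k (E.g i j φ) = E.g j k (E.δloc i j φ) := by
  have h : E.δloc j k (E.g i j φ) + E.g j k (E.δloc i j φ) = 0 := by
    have h1 := LinearMap.congr_fun (E.tot.δ_comp i j k) φ
    have h2 := LinearMap.congr_fun (E.δloc_comp i j k) φ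
    have h3 := LinearMap.congr_fun (E.g_comp i j k) φ
    simp only [δ_eq, LinearMap.comp_apply, LinearMap.add_apply, map_add, LinearMap.zero_apply]
      at h1 h2 h3
    rw [h2, h3] at h1
    simpa [add_comm] using h1
  have h4 := eq_neg_of_add_eq_zero_left h
  rw [h4]
  funext c
  simp [ZMod.neg_eq_self_mod_two]

/-- The cocycles of `δ_loc` in degree `n`. -/
noncomputable def Zloc (n : ℕ) : Submodule (ZMod 2) (E.tot.Cochain n) := LinearMap.ker (E.δloc n (n + 1))

/-- The coboundaries of `δ_loc` in degree `n`, inside the cocycles (`δloc 0 0` is zero). -/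
noncomputable def Bloc (n : ℕ) : Submodule (ZMod 2) (E.Zloc n) :=
  (LinearMap.range (E.δloc (n - 1) n)).submoduleOf (E.Zloc n)

/-- The cohomology `Hⁿ(C, δ_loc)`. -/
abbrev Hloc (n : ℕ) : Type := E.Zloc n ⧸ E.Bloc n

theorem g_shape {i j : ℕ} (hij : i + 1 ≠ j) : E.g i j = 0 :=
  relMap_false _ fun a b h => hij (by rw [← b.2, E.tot.adj_deg _ _ h.1, a.2])

theorem g_mem_Zloc (i j : ℕ) (φ : E.tot.Cochain i) (h : φ ∈ E.Zloc i) : E.g i j φ ∈ E.Zloc j := by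
  by_cases hij : i + 1 = j
  · subst hij
    change E.δloc _ _ _ = 0
    rw [E.δloc_g, show E.δloc i (i + 1) φ = 0 from h, map_zero]
  · rw [E.g_shape hij]
    exact Submodule.zero_mem _

/-- The restriction of `g` to the cocycles of `δ_loc`. -/
noncomputable def gZ (i j : ℕ) : E.Zloc i →ₗ[ZMod 2] E.Zloc j :=
  (E.g i j).restrict (E.g_mem_Zloc i j)

theorem gZ_Bloc (i j : ℕ) : E.Bloc i ≤ (E.Bloc j).comap (E.gZ i j) := by
  rintro ⟨φ, hφ⟩ ⟨ψ, hψ⟩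
  by_cases hij : i + 1 = j
  · subst hij
    refine ⟨E.g (i - 1) i ψ, ?_⟩
    change E.δloc i (i + 1) _ = E.g i (i + 1) φ
    rw [E.δloc_g]
    exact congrArg _ hψ
  · refine ⟨0, ?_⟩
    change _ = E.g i j φ
    rw [E.g_shape hij]
    simp

/-- The map `H(g)` induced by the connecting maps on the cohomology of `δ_loc`. -/
noncomputable def Hg (i j : ℕ) : E.Hloc i →ₗ[ZMod 2] E.Hloc j :=
  (E.Bloc i).mapQ (E.Bloc j) (E.gZ i j) (E.gZ_Bloc i j)

/-- The induced complex `(H(C, δ_loc), H(g))`. -/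
noncomputable def induced : CochainComplex (ModuleCat (ZMod 2)) ℕ where
  X n := ModuleCat.of (ZMod 2) (E.Hloc n)
  d i j := ModuleCat.ofHom (E.Hg i j)
  shape i j hij := by
    have : E.Hg i j = 0 := by
      ext φ : 2
      simp only [Hg, LinearMap.comp_apply, Submodule.mkQ_apply, Submodule.mapQ_apply,
        LinearMap.zero_apply]
      have : E.gZ i j φ = 0 := Subtype.ext (by
        change E.g i j φ = 0
        rw [E.g_shape hij]; rfl)
      rw [this]; rfl
    rw [this]; rfl
  d_comp_d' i j k _ _ := by
    have : E.Hg j k ∘ₗ E.Hg i j = 0 := by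
      ext φ : 2
      simp only [Hg, LinearMap.comp_apply, Submodule.mkQ_apply, Submodule.mapQ_apply,
        LinearMap.zero_apply]
      have : E.gZ j k (E.gZ i j φ) = 0 := Subtype.ext (by
        change E.g j k (E.g i j φ) = 0
        exact LinearMap.congr_fun (E.g_comp i j k) φ)
      rw [this]; rfl
    rw [← ModuleCat.ofHom_comp, this]; rfl

end CodeEmbedding

/-- Names of the cells of the subdivided square complex: the old vertices, the cells inside an old
edge, and the cells inside an old square. -/
inductive Place (V : Type) : Type
  | vert (v : V) : Place V
  | edge (a b : V) (i : ℕ) : Place V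
  | sq (x z : V) (s : Sym2 (V × ℕ)) : Place V

namespace Place

variable {V : Type}

/-- The cell at position `i ∈ {0, …, ℓ - 1}` of the edge from `a` to `b`, subdivided into `(ℓ - 1) / 2`
edges: even positions are vertices, odd positions are the open edges between them. -/
def edgePt (ℓ : ℕ) (a b : V) (i : ℕ) : Place V :=
  if i = 0 then vert a else if i = ℓ - 1 then vert b else edge a b i

/-- The cell at position `(i, j) ∈ {0, …, ℓ - 1}²` of the square `(x, q, z, q')`, subdivided into
`(ℓ - 1) / 2 × (ℓ - 1) / 2` squares. The corners `x`, `q`, `z`, `q'` are at `(0, 0)`, `(ℓ - 1, 0)`,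
`(ℓ - 1, ℓ - 1)`, `(0, ℓ - 1)`; the dimension is the number of odd coordinates. Positions on the sides
get names that depend on the side only, so that squares with a common side or corner are glued. -/
def facePt (ℓ : ℕ) (x q z q' : V) (i j : ℕ) : Place V :=
  if j = 0 then edgePt ℓ x q i
  else if j = ℓ - 1 then edgePt ℓ q' z i
  else if i = 0 then edgePt ℓ x q' j
  else if i = ℓ - 1 then edgePt ℓ q z j
  else sq x z s((q, i), (q', j))

/-- The dimension of a cell. -/
def dim : Place V → ℕ
  | vert _ => 0
  | edge _ _ i => i % 2
  | sq _ _ s => Sym2.lift ⟨fun a b => a.2 % 2 + b.2 % 2, fun _ _ => Nat.add_comm _ _⟩ s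

end Place

namespace TannerComplex

open Place

variable (T : TannerComplex) (ℓ : ℕ)

/-- `c` is a face of `c'` of codimension one in the subdivision of `T`: both lie on a common edge, or
in a common square, and their positions differ by one in one coordinate, which is even for `c` and odd
for `c'`. (It suffices to move the first coordinate, as `(x, q', z, q)` is a face too.) -/
def Inc (c c' : Place T.V) : Prop :=
  (∃ a b i i', T.adj a b ∧ i ≤ ℓ - 1 ∧ i' ≤ ℓ - 1 ∧ Even i ∧ (i' = i + 1 ∨ i = i' + 1) ∧
    c = edgePt ℓ a b i ∧ c' = edgePt ℓ a b i') ∨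
  (∃ x q z q' i i' j, T.face x q z q' ∧ i ≤ ℓ - 1 ∧ i' ≤ ℓ - 1 ∧ Even i ∧ (i' = i + 1 ∨ i = i' + 1) ∧
    0 < j ∧ j < ℓ - 1 ∧ c = facePt ℓ x q z q' i j ∧ c' = facePt ℓ x q z q' i' j)

/-- The cells of the subdivided star `X'_v`: the squares around `v` if `v` is an `X`-check, the edges
from `v` to `Z`-checks if `v` is a qubit, the point `v` if `v` is a `Z`-check. -/
def InStar (v : T.V) (c : Place T.V) : Prop :=
  (∃ q z q' i j, T.face v q z q' ∧ i ≤ ℓ - 1 ∧ j ≤ ℓ - 1 ∧ c = facePt ℓ v q z q' i j) ∨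
  (T.deg v = 1 ∧ ∃ z j, T.adj v z ∧ j ≤ ℓ - 1 ∧ c = edgePt ℓ v z j) ∨
  (T.deg v = 2 ∧ c = vert v)

/-- The cells of the boundary `∂X'_v`: the subdivided edges opposite to `v` in the squares around `v`
if `v` is an `X`-check, the `Z`-checks next to `v` if `v` is a qubit, empty if `v` is a `Z`-check. -/
def InBdry (v : T.V) (c : Place T.V) : Prop :=
  (∃ q z q' j, T.face v q z q' ∧ j ≤ ℓ - 1 ∧ c = edgePt ℓ q z j) ∨
  (T.deg v = 1 ∧ ∃ z, T.adj v z ∧ c = vert z)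

/-- The cells of the local complexes
`Y_v = X'_v × {0} ⊔ X'_v × {1} ⊔ ∂X'_v × [0, 1] / ∼`, for all vertices `v` of `T`.
The coordinate `layer` is a cell of the interval `[0, 1]`: its end points are `0` and `2`, and `1` is
the open interval. -/
structure LocalCell where
  own : T.V
  pos : Place T.V
  layer : Fin 3
  mem_star : T.InStar ℓ own pos
  mem_bdry : layer = 1 → T.InBdry ℓ own pos

namespace LocalCell

variable {T ℓ}

@[ext]
theorem ext' {a b : T.LocalCell ℓ} (h1 : a.own = b.own) (h2 : a.pos = b.pos)
    (h3 : a.layer = b.layer) : a = b := by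
  cases a; cases b; cases h1; cases h2; cases h3; rfl

/-- The cochain degree of a cell: its dimension in `Y_v`, shifted by the degree of `v`. -/
def deg (a : T.LocalCell ℓ) : ℕ :=
  T.deg a.own + a.pos.dim + if a.layer = 1 then 1 else 0

/-- Incidence in the local complexes `Y_v` (first part), and the connecting maps (second part):
restriction of cochains along the inclusions `Y_q ⊆ Y_x` and `Y_z ⊆ Y_q` for adjacent vertices. -/
def adj (a b : T.LocalCell ℓ) : Prop :=
  (a.own = b.own ∧ ((T.Inc ℓ a.pos b.pos ∧ a.layer = b.layer) ∨
    (a.pos = b.pos ∧ a.layer ≠ 1 ∧ b.layer = 1))) ∨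
  (T.adj a.own b.own ∧ a.pos = b.pos ∧ a.layer = b.layer)

end LocalCell

section Lemmas

variable {T ℓ}

theorem adj_ne {a b : T.V} (h : T.adj a b) : a ≠ b := CodeEmbedding.own_ne_of_adj h

theorem face_corners {x q z q' : T.V} (h : T.face x q z q') :
    x ≠ q ∧ x ≠ q' ∧ q ≠ z ∧ q' ≠ z ∧ x ≠ z ∧ q ≠ q' ∧ T.deg x = 0 ∧ T.deg q = 1 ∧ T.deg q' = 1 ∧
      T.deg z = 2 := by
  obtain ⟨h1, h2, h3, h4⟩ := T.face_adj _ _ _ _ h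
  have e1 := T.adj_deg _ _ h1
  have e2 := T.adj_deg _ _ h2
  have e3 := T.adj_deg _ _ h3
  have e4 := T.adj_deg _ _ h4
  have e5 := T.deg_le z
  refine ⟨adj_ne h1, adj_ne h3, adj_ne h2, adj_ne h4, ?_, T.face_ne _ _ _ _ h, by omega, by omega,
    by omega, by omega⟩
  rintro rfl
  omega

theorem facePt_swap (x q z q' : T.V) (i j : ℕ) (hℓ : 3 ≤ ℓ) :
    facePt ℓ x q' z q j i = facePt ℓ x q z q' i j := by
  unfold facePt edgePt
  split_ifs <;> first | rfl | omega | simp [Sym2.eq_swap]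

theorem facePt_zero (x q z q' : T.V) (j : ℕ) (hℓ : 3 ≤ ℓ) :
    facePt ℓ x q z q' 0 j = edgePt ℓ x q' j := by
  unfold facePt edgePt
  split_ifs <;> first | rfl | omega

theorem facePt_last (x q z q' : T.V) (j : ℕ) (hℓ : 3 ≤ ℓ) :
    facePt ℓ x q z q' (ℓ - 1) j = edgePt ℓ q z j := by
  unfold facePt edgePt
  split_ifs <;> first | rfl | omega

theorem facePt_bot (x q z q' : T.V) (i : ℕ) : facePt ℓ x q z q' i 0 = edgePt ℓ x q i := by
  simp [facePt]

theorem facePt_top (x q z q' : T.V) (i : ℕ) (hℓ : 3 ≤ ℓ) :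
    facePt ℓ x q z q' i (ℓ - 1) = edgePt ℓ q' z i := by
  rw [← facePt_swap _ _ _ _ _ _ hℓ, facePt_last _ _ _ _ _ hℓ]

theorem facePt_mid (x q z q' : T.V) {i j : ℕ} (hi : 0 < i) (hi' : i < ℓ - 1) (hj : 0 < j)
    (hj' : j < ℓ - 1) : facePt ℓ x q z q' i j = sq x z s((q, i), (q', j)) := by
  unfold facePt
  split_ifs <;> first | rfl | omega

theorem edgePt_mid (a b : T.V) {i : ℕ} (hi : 0 < i) (hi' : i < ℓ - 1) :
    edgePt ℓ a b i = edge a b i := by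
  unfold edgePt
  split_ifs <;> first | rfl | omega

theorem dim_edgePt (hℓ : Odd ℓ) (a b : T.V) (i : ℕ) : (edgePt ℓ a b i).dim = i % 2 := by
  obtain ⟨k, rfl⟩ := hℓ
  unfold edgePt
  split_ifs <;> simp only [dim] <;> omega

theorem dim_facePt (hℓ : Odd ℓ) (x q z q' : T.V) (i j : ℕ) :
    (facePt ℓ x q z q' i j).dim = i % 2 + j % 2 := by
  unfold facePt
  have := hℓ
  obtain ⟨k, rfl⟩ := hℓ
  split_ifs <;> first | (rw [dim_edgePt this]; omega) | simp [dim, Sym2.lift_mk]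

theorem facePt_inj {x q z q' : T.V} (h : T.face x q z q') {i j i' j' : ℕ} (hℓ : 3 ≤ ℓ)
    (e : facePt ℓ x q z q' i j = facePt ℓ x q z q' i' j') : i = i' ∧ j = j' := by
  obtain ⟨h1, h2, h3, h4, h5, h6, -⟩ := face_corners h
  unfold facePt edgePt at e
  split_ifs at e <;> simp_all

theorem facePt_eq_edge {x q z q' a b : T.V} {i j k : ℕ}
    (e : facePt ℓ x q z q' i j = edge a b k) :
    (a = x ∧ b = q) ∨ (a = q' ∧ b = z) ∨ (a = x ∧ b = q') ∨ (a = q ∧ b = z) := by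
  unfold facePt edgePt at e
  split_ifs at e <;> simp_all

theorem inc_dim (hℓ : Odd ℓ) {c c' : Place T.V} (h : T.Inc ℓ c c') : c'.dim = c.dim + 1 := by
  rcases h with ⟨a, b, i, i', -, -, -, ⟨k, rfl⟩, h, rfl, rfl⟩ |
    ⟨x, q, z, q', i, i', j, -, -, -, ⟨k, rfl⟩, h, -, -, rfl, rfl⟩
  · rw [dim_edgePt hℓ, dim_edgePt hℓ]; omega
  · rw [dim_facePt hℓ, dim_facePt hℓ]; omega

/-- The cells below an edge cell. -/
theorem inc_edge (hℓ : Odd ℓ) {c : Place T.V} {a b : T.V} {k : ℕ} (h : T.Inc ℓ c (edge a b k)) :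
    T.adj a b ∧ 0 < k ∧ k < ℓ - 1 ∧ ∃ i, i ≤ ℓ - 1 ∧ Even i ∧ (k = i + 1 ∨ i = k + 1) ∧
      c = edgePt ℓ a b i := by
  rcases h with ⟨a', b', i, i', h1, h2, h3, h4, h5, rfl, h6⟩ |
    ⟨x, q, z, q', i, i', j, h1, h2, h3, h4, h5, h6, h7, rfl, h8⟩
  · have : 0 < i' ∧ i' < ℓ - 1 := by
      obtain ⟨r, rfl⟩ := hℓ
      obtain ⟨s, rfl⟩ := h4
      omega
    rw [edgePt_mid _ _ this.1 this.2] at h6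
    cases h6
    exact ⟨h1, this.1, this.2, i, h2, h4, h5, rfl⟩
  · have : 0 < i' ∧ i' < ℓ - 1 := by
      obtain ⟨r, rfl⟩ := hℓ
      obtain ⟨s, rfl⟩ := h4
      omega
    rw [facePt_mid _ _ _ _ this.1 this.2 h6 h7] at h8
    cases h8

/-- The cells below a cell in the interior of a square. -/
theorem inc_sq (hℓ : Odd ℓ) {c : Place T.V} {x z : T.V} {s : Sym2 (T.V × ℕ)}
    (h : T.Inc ℓ c (sq x z s)) :
    ∃ q q' i i' j, T.face x q z q' ∧ i ≤ ℓ - 1 ∧ Even i ∧ (i' = i + 1 ∨ i = i' + 1) ∧ 0 < i' ∧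
      i' < ℓ - 1 ∧ 0 < j ∧ j < ℓ - 1 ∧ c = facePt ℓ x q z q' i j ∧ s = s((q, i'), (q', j)) := by
  rcases h with ⟨a', b', i, i', h1, h2, h3, h4, h5, rfl, h6⟩ |
    ⟨x', q, z', q', i, i', j, h1, h2, h3, h4, h5, h6, h7, rfl, h8⟩
  · unfold edgePt at h6
    split_ifs at h6
  · have : 0 < i' ∧ i' < ℓ - 1 := by
      obtain ⟨r, rfl⟩ := hℓ
      obtain ⟨s, rfl⟩ := h4
      omega
    rw [facePt_mid _ _ _ _ this.1 this.2 h6 h7] at h8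
    cases h8
    exact ⟨q, q', i, i', j, h1, h2, h4, h5, this.1, this.2, h6, h7, rfl, rfl⟩

theorem inc_vert (hℓ : Odd ℓ) {c : Place T.V} {v : T.V} (h : T.Inc ℓ c (vert v)) : False := by
  have := inc_dim hℓ h
  simp [dim] at this

/-- A path of length two in the face poset lies in a single small square. -/
theorem inc_inc (hℓ : Odd ℓ ∧ 3 ≤ ℓ) {c b d : Place T.V} (h1 : T.Inc ℓ c b) (h2 : T.Inc ℓ b d) :
    ∃ x q z q' i i' j j', T.face x q z q' ∧ i ≤ ℓ - 1 ∧ j ≤ ℓ - 1 ∧ Even i ∧ Even j ∧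
      (i' = i + 1 ∨ i = i' + 1) ∧ (j' = j + 1 ∨ j = j' + 1) ∧ 0 < i' ∧ i' < ℓ - 1 ∧ 0 < j' ∧
      j' < ℓ - 1 ∧ c = facePt ℓ x q z q' i j ∧ b = facePt ℓ x q z q' i j' ∧
      d = sq x z s((q, i'), (q', j')) := by
  cases d with
  | vert v => exact (inc_vert hℓ.1 h2).elim
  | edge a a' k =>
    obtain ⟨-, -, -, i, -, hi, -, rfl⟩ := inc_edge hℓ.1 h2
    have := inc_dim hℓ.1 h1
    rw [dim_edgePt hℓ.1] at this
    obtain ⟨r, rfl⟩ := hi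
    omega
  | sq x z s =>
    obtain ⟨q, q', i, i', j', hf, hi, hie, hii, hi1, hi2, hj1, hj2, rfl, rfl⟩ := inc_sq hℓ.1 h2
    have hjo := inc_dim hℓ.1 h1
    rw [dim_facePt hℓ.1] at hjo
    have hj : j' % 2 = 1 := by
      obtain ⟨r, rfl⟩ := hie
      omega
    rcases Nat.eq_zero_or_pos i with rfl | hi0
    · rw [facePt_zero _ _ _ _ _ hℓ.2, edgePt_mid _ _ hj1 hj2] at h1
      obtain ⟨-, -, -, j, hj3, hj4, hj5, rfl⟩ := inc_edge hℓ.1 h1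
      exact ⟨x, q, z, q', 0, i', j, j', hf, hi, hj3, hie, hj4, hii, hj5, hi1, hi2, hj1, hj2,
        (facePt_zero _ _ _ _ _ hℓ.2).symm, rfl, rfl⟩
    rcases eq_or_lt_of_le hi with rfl | hil
    · rw [facePt_last _ _ _ _ _ hℓ.2, edgePt_mid _ _ hj1 hj2] at h1
      obtain ⟨-, -, -, j, hj3, hj4, hj5, rfl⟩ := inc_edge hℓ.1 h1
      exact ⟨x, q, z, q', ℓ - 1, i', j, j', hf, hi, hj3, hie, hj4, hii, hj5, hi1, hi2, hj1, hj2,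
        (facePt_last _ _ _ _ _ hℓ.2).symm, rfl, rfl⟩
    rw [facePt_mid _ _ _ _ hi0 hil hj1 hj2] at h1
    obtain ⟨p, p', k, k', l, hf', hk, hke, hkk, hk1, hk2, hl1, hl2, rfl, hs⟩ := inc_sq hℓ.1 h1
    rw [Sym2.eq_iff] at hs
    rcases hs with ⟨hs1, hs2⟩ | ⟨hs1, hs2⟩
    · cases hs1
      obtain ⟨r, rfl⟩ := hie
      obtain ⟨r', rfl⟩ := hke
      omega
    · cases hs1
      cases hs2
      exact ⟨x, q, z, q', i, i', k, j', hf, hi, hk, hie, hke, hii, hkk, hi1, hi2, hj1, hj2,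
        facePt_swap _ _ _ _ _ _ hℓ.2, rfl, rfl⟩

/-- Each path of length two in the face poset has exactly one partner. -/
theorem inc_diamond (hℓ : Odd ℓ ∧ 3 ≤ ℓ) {c b d : Place T.V} (h1 : T.Inc ℓ c b)
    (h2 : T.Inc ℓ b d) :
    ∃ b', b' ≠ b ∧ T.Inc ℓ c b' ∧ T.Inc ℓ b' d ∧
      ∀ b₂, T.Inc ℓ c b₂ → T.Inc ℓ b₂ d → b₂ = b ∨ b₂ = b' := by
  obtain ⟨x, q, z, q', i, i', j, j', hf, hi, hj, hie, hje, hii, hjj, hi1, hi2, hj1, hj2, rfl, rfl, rfl⟩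
    := inc_inc hℓ h1 h2
  refine ⟨facePt ℓ x q z q' i' j, ?_, ?_, ?_, ?_⟩
  · intro h
    have := (facePt_inj hf hℓ.2 h).1
    omega
  · rcases Nat.eq_zero_or_pos j with rfl | hj0
    · refine Or.inl ⟨x, q, i, i', (T.face_adj _ _ _ _ hf).1, hi, hi2.le, hie, hii, ?_, ?_⟩ <;>
        rw [facePt_bot]
    rcases eq_or_lt_of_le hj with rfl | hjl
    · refine Or.inl ⟨q', z, i, i', (T.face_adj _ _ _ _ hf).2.2.2, hi, hi2.le, hie, hii, ?_, ?_⟩ <;>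
        rw [facePt_top _ _ _ _ _ hℓ.2]
    · exact Or.inr ⟨x, q, z, q', i, i', j, hf, hi, hi2.le, hie, hii, hj0, hjl, rfl, rfl⟩
  · refine Or.inr ⟨x, q', z, q, j, j', i', T.face_symm _ _ _ _ hf, hj, hj2.le, hje, hjj, hi1, hi2,
      (facePt_swap _ _ _ _ _ _ hℓ.2).symm, ?_⟩
    rw [facePt_swap _ _ _ _ _ _ hℓ.2, facePt_mid _ _ _ _ hi1 hi2 hj1 hj2]
  · intro b₂ h3 h4
    obtain ⟨x₂, p, z₂, p', k, k', l, l', hf', hk, hl, hke, hle, hkk, hll, hk1, hk2, hl1, hl2, hc, rfl,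
      hd⟩ := inc_inc hℓ h3 h4
    injection hd with hx hz hs
    subst hx hz
    rw [Sym2.eq_iff] at hs
    rcases hs with ⟨hs1, hs2⟩ | ⟨hs1, hs2⟩
    · cases hs1
      cases hs2
      obtain ⟨rfl, rfl⟩ := facePt_inj hf hℓ.2 hc
      exact Or.inl rfl
    · cases hs1
      cases hs2
      rw [← facePt_swap _ _ _ _ i j hℓ.2] at hc
      have hf := T.face_symm _ _ _ _ hf
      obtain ⟨rfl, rfl⟩ := facePt_inj hf hℓ.2 hc
      exact Or.inr (facePt_swap _ _ _ _ _ _ hℓ.2)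

theorem InStar.of_inc (hℓ : Odd ℓ ∧ 3 ≤ ℓ) {v : T.V} {c d : Place T.V} (h : T.Inc ℓ c d)
    (hd : T.InStar ℓ v d) : T.InStar ℓ v c := by
  cases d with
  | vert w => exact (inc_vert hℓ.1 h).elim
  | edge a b k =>
    obtain ⟨hab, -, -, i, hi, -, -, rfl⟩ := inc_edge hℓ.1 h
    rcases hd with ⟨q, z, q', k, l, hf, -, -, hd⟩ | ⟨hv, z, j, hz, -, hd⟩ | ⟨-, hd⟩
    · rcases facePt_eq_edge hd.symm with ⟨rfl, rfl⟩ | ⟨rfl, rfl⟩ | ⟨rfl, rfl⟩ | ⟨rfl, rfl⟩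
      · exact Or.inl ⟨_, _, _, i, 0, hf, hi, Nat.zero_le _, (facePt_bot _ _ _ _ _).symm⟩
      · exact Or.inl ⟨_, _, _, i, ℓ - 1, hf, hi, le_rfl, (facePt_top _ _ _ _ _ hℓ.2).symm⟩
      · exact Or.inl ⟨_, _, _, 0, i, hf, Nat.zero_le _, hi, (facePt_zero _ _ _ _ _ hℓ.2).symm⟩
      · exact Or.inl ⟨_, _, _, ℓ - 1, i, hf, le_rfl, hi, (facePt_last _ _ _ _ _ hℓ.2).symm⟩
    · unfold edgePt at hd
      split_ifs at hd
      cases hd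
      exact Or.inr (Or.inl ⟨hv, _, i, hz, hi, rfl⟩)
    · cases hd
  | sq x z s =>
    obtain ⟨q, q', i, i', j, hf, hi, -, -, -, -, -, hj, rfl, rfl⟩ := inc_sq hℓ.1 h
    have hx : v = x := by
      rcases hd with ⟨p, w, p', k, l, -, -, -, hd⟩ | ⟨-, w, l, -, -, hd⟩ | ⟨-, hd⟩
      · unfold facePt edgePt at hd
        split_ifs at hd
        injection hd with h1
        exact h1.symm
      · unfold edgePt at hd
        split_ifs at hd
      · cases hd
    subst hx
    exact Or.inl ⟨q, z, q', i, j, hf, hi, hj.le, rfl⟩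

theorem InBdry.of_inc (hℓ : Odd ℓ ∧ 3 ≤ ℓ) {v : T.V} {c d : Place T.V} (h : T.Inc ℓ c d)
    (hd : T.InBdry ℓ v d) : T.InBdry ℓ v c := by
  rcases hd with ⟨q, z, q', j, hf, -, rfl⟩ | ⟨-, z, -, rfl⟩
  · unfold edgePt at h
    split_ifs at h
    · exact (inc_vert hℓ.1 h).elim
    · exact (inc_vert hℓ.1 h).elim
    · obtain ⟨-, -, -, i, hi, -, -, rfl⟩ := inc_edge hℓ.1 h
      exact Or.inl ⟨q, z, q', i, hf, hi, rfl⟩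
  · exact (inc_vert hℓ.1 h).elim

theorem InBdry.inStar (hℓ : Odd ℓ ∧ 3 ≤ ℓ) {v : T.V} {c : Place T.V} (h : T.InBdry ℓ v c) :
    T.InStar ℓ v c := by
  rcases h with ⟨q, z, q', j, hf, hj, rfl⟩ | ⟨hv, z, hz, rfl⟩
  · exact Or.inl ⟨q, z, q', ℓ - 1, j, hf, le_rfl, hj, (facePt_last _ _ _ _ _ hℓ.2).symm⟩
  · refine Or.inr (Or.inl ⟨hv, z, ℓ - 1, hz, le_rfl, ?_⟩)
    unfold edgePt
    split_ifs <;> first | rfl | omega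

/-- `X'_w ⊆ ∂X'_v` for `v` adjacent to `w`. -/
theorem InStar.inBdry (hℓ : Odd ℓ ∧ 3 ≤ ℓ) {v w : T.V} {c : Place T.V} (hvw : T.adj v w)
    (h : T.InStar ℓ w c) : T.InBdry ℓ v c := by
  have h1 := T.adj_deg _ _ hvw
  rcases h with ⟨q, z, q', i, j, hf, -⟩ | ⟨hw, z, j, hz, hj, rfl⟩ | ⟨hw, rfl⟩
  · have := (face_corners hf).2.2.2.2.2.2.1
    omega
  · obtain ⟨q', hf⟩ := T.face_cover _ _ _ hvw hz
    exact Or.inl ⟨w, z, q', j, hf, hj, rfl⟩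
  · exact Or.inr ⟨by omega, w, hvw, rfl⟩

theorem InStar.dim_le (hℓ : Odd ℓ ∧ 3 ≤ ℓ) {v : T.V} {c : Place T.V} (h : T.InStar ℓ v c) :
    T.deg v + c.dim ≤ 2 := by
  rcases h with ⟨q, z, q', i, j, hf, -, -, rfl⟩ | ⟨hw, z, j, hz, hj, rfl⟩ | ⟨hw, rfl⟩
  · have := (face_corners hf).2.2.2.2.2.2.1
    rw [dim_facePt hℓ.1]
    omega
  · rw [dim_edgePt hℓ.1]
    omega
  · simp [dim, hw]

theorem InBdry.dim_le (hℓ : Odd ℓ ∧ 3 ≤ ℓ) {v : T.V} {c : Place T.V} (h : T.InBdry ℓ v c) :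
    T.deg v + c.dim ≤ 1 := by
  rcases h with ⟨q, z, q', j, hf, hj, rfl⟩ | ⟨hv, z, hz, rfl⟩
  · have := (face_corners hf).2.2.2.2.2.2.1
    rw [dim_edgePt hℓ.1]
    omega
  · simp [dim, hv]

theorem finite_star (hℓ : Odd ℓ ∧ 3 ≤ ℓ) : {c | ∃ v, T.InStar ℓ v c}.Finite := by
  refine (((Set.finite_range fun p : T.V × T.V × T.V × T.V × Fin ℓ × Fin ℓ =>
      facePt ℓ p.1 p.2.1 p.2.2.1 p.2.2.2.1 p.2.2.2.2.1 p.2.2.2.2.2).union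
    (Set.finite_range fun p : T.V × T.V × Fin ℓ => edgePt ℓ p.1 p.2.1 p.2.2)).union
    (Set.finite_range fun v : T.V => (vert v : Place T.V))).subset ?_
  rintro c ⟨v, ⟨q, z, q', i, j, -, hi, hj, rfl⟩ | ⟨-, z, j, -, hj, rfl⟩ | ⟨-, rfl⟩⟩
  · exact Or.inl (Or.inl ⟨⟨v, q, z, q', ⟨i, by omega⟩, ⟨j, by omega⟩⟩, rfl⟩)
  · exact Or.inl (Or.inr ⟨⟨v, z, ⟨j, by omega⟩⟩, rfl⟩)
  · exact Or.inr ⟨v, rfl⟩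

namespace LocalCell

theorem finite (hℓ : Odd ℓ ∧ 3 ≤ ℓ) : Finite (T.LocalCell ℓ) := by
  have : Finite {c : Place T.V | ∃ v, T.InStar ℓ v c} := (finite_star hℓ).to_subtype
  refine Finite.of_injective (β := T.V × {c : Place T.V | ∃ v, T.InStar ℓ v c} × Fin 3)
    (fun a => (a.own, ⟨a.pos, a.own, a.mem_star⟩, a.layer)) fun a b h => ?_
  simp only [Prod.mk.injEq, Subtype.mk.injEq] at h
  exact LocalCell.ext' h.1 h.2.1 h.2.2

theorem deg_le (hℓ : Odd ℓ ∧ 3 ≤ ℓ) (a : T.LocalCell ℓ) : a.deg ≤ 2 := by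
  unfold deg
  split_ifs with h
  · have := (a.mem_bdry h).dim_le hℓ
    omega
  · exact a.mem_star.dim_le hℓ

theorem adj_deg (hℓ : Odd ℓ ∧ 3 ≤ ℓ) {a b : T.LocalCell ℓ} (h : a.adj b) : b.deg = a.deg + 1 := by
  unfold deg
  rcases h with ⟨h1, ⟨h2, h3⟩ | ⟨h2, h3, h4⟩⟩ | ⟨h1, h2, h3⟩
  · rw [h1, h3, inc_dim hℓ.1 h2]
    omega
  · rw [h1, h2, if_neg h3, if_pos h4]
  · rw [T.adj_deg _ _ h1, h2, h3]
    omega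

theorem own_adj {a b : T.LocalCell ℓ} (h : a.adj b) : a.own = b.own ∨ T.adj a.own b.own :=
  h.imp And.left And.left

theorem adj_local {a b : T.LocalCell ℓ} (h : a.own = b.own) (hab : a.adj b) :
    (T.Inc ℓ a.pos b.pos ∧ a.layer = b.layer) ∨ (a.pos = b.pos ∧ a.layer ≠ 1 ∧ b.layer = 1) := by
  rcases hab with h1 | h1
  · exact h1.2
  · exact absurd h (adj_ne h1.1)

theorem adj_connect {a b : T.LocalCell ℓ} (h : T.adj a.own b.own) (hab : a.adj b) :
    a.pos = b.pos ∧ a.layer = b.layer := by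
  rcases hab with h1 | h1
  · exact absurd h1.1 (adj_ne h)
  · exact h1.2

theorem inc_irrefl (hℓ : Odd ℓ) (c : Place T.V) : ¬ T.Inc ℓ c c := fun h => by
  have := inc_dim hℓ h
  omega

/-- A path of length two has exactly one partner, unless it passes through three local complexes. -/
theorem diamond (hℓ : Odd ℓ ∧ 3 ≤ ℓ) {a b c : T.LocalCell ℓ} (h1 : a.adj b) (h2 : b.adj c)
    (h : ¬ (T.adj a.own b.own ∧ T.adj b.own c.own)) :
    ∃ b', b' ≠ b ∧ a.adj b' ∧ b'.adj c ∧ ∀ b₂, a.adj b₂ → b₂.adj c → b₂ = b ∨ b₂ = b' := by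
  rcases h1 with ⟨e1, h1⟩ | ⟨e1, p1, l1⟩
  · rcases h2 with ⟨e2, h2⟩ | ⟨e2, p2, l2⟩
    · -- all three cells in the same local complex
      have own_eq : ∀ b₂ : T.LocalCell ℓ, a.adj b₂ → b₂.adj c → a.own = b₂.own ∧ b₂.own = c.own := by
        intro b₂ h3 h4
        rcases own_adj h3 with h5 | h5
        · exact ⟨h5, h5 ▸ e1.trans e2⟩
        · have h6 := T.adj_deg _ _ h5
          rcases own_adj h4 with h7 | h7
          · rw [h7, ← e2, ← e1] at h6; omega
          · have h8 := T.adj_deg _ _ h7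
            rw [← e2, ← e1] at h8; omega
      rcases h1 with ⟨i1, l1⟩ | ⟨p1, l1, l1'⟩
      · rcases h2 with ⟨i2, l2⟩ | ⟨p2, l2, l2'⟩
        · obtain ⟨p, hp1, hp2, hp3, hp4⟩ := inc_diamond hℓ i1 i2
          refine ⟨⟨a.own, p, a.layer, ?_, ?_⟩, ?_, Or.inl ⟨rfl, Or.inl ⟨hp2, rfl⟩⟩,
            Or.inl ⟨e1.trans e2, Or.inl ⟨hp3, l1.trans l2⟩⟩, ?_⟩
          · rw [e1.trans e2]
            exact c.mem_star.of_inc hℓ hp3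
          · intro hl
            rw [e1.trans e2]
            exact (c.mem_bdry (by rw [← l2, ← l1, hl])).of_inc hℓ hp3
          · exact fun e => hp1 (congrArg pos e)
          · intro b₂ h3 h4
            obtain ⟨o1, o2⟩ := own_eq b₂ h3 h4
            rcases adj_local o1 h3 with ⟨i3, l3⟩ | ⟨p3, l3, l3'⟩
            · rcases adj_local o2 h4 with ⟨i4, l4⟩ | ⟨p4, l4, l4'⟩
              · rcases hp4 _ i3 i4 with h5 | h5
                · exact Or.inl (LocalCell.ext' (o1.symm.trans e1) h5 (l3.symm.trans l1))
                · exact Or.inr (LocalCell.ext' o1.symm h5 l3.symm)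
              · exact absurd (by rw [← l3, l1, l2, l4']) l4
            · rcases adj_local o2 h4 with ⟨i4, l4⟩ | ⟨p4, l4, l4'⟩
              · exact absurd (by rw [l1, l2, ← l4, l3']) l3
              · exact absurd l3' l4
        · refine ⟨⟨a.own, a.pos, 1, a.mem_star, fun _ => ?_⟩, ?_,
            Or.inl ⟨rfl, Or.inr ⟨rfl, by rw [l1]; exact l2, rfl⟩⟩,
            Or.inl ⟨e1.trans e2, Or.inl ⟨p2 ▸ i1, l2'.symm⟩⟩, ?_⟩
          · rw [e1.trans e2]
            exact (c.mem_bdry l2').of_inc hℓ (p2 ▸ i1)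
          · exact fun e => l2 (congrArg layer e).symm
          · intro b₂ h3 h4
            obtain ⟨o1, o2⟩ := own_eq b₂ h3 h4
            rcases adj_local o1 h3 with ⟨i3, l3⟩ | ⟨p3, l3, l3'⟩
            · rcases adj_local o2 h4 with ⟨i4, l4⟩ | ⟨p4, l4, l4'⟩
              · exact absurd (by rw [← l1, l3, l4, l2']) l2
              · exact Or.inl (LocalCell.ext' (o1.symm.trans e1) (p4.trans p2.symm) (l3.symm.trans l1))
            · exact Or.inr (LocalCell.ext' o1.symm p3.symm l3')
      · rcases h2 with ⟨i2, l2⟩ | ⟨p2, l2, l2'⟩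
        · refine ⟨⟨a.own, c.pos, a.layer, ?_, fun hl => absurd hl l1⟩, ?_,
            Or.inl ⟨rfl, Or.inl ⟨p1.symm ▸ i2, rfl⟩⟩,
            Or.inl ⟨e1.trans e2, Or.inr ⟨rfl, l1, l2 ▸ l1'⟩⟩, ?_⟩
          · rw [e1.trans e2]
            exact c.mem_star
          · exact fun e => l1 ((congrArg layer e).trans l1')
          · intro b₂ h3 h4
            obtain ⟨o1, o2⟩ := own_eq b₂ h3 h4
            rcases adj_local o1 h3 with ⟨i3, l3⟩ | ⟨p3, l3, l3'⟩
            · rcases adj_local o2 h4 with ⟨i4, l4⟩ | ⟨p4, l4, l4'⟩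
              · exact absurd (by rw [l3, l4, ← l2, l1']) l1
              · exact Or.inr (LocalCell.ext' o1.symm p4 l3.symm)
            · exact Or.inl (LocalCell.ext' (o1.symm.trans e1) (p3.symm.trans p1) (l3'.trans l1'.symm))
        · exact absurd l1' l2
    · -- a local step, then a connecting step
      refine ⟨⟨c.own, a.pos, a.layer, ?_, ?_⟩, ?_, Or.inr ⟨e1 ▸ e2, rfl, rfl⟩, Or.inl ⟨rfl, ?_⟩, ?_⟩
      · rcases h1 with ⟨i1, l1⟩ | ⟨p1, l1, l1'⟩
        · exact c.mem_star.of_inc hℓ (p2 ▸ i1)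
        · rw [p1, p2]; exact c.mem_star
      · intro hl
        rcases h1 with ⟨i1, l1⟩ | ⟨p1, l1, l1'⟩
        · exact (c.mem_bdry (by rw [← l2, ← l1, hl])).of_inc hℓ (p2 ▸ i1)
        · exact absurd hl l1
      · exact fun e => adj_ne e2 (congrArg own e).symm
      · change (T.Inc ℓ a.pos c.pos ∧ a.layer = c.layer) ∨ (a.pos = c.pos ∧ a.layer ≠ 1 ∧ c.layer = 1)
        rw [← p2, ← l2]; exact h1
      · intro b₂ h3 h4
        rcases own_adj h3 with o1 | o1
        · have o2 : T.adj b₂.own c.own := by rw [← o1, e1]; exact e2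
          obtain ⟨p4, l4⟩ := adj_connect o2 h4
          exact Or.inl (LocalCell.ext' (o1.symm.trans e1) (p4.trans p2.symm) (l4.trans l2.symm))
        · obtain ⟨p3, l3⟩ := adj_connect o1 h3
          rcases own_adj h4 with o2 | o2
          · exact Or.inr (LocalCell.ext' o2 p3.symm l3.symm)
          · have d1 := T.adj_deg _ _ o1
            have d2 := T.adj_deg _ _ o2
            have d3 := T.adj_deg _ _ e2
            rw [← e1] at d3
            omega
  · rcases h2 with ⟨e2, h2⟩ | ⟨e2, p2, l2⟩
    · -- a connecting step, then a local step
      have e3 : T.adj a.own c.own := e2 ▸ e1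
      refine ⟨⟨a.own, c.pos, c.layer, ?_, ?_⟩, ?_, Or.inl ⟨rfl, ?_⟩, Or.inr ⟨e3, rfl, rfl⟩, ?_⟩
      · exact (c.mem_star.inBdry hℓ e3).inStar hℓ
      · exact fun _ => c.mem_star.inBdry hℓ e3
      · exact fun e => adj_ne e1 (by have := congrArg own e; exact this)
      · change (T.Inc ℓ a.pos c.pos ∧ a.layer = c.layer) ∨ (a.pos = c.pos ∧ a.layer ≠ 1 ∧ c.layer = 1)
        rw [p1, l1]; exact h2
      · intro b₂ h3 h4
        rcases own_adj h3 with o1 | o1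
        · have o2 : T.adj b₂.own c.own := by rw [← o1]; exact e3
          obtain ⟨p4, l4⟩ := adj_connect o2 h4
          exact Or.inr (LocalCell.ext' o1.symm p4 l4)
        · obtain ⟨p3, l3⟩ := adj_connect o1 h3
          rcases own_adj h4 with o2 | o2
          · exact Or.inl (LocalCell.ext' (o2.trans e2.symm) (p3.symm.trans p1) (l3.symm.trans l1))
          · have d1 := T.adj_deg _ _ o1
            have d2 := T.adj_deg _ _ o2
            have d3 := T.adj_deg _ _ e3
            omega
    · exact absurd ⟨e1, e2⟩ h

/-- A path through three local complexes stays at one place, and can be moved to every other common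
neighbour of the outer two vertices. -/
theorem through (hℓ : Odd ℓ ∧ 3 ≤ ℓ) {a b c : T.LocalCell ℓ} (h1 : a.adj b) (h2 : b.adj c)
    (e1 : T.adj a.own b.own) (e2 : T.adj b.own c.own) {v : T.V} (v1 : T.adj a.own v)
    (v2 : T.adj v c.own) :
    ∃ b' : T.LocalCell ℓ, b'.own = v ∧ b'.pos = a.pos ∧ b'.layer = a.layer ∧ a.adj b' ∧ b'.adj c := by
  obtain ⟨p1, l1⟩ := adj_connect e1 h1
  obtain ⟨p2, l2⟩ := adj_connect e2 h2
  refine ⟨⟨v, a.pos, a.layer, ?_, ?_⟩, rfl, rfl, rfl, Or.inr ⟨v1, rfl, rfl⟩,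
    Or.inr ⟨v2, p1.trans p2, l1.trans l2⟩⟩
  · rw [p1.trans p2]
    exact (c.mem_star.inBdry hℓ v2).inStar hℓ
  · intro _
    rw [p1.trans p2]
    exact c.mem_star.inBdry hℓ v2

theorem through_own {a b c b₂ : T.LocalCell ℓ} (e1 : T.adj a.own b.own)
    (e2 : T.adj b.own c.own) (h3 : a.adj b₂) (h4 : b₂.adj c) :
    T.adj a.own b₂.own ∧ T.adj b₂.own c.own := by
  have d1 := T.adj_deg _ _ e1
  have d2 := T.adj_deg _ _ e2
  rcases own_adj h3 with o1 | o1
  · rcases own_adj h4 with o2 | o2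
    · rw [o1, o2] at d1; omega
    · have := T.adj_deg _ _ o2
      rw [← o1] at this; omega
  · rcases own_adj h4 with o2 | o2
    · have := T.adj_deg _ _ o1
      rw [o2] at this; omega
    · exact ⟨o1, o2⟩

theorem even_common (hℓ : Odd ℓ ∧ 3 ≤ ℓ) (a c : T.LocalCell ℓ) :
    Even (Nat.card {b : T.LocalCell ℓ // a.adj b ∧ b.adj c}) := by
  classical
  by_cases h : ∃ b, a.adj b ∧ b.adj c
  · obtain ⟨b, h1, h2⟩ := h
    by_cases hb : T.adj a.own b.own ∧ T.adj b.own c.own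
    · rw [Nat.card_congr (β := {v // T.adj a.own v ∧ T.adj v c.own})]
      · exact T.even_common _ _
      · refine Equiv.ofBijective (fun b₂ => ⟨b₂.1.own, through_own hb.1 hb.2 b₂.2.1 b₂.2.2⟩) ⟨?_, ?_⟩
        · rintro ⟨b₂, h3, h4⟩ ⟨b₃, h5, h6⟩ e
          simp only [Subtype.mk.injEq] at e
          have h7 := adj_connect (through_own hb.1 hb.2 h3 h4).1 h3
          have h8 := adj_connect (through_own hb.1 hb.2 h5 h6).1 h5
          exact Subtype.ext (LocalCell.ext' e (h7.1.symm.trans h8.1) (h7.2.symm.trans h8.2))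
        · rintro ⟨v, h3, h4⟩
          obtain ⟨b', o, -, -, h5, h6⟩ := through hℓ h1 h2 hb.1 hb.2 h3 h4
          exact ⟨⟨b', h5, h6⟩, Subtype.ext o⟩
    · obtain ⟨b', h3, h4, h5, h6⟩ := diamond hℓ h1 h2 hb
      have : {b : T.LocalCell ℓ | a.adj b ∧ b.adj c} = {b, b'} := by
        ext b₂
        simp only [Set.mem_ofPred_eq, Set.mem_insert_iff, Set.mem_singleton_iff]
        constructor
        · exact fun h => h6 _ h.1 h.2
        · rintro (rfl | rfl)
          · exact ⟨h1, h2⟩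
          · exact ⟨h4, h5⟩
      have h7 : Nat.card {b : T.LocalCell ℓ // a.adj b ∧ b.adj c} = 2 := by
        change Nat.card ({b : T.LocalCell ℓ | a.adj b ∧ b.adj c} : Set _) = 2
        rw [Nat.card_coe_set_eq, this, Set.ncard_pair h3.symm]
      rw [h7]
      exact even_two
  · have : IsEmpty {b : T.LocalCell ℓ // a.adj b ∧ b.adj c} := ⟨fun b => h ⟨b.1, b.2⟩⟩
    simp

end LocalCell

end Lemmas

/-- The replacement `R_X` with odd scale `ℓ ≥ 3`: the code assembled from the local complexes `Y_v`,
`v ∈ V`, together with its Tanner square complex. A face consists of two different paths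
`a → b → c`, `a → b' → c`; if these paths run through three local complexes, then the face has to be
the copy of a face of `T`. -/
def replaceX (hℓ : Odd ℓ ∧ 3 ≤ ℓ) : CodeEmbedding T where
  tot :=
    { V := T.LocalCell ℓ
      finite_V := LocalCell.finite hℓ
      deg := LocalCell.deg
      deg_le := LocalCell.deg_le hℓ
      adj := LocalCell.adj
      adj_deg := fun _ _ h => LocalCell.adj_deg hℓ h
      even_common := LocalCell.even_common hℓ
      face := fun a b c b' => a.adj b ∧ b.adj c ∧ a.adj b' ∧ b'.adj c ∧ b ≠ b' ∧
        (T.adj a.own b.own → T.adj b.own c.own → T.face a.own b.own c.own b'.own)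
      face_adj := fun _ _ _ _ h => ⟨h.1, h.2.1, h.2.2.1, h.2.2.2.1⟩
      face_ne := fun _ _ _ _ h => h.2.2.2.2.1
      face_symm := by
        rintro a b c b' ⟨h1, h2, h3, h4, h5, h6⟩
        refine ⟨h3, h4, h1, h2, h5.symm, fun h7 h8 => T.face_symm _ _ _ _ ?_⟩
        obtain ⟨h9, h10⟩ := LocalCell.through_own h7 h8 h1 h2
        exact h6 h9 h10
      face_cover := by
        intro a b c h1 h2
        by_cases hb : T.adj a.own b.own ∧ T.adj b.own c.own
        · obtain ⟨q', hq⟩ := T.face_cover _ _ _ hb.1 hb.2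
          obtain ⟨-, -, h3, h4⟩ := T.face_adj _ _ _ _ hq
          obtain ⟨b', rfl, -, -, h5, h6⟩ := LocalCell.through hℓ h1 h2 hb.1 hb.2 h3 h4
          refine ⟨b', h1, h2, h5, h6, ?_, fun _ _ => hq⟩
          rintro rfl
          exact T.face_ne _ _ _ _ hq rfl
        · obtain ⟨b', h3, h4, h5, -⟩ := LocalCell.diamond hℓ h1 h2 hb
          exact ⟨b', h1, h2, h4, h5, h3.symm, fun h6 h7 => absurd ⟨h6, h7⟩ hb⟩ }
  own := LocalCell.own
  own_adj := fun _ _ h => LocalCell.own_adj h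

/-- The replacement `R_Z`: the replacement `R_X` with the roles of `X` and `Z` exchanged. -/
def replaceZ (hℓ : Odd ℓ ∧ 3 ≤ ℓ) : CodeEmbedding T := (T.dual.replaceX ℓ hℓ).dual

end TannerComplex

namespace TannerComplex

open CategoryTheory

/-- `(v, q, w, q')` are the corners of a square in cyclic order (`v`, `w` are an `X`- and a `Z`-check,
in any order). -/
def IsSquareAt (T : TannerComplex) (v q w q' : T.V) : Prop :=
  T.face v q w q' ∨ T.face w q v q'

/-- The graph `∂X_v`: the edges, not containing `v`, of the squares around the check `v`. -/
def boundaryGraph (T : TannerComplex) (v : T.V) : SimpleGraph T.V where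
  Adj a b := ∃ q w q', T.IsSquareAt v q w q' ∧ ((a = q ∧ b = w) ∨ (a = w ∧ b = q))
  symm := ⟨by
    rintro a b ⟨q, w, q', h, h'⟩
    exact ⟨q, w, q', h, h'.symm.imp And.symm And.symm⟩⟩
  loopless := ⟨by
    rintro a ⟨q, w, q', h, h'⟩
    have hne : q ≠ w := by
      rcases h with h | h
      · exact (face_corners h).2.2.1
      · exact (face_corners h).1.symm
    rcases h' with ⟨rfl, h'⟩ | ⟨rfl, h'⟩
    · exact hne h'
    · exact hne h'.symm⟩

/-- The local shape of the complexes of the construction. -/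
structure IsRegular (T : TannerComplex) : Prop where
  /-- An `X`-check and a `Z`-check are opposite corners of at most one square. -/
  square_unique : ∀ x q z q' r r', T.face x q z q' → T.face x r z r' → r = q ∨ r = q'
  /-- `∂X_v` is connected and not empty, for each check `v`. -/
  boundary_connected : ∀ v, T.deg v ≠ 1 →
    ((T.boundaryGraph v).induce (T.boundaryGraph v).support).Connected
  /-- Every qubit takes part in an `X`-check and in a `Z`-check. -/
  qubit_checked : ∀ q, T.deg q = 1 → (∃ x, T.adj x q) ∧ ∃ z, T.adj q z

/-- The edges of the Tanner graph of the `[[5, 1, 2]]` surface code: `X`-checks `0`, `1`, qubits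
`2, …, 6`, `Z`-checks `7`, `8`; the supports of the checks are `{2, 3, 4}`, `{4, 5, 6}` and
`{2, 4, 5}`, `{3, 4, 6}`. -/
def surfaceEdge (a b : Fin 9) : Bool :=
  (a, b) ∈ ([(0, 2), (0, 3), (0, 4), (1, 4), (1, 5), (1, 6), (2, 7), (4, 7), (5, 7), (3, 8), (4, 8),
    (6, 8)] : List (Fin 9 × Fin 9))

/-- The Tanner square complex of the `[[5, 1, 2]]` surface code. -/
def surfaceCode : TannerComplex where
  V := Fin 9
  finite_V := inferInstance
  deg := ![0, 0, 1, 1, 1, 1, 1, 2, 2]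
  deg_le := by decide
  adj a b := surfaceEdge a b
  adj_deg := by decide
  even_common := by
    intro x z
    rw [Nat.card_eq_fintype_card]
    revert x z
    decide
  face x q z q' := (surfaceEdge x q ∧ surfaceEdge q z ∧ surfaceEdge x q' ∧ surfaceEdge q' z) ∧ q ≠ q'
  face_adj := fun _ _ _ _ h => h.1
  face_ne := fun _ _ _ _ h => h.2
  face_symm := fun _ _ _ _ h => ⟨⟨h.1.2.2.1, h.1.2.2.2, h.1.1, h.1.2.1⟩, h.2.symm⟩
  face_cover := by decide

/-- The alternating construction from the seed `T`: `R_X` at even levels, `R_Z` at odd levels. -/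
def level (ℓ : ℕ) (hℓ : Odd ℓ ∧ 3 ≤ ℓ) (T : TannerComplex) : ℕ → TannerComplex
  | 0 => T
  | i + 1 => if Even i then ((level ℓ hℓ T i).replaceX ℓ hℓ).tot else ((level ℓ hℓ T i).replaceZ ℓ hℓ).tot

end TannerComplex

namespace CodeEmbedding

open CategoryTheory TannerComplex

variable {T : TannerComplex} (E : CodeEmbedding T)

open Classical in
/-- There is a cochain map `F` from the code of `T` to the global code that is an isomorphism on `H¹`,
and it is the composition of an injective cochain map `ι` into the induced complex
`(H(C, δ_loc), H(g))` with a homotopy equivalence `e` from the induced complex to the global code;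
`ι` maps the basis vector of each vertex `v` to the class of a local cocycle as prescribed by `gen`. -/
def HasCochainMap (gen : ∀ n, T.Cells n → E.tot.Cochain n → Prop) : Prop :=
  ∃ (F : T.complex ⟶ E.tot.complex) (ι : T.complex ⟶ E.induced)
    (e : HomotopyEquiv E.induced E.tot.complex),
    IsIso (HomologicalComplex.homologyMap F 1) ∧
    F = ι ≫ e.hom ∧
    (∀ n, Function.Injective (ι.f n).hom) ∧
    ∀ n (v : T.Cells n), ∃ a : E.Zloc n, gen n v a.1 ∧
      (ι.f n).hom (Pi.single v 1 : T.Cochain n) = (E.Bloc n).mkQ a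

/-- The sum of all cells of degree `n` in the local code of `v`. -/
def localSum (n : ℕ) (v : T.Cells n) (φ : E.tot.Cochain n) : Prop :=
  φ = Set.indicator {c | E.own c.1 = v.1} 1

open Classical in
/-- A single cell of degree `n` in the local code of `v`. -/
def localPoint (n : ℕ) (v : T.Cells n) (φ : E.tot.Cochain n) : Prop :=
  ∃ c : E.tot.Cells n, E.own c.1 = v.1 ∧ φ = Pi.single c 1

end CodeEmbedding

/-! ### Linear algebra: splitting a complex of vector spaces -/

section LinearAlgebra

open Module

/-! Each `Y_v` is the double of the star of `v` along its boundary. For an X-check `x`, both layers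
contract onto the centre, and they are glued along the nonempty connected `∂X_x`; hence `Y_x` is
connected and has no first cohomology. For a qubit `q`, `Y_q` is connected because `q` has a
Z-check. So for `R_X` the local cohomology in degrees 0 and 1 has exactly one class per X-check and
one per qubit, the functions that are constant on the 0-cells of one local complex (`pull`), and the
connecting maps act on these as the coboundary of `T` (`replaceX_g_pull`). The resulting `ι` is
bijective in degrees 0 and 1. In degree 2 it is only injective: the two points of `Y_z` and the
higher cohomology of `Y_q` and `Y_x` can add classes. This suffices for an isomorphism on `H¹`.

The equivalence `e` is not built by hand. Over a field, complexes with cohomology of equal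
dimensions are homotopy equivalent, so `e` exists once `rank δ = rank δ_loc + rank H(g)` in each
degree (`hasCochainMap_of`). This is a degeneration statement. It is proved by computing the kernel
of `δ_loc + ε g` for `ε = 0` and `ε = 1` by one argument (`partialδ`): nothing maps into the
complexes of X-checks under `g`, so there a cocycle is locally closed, hence a constant in degree 0
and exact in degree 1; a 1-cocycle that vanishes there is locally constant on the complexes of the
qubits. The two ranks then differ by the rank of the coboundary of `T`.

For `R_Z` everything is transposed. Ranks are unchanged by transposition. Constants become sums over
the 0-cells (`sumOwn`), and the class of a vertex is represented by a single 0-cell, whose choice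
does not matter in a connected `Y_v`. Now `ι` may miss classes in degree 0, and the sums show that
these produce no new boundaries.

To iterate, regularity has to be inherited (`IsRegular.replaceX`): links of checks in the
replacement are connected because links in the subdivided stars are. -/

/-- A generalized inverse of a linear map over a field. -/
theorem LinearMap.exists_generalizedInverse {k A B : Type*} [Field k] [AddCommGroup A] [Module k A]
    [AddCommGroup B] [Module k B] (f : A →ₗ[k] B) : ∃ h : B →ₗ[k] A, ∀ x, f (h (f x)) = f x := by
  obtain ⟨s, hs⟩ := f.rangeRestrict.exists_rightInverse_of_surjective f.range_rangeRestrict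
  obtain ⟨t, ht⟩ := (LinearMap.range f).subtype.exists_leftInverse_of_injective
    (Submodule.ker_subtype _)
  refine ⟨s ∘ₗ t, fun x => ?_⟩
  have h1 : t (f x) = f.rangeRestrict x := LinearMap.congr_fun ht (f.rangeRestrict x)
  have h2 := LinearMap.congr_fun hs (f.rangeRestrict x)
  rw [LinearMap.comp_apply, h1]
  exact congrArg Subtype.val h2

variable {k A B C : Type*} [Field k] [AddCommGroup A] [Module k A] [AddCommGroup B] [Module k B]
  [AddCommGroup C] [Module k C]

/-- The cohomology at the middle of `A → B → C`. -/
abbrev midCohomology (f : A →ₗ[k] B) (g : B →ₗ[k] C) : Type _ :=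
  LinearMap.ker g ⧸ (LinearMap.range f).submoduleOf (LinearMap.ker g)

theorem finrank_midCohomology [FiniteDimensional k B] (f : A →ₗ[k] B) (g : B →ₗ[k] C)
    (h : g ∘ₗ f = 0) :
    finrank k (midCohomology f g) + finrank k (LinearMap.range f) + finrank k (LinearMap.range g)
      = finrank k B := by
  have h1 : LinearMap.range f ≤ LinearMap.ker g := LinearMap.range_le_ker_iff.2 h
  have h2 : finrank k (midCohomology f g) +
      finrank k ((LinearMap.range f).submoduleOf (LinearMap.ker g)) = finrank k (LinearMap.ker g) :=
    Submodule.finrank_quotient_add_finrank _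
  rw [(Submodule.submoduleOfEquivOfLe h1).finrank_eq] at h2
  have h3 := LinearMap.finrank_range_add_finrank_ker g
  omega

/-- Splitting of the middle of a complex `A → B → C` of vector spaces. -/
theorem exists_splitting (f : A →ₗ[k] B) (g : B →ₗ[k] C) (h : g ∘ₗ f = 0) (s : B →ₗ[k] A)
    (t : C →ₗ[k] B) (hs : ∀ x, f (s (f x)) = f x) (ht : ∀ x, g (t (g x)) = g x) :
    ∃ (P : B →ₗ[k] midCohomology f g) (S : midCohomology f g →ₗ[k] B) (s' : B →ₗ[k] A),
      (∀ x, P (f x) = 0) ∧ (∀ y, g (S y) = 0) ∧ (∀ y, P (S y) = y) ∧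
      (∀ x, s' (f x) = s (f x)) ∧ ∀ x, x - S (P x) = f (s' x) + t (g x) := by
  have hgf : ∀ x, g (f x) = 0 := LinearMap.congr_fun h
  -- `π` maps into the kernel of `g`, kills the range of `f`, and moves each cocycle only by a
  -- coboundary, so it induces the projection to cohomology.
  let π : B →ₗ[k] B := LinearMap.id - f ∘ₗ s - t ∘ₗ g
  have hπ : ∀ x, π x = x - f (s x) - t (g x) := fun _ => rfl
  have hπg : ∀ x, π x ∈ LinearMap.ker g := fun x => by
    rw [LinearMap.mem_ker, hπ, map_sub, map_sub, hgf, ht]; simp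
  let q := ((LinearMap.range f).submoduleOf (LinearMap.ker g)).mkQ
  let P : B →ₗ[k] midCohomology f g := q ∘ₗ π.codRestrict _ hπg
  obtain ⟨σ, hσ⟩ := q.exists_rightInverse_of_surjective (Submodule.range_mkQ _)
  let S : midCohomology f g →ₗ[k] B := (LinearMap.ker g).subtype ∘ₗ σ
  have hPf : ∀ x, P (f x) = 0 := fun x => by
    have : π.codRestrict _ hπg (f x) = 0 := Subtype.ext (by
      change π (f x) = 0
      rw [hπ, hs, hgf]; simp)
    change q _ = 0
    rw [this, map_zero]
  have hgS : ∀ y, g (S y) = 0 := fun y => (σ y).2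
  have hq : ∀ z (hz : g z = 0), P z = q ⟨z, hz⟩ := fun z hz => by
    refine (Submodule.Quotient.eq _).2 ⟨-s z, ?_⟩
    change f _ = π z - z
    rw [hπ, hz]; simp
  have hPS : ∀ y, P (S y) = y := fun y => by
    rw [hq _ (hgS y)]
    exact LinearMap.congr_fun hσ y
  -- `π x` and `S (P x)` represent the same class, and the correction term adds a primitive of their
  -- difference. It vanishes on the range of `f`, so the new `s'` agrees with `s` there and may
  -- replace it wherever it is applied to coboundaries.
  refine ⟨P, S, s + s ∘ₗ (π - S ∘ₗ P), hPf, hgS, hPS, fun x => ?_, fun x => ?_⟩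
  · have : π (f x) = 0 := by rw [hπ, hs, hgf]; simp
    simp [this, hPf]
  · have h1 : q ⟨π x, hπg x⟩ = q ⟨S (P x), hgS _⟩ := by
      rw [← hq _ (hgS (P x)), hPS]; rfl
    obtain ⟨a, ha⟩ := (Submodule.Quotient.eq _).1 h1
    have ha' : f a = π x - S (P x) := ha
    have h2 : f (s (π x - S (P x))) = π x - S (P x) := by rw [← ha', hs]
    simp only [LinearMap.add_apply, LinearMap.comp_apply, LinearMap.sub_apply, map_add, h2]
    rw [hπ]; abel

end LinearAlgebra

/-! ### Homotopy equivalence from isomorphic cohomology -/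

section HomotopyEquivalence

open CategoryTheory Module

variable {k : Type} [Field k]

/-- The cohomology of a cochain complex of vector spaces, as a quotient space. -/
abbrev CochainComplex.cohomologySpace (K : CochainComplex (ModuleCat k) ℕ) (n : ℕ) : Type _ :=
  midCohomology (K.d (n - 1) n).hom (K.d n (n + 1)).hom

theorem CochainComplex.d_hom_comp (K : CochainComplex (ModuleCat k) ℕ) (i j l : ℕ) :
    (K.d j l).hom ∘ₗ (K.d i j).hom = 0 := by
  rw [← ModuleCat.hom_comp, K.d_comp_d]; rfl

/-- The splittings of neighbouring degrees share their generalized inverses, and the corrected maps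
agree with these on coboundaries, so they fit into one contracting homotopy. Since `0 - 1 = 0` in
`ℕ`, the incoming differential in degree 0 is `d 0 0 = 0`, and only one term is left there. -/
theorem CochainComplex.exists_splitting (K : CochainComplex (ModuleCat k) ℕ) :
    ∃ (P : ∀ n, K.X n →ₗ[k] K.cohomologySpace n) (S : ∀ n, K.cohomologySpace n →ₗ[k] K.X n)
      (s : ∀ n, K.X (n + 1) →ₗ[k] K.X n),
      (∀ n x, P (n + 1) ((K.d n (n + 1)).hom x) = 0) ∧ (∀ n y, (K.d n (n + 1)).hom (S n y) = 0) ∧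
      (∀ n y, P n (S n y) = y) ∧
      (∀ x, x - S 0 (P 0 x) = s 0 ((K.d 0 1).hom x)) ∧
      ∀ n x, x - S (n + 1) (P (n + 1) x) = (K.d n (n + 1)).hom (s n x) +
        s (n + 1) ((K.d (n + 1) (n + 1 + 1)).hom x) := by
  choose s hs using fun n => (K.d (n - 1) n).hom.exists_generalizedInverse
  choose P S s' h1 h2 h3 h4 h5 using fun n => _root_.exists_splitting (K.d (n - 1) n).hom
    (K.d n (n + 1)).hom (K.d_hom_comp _ _ _) (s n) (s (n + 1)) (hs n) (hs (n + 1))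
  refine ⟨P, S, fun n => s' (n + 1), fun n => h1 (n + 1), h2, h3, fun x => ?_, fun n x => ?_⟩
  · have h0 : K.d (0 - 1) 0 = 0 := K.shape _ _ (by simp)
    rw [h5, h0]
    refine Eq.trans (congrArg₂ _ rfl (h4 1 x).symm) (zero_add _)
  · rw [h5]
    exact congrArg₂ _ rfl (h4 (n + 1 + 1) x).symm

/-- Complexes of vector spaces with isomorphic cohomology are homotopy equivalent. -/
theorem CochainComplex.nonempty_homotopyEquiv (K L : CochainComplex (ModuleCat k) ℕ)
    (φ : ∀ n, K.cohomologySpace n ≃ₗ[k] L.cohomologySpace n) : Nonempty (HomotopyEquiv K L) := by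
  -- A family of maps that factors through cohomology is automatically a cochain map: `P` kills
  -- coboundaries and `S` takes values in cocycles, so both composites with the differentials
  -- vanish.
  have key : ∀ (K L : CochainComplex (ModuleCat k) ℕ)
      (PK : ∀ n, K.X n →ₗ[k] K.cohomologySpace n) (SL : ∀ n, L.cohomologySpace n →ₗ[k] L.X n)
      (φ : ∀ n, K.cohomologySpace n ≃ₗ[k] L.cohomologySpace n)
      (_ : ∀ n x, PK (n + 1) ((K.d n (n + 1)).hom x) = 0)
      (_ : ∀ n y, (L.d n (n + 1)).hom (SL n y) = 0),
      ∃ f : K ⟶ L, ∀ n x, (f.f n).hom x = SL n (φ n (PK n x)) := by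
    intro K L PK SL φ h1 h2
    refine ⟨{ f := fun n => ModuleCat.ofHom (SL n ∘ₗ (φ n).toLinearMap ∘ₗ PK n)
              comm' := ?_ }, fun _ _ => rfl⟩
    rintro i _ rfl
    ext x
    change (L.d i (i + 1)).hom (SL i _) = SL (i + 1) (φ (i + 1) (PK (i + 1) ((K.d i (i + 1)).hom x)))
    rw [h2, h1]
    simp
  have key2 : ∀ (K : CochainComplex (ModuleCat k) ℕ) (f : K ⟶ K) (s : ∀ n, K.X (n + 1) →ₗ[k] K.X n),
      (∀ x, x - (f.f 0).hom x = s 0 ((K.d 0 1).hom x)) →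
      (∀ n x, x - (f.f (n + 1)).hom x = (K.d n (n + 1)).hom (s n x) +
        s (n + 1) ((K.d (n + 1) (n + 1 + 1)).hom x)) → Nonempty (Homotopy f (𝟙 K)) := by
    intro K f s h h'
    let hom : ∀ i j, K.X i ⟶ K.X j := fun i j => if hij : j + 1 = i then
        eqToHom (by subst hij; rfl) ≫ ModuleCat.ofHom (s j) else 0
    have hom_succ : ∀ n, hom (n + 1) n = ModuleCat.ofHom (s n) := fun n => by simp [hom]
    refine ⟨Homotopy.symm { hom := hom, zero := fun i j hij => dif_neg hij, comm := ?_ }⟩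
    intro n
    rw [Homotopy.dNext_cochainComplex, hom_succ]
    cases n with
    | zero =>
      rw [Homotopy.prevD_zero_cochainComplex]
      ext x
      change x = s 0 ((K.d 0 1).hom x) + 0 + (f.f 0).hom x
      rw [← h x]; abel
    | succ n =>
      rw [Homotopy.prevD_succ_cochainComplex, hom_succ]
      ext x
      change x = s (n + 1) ((K.d (n + 1) (n + 1 + 1)).hom x) + (K.d n (n + 1)).hom (s n x) +
        (f.f (n + 1)).hom x
      rw [add_comm (s (n + 1) _), ← h' n x]; abel
  obtain ⟨PK, SK, sK, K1, K2, K3, K4, K5⟩ := K.exists_splitting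
  obtain ⟨PL, SL, sL, L1, L2, L3, L4, L5⟩ := L.exists_splitting
  obtain ⟨f, hf⟩ := key K L PK SL φ K1 L2
  obtain ⟨g, hg⟩ := key L K PL SK (fun n => (φ n).symm) L1 K2
  have hfg : ∀ n x, ((f ≫ g).f n).hom x = SK n (PK n x) := fun n x => by
    rw [HomologicalComplex.comp_f, ModuleCat.hom_comp, LinearMap.comp_apply, hg, hf, L3,
      LinearEquiv.symm_apply_apply]
  have hgf : ∀ n x, ((g ≫ f).f n).hom x = SL n (PL n x) := fun n x => by
    rw [HomologicalComplex.comp_f, ModuleCat.hom_comp, LinearMap.comp_apply, hf, hg, K3,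
      LinearEquiv.apply_symm_apply]
  obtain ⟨H1⟩ := key2 K (f ≫ g) sK (fun x => by rw [hfg, K4]) fun n x => by rw [hfg, K5]
  obtain ⟨H2⟩ := key2 L (g ≫ f) sL (fun x => by rw [hgf, L4]) fun n x => by rw [hgf, L5]
  exact ⟨⟨f, g, H1, H2⟩⟩

end HomotopyEquivalence

/-! ### A criterion for isomorphisms in homology -/

section HomologyIso

open CategoryTheory

variable {k : Type} [Field k]

/-- A morphism of short complexes that is bijective in the middle, injective on the right, and hits all
boundaries induces an isomorphism in homology. -/
theorem ShortComplex.quasiIso_of_bijective {K L : ShortComplex (ModuleCat.{0} k)} (f : K ⟶ L)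
    (h1 : Function.Bijective f.τ₂.hom) (h2 : Function.Injective f.τ₃.hom)
    (h0 : ∀ y, ∃ x, f.τ₂.hom (K.f.hom x) = L.f.hom y) : ShortComplex.QuasiIso f := by
  -- `M` has the same homology as `L`, with the first term cut down to the boundaries. After
  -- composing with `L ⟶ M`, hitting all boundaries becomes surjectivity on the left.
  let M : ShortComplex (ModuleCat.{0} k) :=
    { X₁ := ModuleCat.of k (LinearMap.range L.f.hom), X₂ := L.X₂, X₃ := L.X₃
      f := ModuleCat.ofHom (LinearMap.range L.f.hom).subtype, g := L.g
      zero := by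
        ext ⟨_, y, rfl⟩
        exact LinearMap.congr_fun (congrArg ModuleCat.Hom.hom L.zero) y }
  let p : L ⟶ M :=
    { τ₁ := ModuleCat.ofHom L.f.hom.rangeRestrict, τ₂ := 𝟙 _, τ₃ := 𝟙 _
      comm₁₂ := by ext x; rfl
      comm₂₃ := by ext x; rfl }
  have : Epi p.τ₁ := (ModuleCat.epi_iff_surjective _).2 L.f.hom.surjective_rangeRestrict
  have : IsIso p.τ₂ := inferInstanceAs (IsIso (𝟙 _))
  have : Mono p.τ₃ := inferInstanceAs (Mono (𝟙 _))
  have hp : ShortComplex.QuasiIso p := ShortComplex.quasiIso_of_epi_of_isIso_of_mono p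
  have : Epi (f ≫ p).τ₁ := (ModuleCat.epi_iff_surjective _).2 fun ⟨_, y, hy⟩ => by
    obtain ⟨x, hx⟩ := h0 y
    refine ⟨x, Subtype.ext ?_⟩
    change L.f.hom (f.τ₁.hom x) = _
    refine Eq.trans ?_ (hx.trans hy)
    exact LinearMap.congr_fun (congrArg ModuleCat.Hom.hom f.comm₁₂) x
  have : IsIso (f ≫ p).τ₂ := (ConcreteCategory.isIso_iff_bijective _).2 h1
  have : Mono (f ≫ p).τ₃ := (ModuleCat.mono_iff_injective _).2 h2
  have hfp : ShortComplex.QuasiIso (f ≫ p) := ShortComplex.quasiIso_of_epi_of_isIso_of_mono _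
  exact ShortComplex.quasiIso_of_comp_right f p

/-- Condition `h0` stands in for surjectivity in degree 0, which is not available for `R_Z`: there
the local code of an X-check consists of two unconnected points and contributes two classes. -/
theorem CochainComplex.isIso_homologyMap_one {K L : CochainComplex (ModuleCat.{0} k) ℕ} (f : K ⟶ L)
    (h1 : Function.Bijective (f.f 1).hom) (h2 : Function.Injective (f.f 2).hom)
    (h0 : ∀ y, ∃ x, (f.f 1).hom ((K.d 0 1).hom x) = (L.d 0 1).hom y) :
    IsIso (HomologicalComplex.homologyMap f 1) := by
  rw [← quasiIsoAt_iff_isIso_homologyMap, quasiIsoAt_iff' f 0 1 2 (by simp) (by simp)]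
  exact ShortComplex.quasiIso_of_bijective _ h1 h2 h0

end HomologyIso

/-! ### Ranks of relation matrices -/

section RelMap

open Module

theorem relMap_single {α β : Type} [Finite α] [DecidableEq α] (r : α → β → Prop) [DecidableRel r]
    (a : α) (b : β) : relMap r (Pi.single a 1) b = if r a b then 1 else 0 := by
  let _ := Fintype.ofFinite α
  rw [relMap_apply, Finset.sum_eq_single a]
  · simp
  · intro c _ hc
    simp [Pi.single_eq_of_ne hc]
  · simp

/-- The opposite relation gives the transposed map, which has the same rank. -/
theorem finrank_range_relMap_swap {α β : Type} [Finite α] [Finite β] (r : α → β → Prop) :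
    finrank (ZMod 2) (LinearMap.range (relMap fun b a => r a b)) =
      finrank (ZMod 2) (LinearMap.range (relMap r)) := by
  classical
  let _ := Fintype.ofFinite α
  let _ := Fintype.ofFinite β
  have h1 : relMap r = Matrix.mulVecLin (Matrix.of fun b a => if r a b then (1 : ZMod 2) else 0) := by
    refine LinearMap.ext fun φ => funext fun b => ?_
    simp [relMap_apply, Matrix.mulVec, dotProduct]
  have h2 : relMap (fun b a => r a b) =
      Matrix.mulVecLin (Matrix.of fun b a => if r a b then (1 : ZMod 2) else 0).transpose := by
    refine LinearMap.ext fun φ => funext fun b => ?_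
    simp [relMap_apply, Matrix.vecMul, dotProduct]
  rw [h1, h2]
  exact Matrix.rank_transpose _

theorem finrank_range_relMap_congr {α β α' β' : Type} [Finite α] [Finite α']
    (r : α → β → Prop) (r' : α' → β' → Prop) (e : α ≃ α') (f : β ≃ β')
    (h : ∀ a b, r a b ↔ r' (e a) (f b)) :
    finrank (ZMod 2) (LinearMap.range (relMap r)) =
      finrank (ZMod 2) (LinearMap.range (relMap r')) := by
  classical
  let _ := Fintype.ofFinite α
  let _ := Fintype.ofFinite α'
  let F : (β' → ZMod 2) ≃ₗ[ZMod 2] (β → ZMod 2) := LinearEquiv.funCongrLeft _ _ f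
  let G : (α' → ZMod 2) ≃ₗ[ZMod 2] (α → ZMod 2) := LinearEquiv.funCongrLeft _ _ e
  have h1 : relMap r ∘ₗ G.toLinearMap = F.toLinearMap ∘ₗ relMap r' := by
    refine LinearMap.ext fun φ => funext fun b => ?_
    change relMap r (φ ∘ e) b = relMap r' φ (f b)
    rw [relMap_apply, relMap_apply]
    refine Fintype.sum_equiv e _ _ fun a => ?_
    simp [h]
  have h2 : LinearMap.range (relMap r) = (LinearMap.range (relMap r')).map F.toLinearMap := by
    rw [← LinearMap.range_comp, ← h1, LinearMap.range_comp, LinearEquiv.range, LinearMap.range_eq_map]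
  rw [h2]
  exact LinearEquiv.finrank_map_eq F _

end RelMap

/-! ### Reduction of the theorem to a rank equation -/

namespace CodeEmbedding

open CategoryTheory Module TannerComplex

variable {T : TannerComplex} (E : CodeEmbedding T)

theorem finrank_Hloc (n : ℕ) : finrank (ZMod 2) (E.Hloc n) +
    finrank (ZMod 2) (LinearMap.range (E.δloc (n - 1) n)) +
    finrank (ZMod 2) (LinearMap.range (E.δloc n (n + 1))) = finrank (ZMod 2) (E.tot.Cochain n) :=
  finrank_midCohomology _ _ (E.δloc_comp _ _ _)

theorem isEmpty_cells (S : TannerComplex) {n : ℕ} (hn : 2 < n) : IsEmpty (S.Cells n) :=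
  ⟨fun v => by have := S.deg_le v.1; have := v.2; omega⟩

theorem subsingleton_cochain (S : TannerComplex) {n : ℕ} (hn : 2 < n) :
    Subsingleton (S.Cochain n) := by
  have := isEmpty_cells S hn
  infer_instance

theorem δ_shape (S : TannerComplex) {i j : ℕ} (hij : i + 1 ≠ j) : S.δ i j = 0 :=
  relMap_false _ fun a b h => hij (by rw [← b.2, S.adj_deg _ _ h, a.2])

theorem finrank_range_zero {A B : Type*} [AddCommGroup A] [Module (ZMod 2) A] [AddCommGroup B]
    [Module (ZMod 2) B] {f : A →ₗ[ZMod 2] B} (h : f = 0) :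
    finrank (ZMod 2) (LinearMap.range f) = 0 := by
  rw [h, LinearMap.range_zero, finrank_bot]

/-- An injective cochain map preserves ranks as soon as every boundary of the target is the image of
a boundary. From degree 1 to 2 this follows from surjectivity in degree 1, from 0 to 1 it is `h0`,
and above degree 2 there is nothing. -/
theorem finrank_range_Hg (ι : T.complex ⟶ E.induced) (hι : ∀ n, Function.Injective (ι.f n).hom)
    (h1 : Function.Surjective (ι.f 1).hom)
    (h0 : ∀ y, ∃ x, (ι.f 1).hom (T.δ 0 1 x) = E.Hg 0 1 y) (i j : ℕ) :
    finrank (ZMod 2) (LinearMap.range (E.Hg i j)) = finrank (ZMod 2) (LinearMap.range (T.δ i j)) := by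
  by_cases hij : i + 1 = j
  · subst hij
    have comm : ∀ x, E.Hg i (i + 1) ((ι.f i).hom x) = (ι.f (i + 1)).hom (T.δ i (i + 1) x) := fun x =>
      LinearMap.congr_fun (congrArg ModuleCat.Hom.hom (ι.comm i (i + 1))) x
    have h2 : ∀ y, ∃ x, (ι.f (i + 1)).hom (T.δ i (i + 1) x) = E.Hg i (i + 1) y := by
      match i with
      | 0 => exact h0
      | 1 =>
        intro y
        obtain ⟨x, rfl⟩ := h1 y
        exact ⟨x, (comm x).symm⟩
      | i + 2 =>
        intro y
        refine ⟨0, ?_⟩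
        have h3 := subsingleton_cochain E.tot (show 2 < i + 2 + 1 by omega)
        have h4 : Subsingleton (E.Hloc (i + 2 + 1)) := inferInstance
        exact Subsingleton.elim (α := E.Hloc (i + 2 + 1)) _ _
    have h3 : LinearMap.range (E.Hg i (i + 1)) =
        (LinearMap.range (T.δ i (i + 1))).map (ι.f (i + 1)).hom := by
      ext z
      constructor
      · rintro ⟨y, rfl⟩
        obtain ⟨x, hx⟩ := h2 y
        exact ⟨_, ⟨x, rfl⟩, hx⟩
      · rintro ⟨_, ⟨x, rfl⟩, rfl⟩
        exact ⟨(ι.f i).hom x, comm x⟩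
    rw [h3]
    exact (Submodule.equivMapOfInjective _ (hι (i + 1)) _).finrank_eq.symm
  · have e1 : E.Hg i j = 0 := congrArg ModuleCat.Hom.hom (E.induced.shape i j hij)
    rw [finrank_range_zero e1, finrank_range_zero (δ_shape T hij)]

/-- Subtracting the ranks into and out of degree `n` from the dimension of the cochains gives the
same dimension of cohomology on both sides. The hypothesis says that the spectral sequence with
first page `H(C, δ_loc)` and differential `H(g)` has no further differentials. -/
theorem nonempty_homotopyEquiv (h : ∀ i j, finrank (ZMod 2) (LinearMap.range (E.tot.δ i j)) =
      finrank (ZMod 2) (LinearMap.range (E.δloc i j)) + finrank (ZMod 2) (LinearMap.range (E.Hg i j))) :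
    Nonempty (HomotopyEquiv E.induced E.tot.complex) := by
  refine CochainComplex.nonempty_homotopyEquiv _ _ fun n => ?_
  have f1 : FiniteDimensional (ZMod 2) (E.induced.X n) :=
    inferInstanceAs (FiniteDimensional (ZMod 2) (E.Hloc n))
  have f2 : FiniteDimensional (ZMod 2) (E.tot.complex.X n) :=
    inferInstanceAs (FiniteDimensional (ZMod 2) (E.tot.Cochain n))
  refine LinearEquiv.ofFinrankEq _ _ ?_
  have h1 : finrank (ZMod 2) (CochainComplex.cohomologySpace E.induced n) +
      finrank (ZMod 2) (LinearMap.range (E.Hg (n - 1) n)) +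
      finrank (ZMod 2) (LinearMap.range (E.Hg n (n + 1))) = finrank (ZMod 2) (E.Hloc n) :=
    finrank_midCohomology (B := E.Hloc n) (E.Hg (n - 1) n) (E.Hg n (n + 1))
      (E.induced.d_hom_comp _ _ _)
  have h2 : finrank (ZMod 2) (CochainComplex.cohomologySpace E.tot.complex n) +
      finrank (ZMod 2) (LinearMap.range (E.tot.δ (n - 1) n)) +
      finrank (ZMod 2) (LinearMap.range (E.tot.δ n (n + 1))) = finrank (ZMod 2) (E.tot.Cochain n) :=
    finrank_midCohomology (B := E.tot.Cochain n) (E.tot.δ (n - 1) n) (E.tot.δ n (n + 1))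
      (E.tot.δ_comp _ _ _)
  have h3 := E.finrank_Hloc n
  have h4 := h (n - 1) n
  have h5 := h n (n + 1)
  omega

/-- Since `F` is defined as `ι` followed by an equivalence, its effect on `H¹` is governed by `ι`
alone, and any homotopy equivalence will do. -/
theorem hasCochainMap_of (gen : ∀ n, T.Cells n → E.tot.Cochain n → Prop)
    (ι : T.complex ⟶ E.induced) (hι : ∀ n, Function.Injective (ι.f n).hom)
    (h1 : Function.Surjective (ι.f 1).hom)
    (h0 : ∀ y, ∃ x, (ι.f 1).hom (T.δ 0 1 x) = E.Hg 0 1 y)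
    (hgen : open Classical in ∀ n (v : T.Cells n), ∃ a : E.Zloc n, gen n v a.1 ∧
      (ι.f n).hom (Pi.single v 1 : T.Cochain n) = (E.Bloc n).mkQ a)
    (hrank : ∀ i j, finrank (ZMod 2) (LinearMap.range (E.tot.δ i j)) =
      finrank (ZMod 2) (LinearMap.range (E.δloc i j)) + finrank (ZMod 2) (LinearMap.range (T.δ i j))) :
    E.HasCochainMap gen ∧ T.numLogical = E.tot.numLogical := by
  obtain ⟨e⟩ := E.nonempty_homotopyEquiv fun i j => by
    rw [E.finrank_range_Hg ι hι h1 h0, hrank]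
  have i1 : IsIso (HomologicalComplex.homologyMap ι 1) :=
    CochainComplex.isIso_homologyMap_one ι ⟨hι 1, h1⟩ (hι 2) h0
  have i2 : IsIso (HomologicalComplex.homologyMap e.hom 1) :=
    (e.toHomologyIso 1).isIso_hom
  have i3 : IsIso (HomologicalComplex.homologyMap (ι ≫ e.hom) 1) := by
    rw [HomologicalComplex.homologyMap_comp]
    infer_instance
  refine ⟨⟨ι ≫ e.hom, ι, e, i3, rfl, hι, hgen⟩, ?_⟩
  exact (asIso (HomologicalComplex.homologyMap (ι ≫ e.hom) 1)).toLinearEquiv.finrank_eq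

end CodeEmbedding

/-! ### Connectedness of links, tested by functions -/

namespace SimpleGraph

theorem reachable_induce_support {V : Type*} (G : SimpleGraph V) {a b : V} (ha : a ∈ G.support)
    (h : G.Reachable a b) : ∃ hb : b ∈ G.support, (G.induce G.support).Reachable ⟨a, ha⟩ ⟨b, hb⟩ := by
  obtain ⟨w⟩ := h
  induction w with
  | nil => exact ⟨ha, Reachable.refl _⟩
  | @cons u v w huv _ ih =>
    have hv : v ∈ G.support := ⟨u, huv.symm⟩
    obtain ⟨hb, h⟩ := ih hv
    refine ⟨hb, Reachable.trans (Adj.reachable ?_) h⟩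
    exact huv

theorem map_eq_of_reachable {V α : Type*} (G : SimpleGraph V) (f : V → α)
    (hf : ∀ a b, G.Adj a b → f a = f b) {a b : V} (h : G.Reachable a b) : f a = f b := by
  obtain ⟨w⟩ := h
  induction w with
  | nil => rfl
  | cons h _ ih => exact (hf _ _ h).trans ih

end SimpleGraph

namespace TannerComplex

variable {T : TannerComplex}

theorem dual_boundaryGraph (T : TannerComplex) (v : T.V) :
    T.dual.boundaryGraph v = T.boundaryGraph v := by
  ext a b
  have : ∀ q w q', T.dual.IsSquareAt v q w q' ↔ T.IsSquareAt v q w q' := fun q w q' => Or.comm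
  change (∃ q w q', T.dual.IsSquareAt v q w q' ∧ _) ↔ ∃ q w q', T.IsSquareAt v q w q' ∧ _
  simp only [this]
  exact Iff.rfl

theorem IsRegular.dual (hT : T.IsRegular) : T.dual.IsRegular where
  square_unique x q z q' r r' h h' := hT.square_unique z q x q' r r' h h'
  boundary_connected v hv := by
    have key : ∀ G : SimpleGraph T.V, G = T.boundaryGraph v → (G.induce G.support).Connected := by
      rintro _ rfl
      refine hT.boundary_connected v fun h => hv ?_
      change 2 - T.deg v = 1
      rw [h]
    exact key _ (dual_boundaryGraph T v)
  qubit_checked q hq := by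
    change 2 - T.deg q = 1 at hq
    exact (hT.qubit_checked q (by omega)).symm

/-- Around an `X`-check, the graph `∂X_v` consists of the paths going up from `v`. -/
theorem boundaryGraph_adj_iff {v : T.V} (hv : T.deg v = 0) (a b : T.V) :
    (T.boundaryGraph v).Adj a b ↔ (T.adj v a ∧ T.adj a b) ∨ (T.adj v b ∧ T.adj b a) := by
  constructor
  · rintro ⟨q, w, q', h | h, h'⟩
    · obtain ⟨h1, h2, -, -⟩ := T.face_adj _ _ _ _ h
      rcases h' with ⟨rfl, rfl⟩ | ⟨rfl, rfl⟩
      · exact Or.inl ⟨h1, h2⟩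
      · exact Or.inr ⟨h1, h2⟩
    · have := (face_corners h).2.2.2.2.2.2.2.2.2
      omega
  · rintro (⟨h1, h2⟩ | ⟨h1, h2⟩)
    · obtain ⟨q', h⟩ := T.face_cover _ _ _ h1 h2
      exact ⟨a, b, q', Or.inl h, Or.inl ⟨rfl, rfl⟩⟩
    · obtain ⟨q', h⟩ := T.face_cover _ _ _ h1 h2
      exact ⟨b, a, q', Or.inl h, Or.inr ⟨rfl, rfl⟩⟩

/-- The map to connected components is itself constant along edges, so it can be used as the test
function `f`. Testing with functions avoids handling walks in links that are glued from pieces. -/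
theorem boundary_connected_of_up {v : T.V} (hv : T.deg v = 0) (hne : ∃ b c, T.adj v b ∧ T.adj b c)
    (h : ∀ (α : Type) (f : T.V → α), (∀ b c, T.adj v b → T.adj b c → f b = f c) →
      ∀ b b', T.adj v b → T.adj v b' → f b = f b') :
    ((T.boundaryGraph v).induce (T.boundaryGraph v).support).Connected := by
  have key := h _ (T.boundaryGraph v).connectedComponentMk fun b c h1 h2 =>
    SimpleGraph.ConnectedComponent.sound
      (SimpleGraph.Adj.reachable ((boundaryGraph_adj_iff hv _ _).2 (Or.inl ⟨h1, h2⟩)))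
  have key2 : ∀ a ∈ (T.boundaryGraph v).support, ∃ b, T.adj v b ∧ (T.boundaryGraph v).Reachable a b := by
    rintro a ⟨b, hab⟩
    rcases (boundaryGraph_adj_iff hv _ _).1 hab with h1 | h1
    · exact ⟨a, h1.1, SimpleGraph.Reachable.refl _⟩
    · exact ⟨b, h1.1, hab.reachable⟩
  rw [SimpleGraph.connected_iff]
  constructor
  · rintro ⟨a, ha⟩ ⟨b, hb⟩
    obtain ⟨a', ha', ra⟩ := key2 a ha
    obtain ⟨b', hb', rb⟩ := key2 b hb
    have hab := SimpleGraph.ConnectedComponent.exact (key _ _ ha' hb')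
    exact (SimpleGraph.reachable_induce_support _ ha (ra.trans (hab.trans rb.symm))).2
  · obtain ⟨b, c, h1, h2⟩ := hne
    exact ⟨⟨b, c, (boundaryGraph_adj_iff hv _ _).2 (Or.inl ⟨h1, h2⟩)⟩⟩

/-- Functions on the qubits around an `X`-check that agree on the two qubits of each square are
constant. -/
theorem IsRegular.eq_of_face (hT : T.IsRegular) {x : T.V} (hx : T.deg x = 0) {α : Type}
    (f : T.V → α) (hf : ∀ q z q', T.face x q z q' → f q = f q') {q q' : T.V} (hq : T.adj x q)
    (hq' : T.adj x q') : f q = f q' := by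
  have hdeg : ∀ {q}, T.adj x q → T.deg q = 1 := fun h => by rw [T.adj_deg _ _ h, hx]
  -- A set-valued extension of `f` to the Z-checks of the link, collecting the values at the qubits
  -- between `x` and the Z-check. By `square_unique` these qubits are the two corners of one square,
  -- where `f` agrees, so the set is a singleton and `key` is constant along the edges of `∂X_x`.
  let key : T.V → Set α := fun a =>
    {y | (T.deg a = 1 ∧ y = f a) ∨ (∃ q, T.adj x q ∧ T.adj q a ∧ y = f q)}
  have key1 : ∀ a, T.adj x a → key a = {f a} := by
    intro a ha
    ext y
    constructor
    · rintro (⟨-, rfl⟩ | ⟨q, h1, h2, -⟩)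
      · rfl
      · have := hdeg h1
        have := T.adj_deg _ _ h2
        have := hdeg ha
        omega
    · rintro rfl
      exact Or.inl ⟨hdeg ha, rfl⟩
  have key2 : ∀ a c, T.adj x a → T.adj a c → key c = {f a} := by
    intro a c ha hc
    ext y
    constructor
    · rintro (⟨h1, rfl⟩ | ⟨q, h1, h2, rfl⟩)
      · have := T.adj_deg _ _ hc
        have := hdeg ha
        omega
      · obtain ⟨a', h3⟩ := T.face_cover _ _ _ ha hc
        obtain ⟨q', h4⟩ := T.face_cover _ _ _ h1 h2
        rcases hT.square_unique _ _ _ _ _ _ h3 h4 with rfl | rfl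
        · rfl
        · exact (hf _ _ _ h3).symm
    · rintro rfl
      exact Or.inr ⟨a, ha, hc, rfl⟩
  have hadj : ∀ a b, (T.boundaryGraph x).Adj a b → key a = key b := by
    intro a b h
    rcases (boundaryGraph_adj_iff hx _ _).1 h with ⟨h1, h2⟩ | ⟨h1, h2⟩
    · rw [key1 _ h1, key2 _ _ h1 h2]
    · rw [key1 _ h1, key2 _ _ h1 h2]
  have hsupp : ∀ q, T.adj x q → q ∈ (T.boundaryGraph x).support := by
    intro q hq
    obtain ⟨z, hz⟩ := (hT.qubit_checked q (hdeg hq)).2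
    exact ⟨z, (boundaryGraph_adj_iff hx _ _).2 (Or.inl ⟨hq, hz⟩)⟩
  have hr := (hT.boundary_connected x (by omega)).preconnected ⟨q, hsupp q hq⟩ ⟨q', hsupp q' hq'⟩
  have := SimpleGraph.map_eq_of_reachable _ (fun a => key a.1) (fun a b h => hadj _ _ h) hr
  simp only [key1 _ hq, key1 _ hq'] at this
  exact Set.singleton_injective this

theorem IsRegular.exists_face (hT : T.IsRegular) {x : T.V} (hx : T.deg x = 0) :
    ∃ q z q', T.face x q z q' := by
  obtain ⟨a, b, hab⟩ := (hT.boundary_connected x (by omega)).nonempty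
  rcases (boundaryGraph_adj_iff hx _ _).1 hab with ⟨h1, h2⟩ | ⟨h1, h2⟩
  · exact ⟨_, _, T.face_cover _ _ _ h1 h2⟩
  · exact ⟨_, _, T.face_cover _ _ _ h1 h2⟩

end TannerComplex

/-! ### Geometry of the subdivided star of an X-check -/

namespace TannerComplex

open Place

section StarGeometry

variable {T : TannerComplex} {ℓ : ℕ}

theorem edgePt_zero (ℓ : ℕ) (a b : T.V) : edgePt ℓ a b 0 = vert a := by simp [edgePt]

theorem edgePt_last (hℓ : 3 ≤ ℓ) (a b : T.V) : edgePt ℓ a b (ℓ - 1) = vert b := by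
  unfold edgePt
  split_ifs <;> first | rfl | omega

theorem inc_edgePt_of {a b : T.V} {i i' : ℕ} (h : T.adj a b) (hi : i ≤ ℓ - 1) (hi' : i' ≤ ℓ - 1)
    (he : Even i) (hii : i' = i + 1 ∨ i = i' + 1) : T.Inc ℓ (edgePt ℓ a b i) (edgePt ℓ a b i') :=
  Or.inl ⟨a, b, i, i', h, hi, hi', he, hii, rfl, rfl⟩

theorem inc_facePt_left (hℓ : 3 ≤ ℓ) {x q z q' : T.V} (h : T.face x q z q') {i i' j : ℕ}
    (hi : i ≤ ℓ - 1) (hi' : i' ≤ ℓ - 1) (hj : j ≤ ℓ - 1) (he : Even i)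
    (hii : i' = i + 1 ∨ i = i' + 1) :
    T.Inc ℓ (facePt ℓ x q z q' i j) (facePt ℓ x q z q' i' j) := by
  rcases Nat.eq_zero_or_pos j with rfl | hj0
  · rw [facePt_bot, facePt_bot]
    exact inc_edgePt_of (T.face_adj _ _ _ _ h).1 hi hi' he hii
  rcases eq_or_lt_of_le hj with rfl | hj1
  · rw [facePt_top _ _ _ _ _ hℓ, facePt_top _ _ _ _ _ hℓ]
    exact inc_edgePt_of (T.face_adj _ _ _ _ h).2.2.2 hi hi' he hii
  · exact Or.inr ⟨x, q, z, q', i, i', j, h, hi, hi', he, hii, hj0, hj1, rfl, rfl⟩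

theorem inc_facePt_right (hℓ : 3 ≤ ℓ) {x q z q' : T.V} (h : T.face x q z q') {i j j' : ℕ}
    (hi : i ≤ ℓ - 1) (hj : j ≤ ℓ - 1) (hj' : j' ≤ ℓ - 1) (he : Even j)
    (hjj : j' = j + 1 ∨ j = j' + 1) :
    T.Inc ℓ (facePt ℓ x q z q' i j) (facePt ℓ x q z q' i j') := by
  rw [← facePt_swap _ _ _ _ _ _ hℓ, ← facePt_swap _ _ _ _ _ j' hℓ]
  exact inc_facePt_left hℓ (T.face_symm _ _ _ _ h) hj hj' hi he hjj

theorem inc_edgePt (hℓ : Odd ℓ ∧ 3 ≤ ℓ) {c : Place T.V} {a b : T.V} {k : ℕ}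
    (h : T.Inc ℓ c (edgePt ℓ a b k)) : T.adj a b ∧ 0 < k ∧ k ≠ ℓ - 1 ∧ ∃ i, i ≤ ℓ - 1 ∧ Even i ∧
      (k = i + 1 ∨ i = k + 1) ∧ c = edgePt ℓ a b i := by
  by_cases h0 : k = 0
  · rw [h0, edgePt_zero] at h
    exact (inc_vert hℓ.1 h).elim
  by_cases h1 : k = ℓ - 1
  · rw [h1, edgePt_last hℓ.2] at h
    exact (inc_vert hℓ.1 h).elim
  have : edgePt ℓ a b k = edge a b k := by simp [edgePt, h0, h1]
  rw [this] at h
  obtain ⟨h2, h3, -, h4⟩ := inc_edge hℓ.1 h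
  exact ⟨h2, h3, h1, h4⟩

/-- The cells below a cell of a subdivided square lie in the same square. -/
theorem inc_facePt (hℓ : Odd ℓ ∧ 3 ≤ ℓ) {c : Place T.V} {x q z q' : T.V}
    {k l : ℕ} (hk : k ≤ ℓ - 1) (hl : l ≤ ℓ - 1) (h : T.Inc ℓ c (facePt ℓ x q z q' k l)) :
    (∃ i, i ≤ ℓ - 1 ∧ Even i ∧ (k = i + 1 ∨ i = k + 1) ∧ c = facePt ℓ x q z q' i l) ∨
    (∃ j, j ≤ ℓ - 1 ∧ Even j ∧ (l = j + 1 ∨ j = l + 1) ∧ c = facePt ℓ x q z q' k j) := by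
  rcases Nat.eq_zero_or_pos l with rfl | hl0
  · rw [facePt_bot] at h
    obtain ⟨-, -, -, i, h1, h2, h3, rfl⟩ := inc_edgePt hℓ h
    exact Or.inl ⟨i, h1, h2, h3, (facePt_bot _ _ _ _ _).symm⟩
  rcases eq_or_lt_of_le hl with rfl | hl1
  · rw [facePt_top _ _ _ _ _ hℓ.2] at h
    obtain ⟨-, -, -, i, h1, h2, h3, rfl⟩ := inc_edgePt hℓ h
    exact Or.inl ⟨i, h1, h2, h3, (facePt_top _ _ _ _ _ hℓ.2).symm⟩
  rcases Nat.eq_zero_or_pos k with rfl | hk0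
  · rw [facePt_zero _ _ _ _ _ hℓ.2] at h
    obtain ⟨-, -, -, i, h1, h2, h3, rfl⟩ := inc_edgePt hℓ h
    exact Or.inr ⟨i, h1, h2, h3, (facePt_zero _ _ _ _ _ hℓ.2).symm⟩
  rcases eq_or_lt_of_le hk with rfl | hk1
  · rw [facePt_last _ _ _ _ _ hℓ.2] at h
    obtain ⟨-, -, -, i, h1, h2, h3, rfl⟩ := inc_edgePt hℓ h
    exact Or.inr ⟨i, h1, h2, h3, (facePt_last _ _ _ _ _ hℓ.2).symm⟩
  rw [facePt_mid _ _ _ _ hk0 hk1 hl0 hl1] at h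
  obtain ⟨p, p', i, i', j, -, hi, hie, hii, -, -, -, -, rfl, hs⟩ := inc_sq hℓ.1 h
  rcases Sym2.eq_iff.1 hs with ⟨h1, h2⟩ | ⟨h1, h2⟩
  · cases h1
    cases h2
    exact Or.inl ⟨i, hi, hie, hii, rfl⟩
  · cases h1
    cases h2
    exact Or.inr ⟨i, hi, hie, hii, (facePt_swap _ _ _ _ _ _ hℓ.2).symm⟩

theorem edgePt_eq_left {a b b' : T.V} {i k : ℕ} (h : a ≠ b) (h' : a ≠ b')
    (e : edgePt ℓ a b i = edgePt ℓ a b' k) : k = i ∧ (0 < i → b' = b) := by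
  unfold edgePt at e
  split_ifs at e <;> simp_all

theorem edgePt_eq_right {a b a' b' : T.V} {i k : ℕ} (hi : 0 < i) (hk : 0 < k)
    (e : edgePt ℓ a b i = edgePt ℓ a' b' k) : b' = b ∧ k = i ∧ (k ≠ ℓ - 1 → a' = a) := by
  unfold edgePt at e
  split_ifs at e <;> simp_all

theorem edgePt_ne {a b a' b' : T.V} {i k : ℕ} (hi : 0 < i) (h1 : a' ≠ a) (h2 : a' ≠ b)
    (h3 : b' ≠ b) : edgePt ℓ a b i ≠ edgePt ℓ a' b' k := by
  intro e
  unfold edgePt at e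
  split_ifs at e <;> simp_all

theorem edgePt_ne_sq {a b x z : T.V} {i : ℕ} {s : Sym2 (T.V × ℕ)} : edgePt ℓ a b i ≠ sq x z s := by
  intro e
  unfold edgePt at e
  split_ifs at e

/-- Data on the positions of the squares around an `X`-check that are compatible with the gluing of the
squares are functions of the cells. -/
theorem IsRegular.glue (hT : T.IsRegular) (hℓ : 3 ≤ ℓ) {x : T.V} {α : Type}
    (U : T.V → T.V → T.V → ℕ → ℕ → α)
    (swap : ∀ q z q' i j, T.face x q z q' → i ≤ ℓ - 1 → j ≤ ℓ - 1 → Even i → Even j →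
      U q' z q j i = U q z q' i j)
    (axis : ∀ q z q' w q'' i, T.face x q z q' → T.face x q w q'' → 0 < i → i ≤ ℓ - 1 → Even i →
      U q z q' i 0 = U q w q'' i 0)
    (orig : ∀ q z q' p w p', T.face x q z q' → T.face x p w p' → U q z q' 0 0 = U p w p' 0 0)
    {q z q' p w p' : T.V} {i j k l : ℕ} (hF : T.face x q z q') (hG : T.face x p w p')
    (hi : i ≤ ℓ - 1) (hj : j ≤ ℓ - 1) (hk : k ≤ ℓ - 1) (hl : l ≤ ℓ - 1) (ei : Even i) (ej : Even j)
    (ek : Even k) (el : Even l) (e : facePt ℓ x q z q' i j = facePt ℓ x p w p' k l) :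
    U q z q' i j = U p w p' k l := by
  -- Up to exchanging the coordinates, a position lies on the axis `j = 0`, on the far side `i = ℓ -
  -- 1` off that axis, or in the interior. This leaves few coincidences of names to examine.
  have norm : ∀ i j, i ≤ ℓ - 1 → j ≤ ℓ - 1 →
      (j = 0 ∨ (i = ℓ - 1 ∧ 0 < j) ∨ (0 < i ∧ i < ℓ - 1 ∧ 0 < j ∧ j < ℓ - 1)) ∨
      (i = 0 ∨ (j = ℓ - 1 ∧ 0 < i) ∨ (0 < j ∧ j < ℓ - 1 ∧ 0 < i ∧ i < ℓ - 1)) := by omega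
  have off : ∀ {q z q' p w p' : T.V} {i j l : ℕ}, T.face x q z q' → T.face x p w p' →
      (i = ℓ - 1 ∧ 0 < j ∨ (0 < i ∧ i < ℓ - 1 ∧ 0 < j ∧ j < ℓ - 1)) →
      facePt ℓ x q z q' i j = edgePt ℓ x p l → False := by
    intro q z q' p w p' i j l hF hG hij e
    obtain ⟨f1, f2, f3, f4, f5, f6, d1, d2, d3, d4⟩ := face_corners hF
    obtain ⟨g1, g2, g3, g4, g5, g6, e1, e2, e3, e4⟩ := face_corners hG
    rcases hij with ⟨rfl, hj⟩ | ⟨h1, h2, h3, h4⟩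
    · rw [facePt_last _ _ _ _ _ hℓ] at e
      refine edgePt_ne hj f1 f5 (fun h => ?_) e
      rw [h] at e2
      omega
    · rw [facePt_mid _ _ _ _ h1 h2 h3 h4] at e
      exact edgePt_ne_sq e.symm
  have core : ∀ {q z q' p w p' : T.V} {i j k l : ℕ}, T.face x q z q' → T.face x p w p' → i ≤ ℓ - 1 →
      j ≤ ℓ - 1 → k ≤ ℓ - 1 → l ≤ ℓ - 1 → Even i → Even j → Even k → Even l →
      (j = 0 ∨ (i = ℓ - 1 ∧ 0 < j) ∨ (0 < i ∧ i < ℓ - 1 ∧ 0 < j ∧ j < ℓ - 1)) →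
      (l = 0 ∨ (k = ℓ - 1 ∧ 0 < l) ∨ (0 < k ∧ k < ℓ - 1 ∧ 0 < l ∧ l < ℓ - 1)) →
      facePt ℓ x q z q' i j = facePt ℓ x p w p' k l → U q z q' i j = U p w p' k l := by
    intro q z q' p w p' i j k l hF hG hi hj hk hl ei ej ek el h1 h2 e
    obtain ⟨f1, f2, f3, f4, f5, f6, d1, d2, d3, d4⟩ := face_corners hF
    obtain ⟨g1, g2, g3, g4, g5, g6, e1, e2, e3, e4⟩ := face_corners hG
    rcases h1 with rfl | h1
    · rcases h2 with rfl | h2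
      · rw [facePt_bot, facePt_bot] at e
        obtain ⟨rfl, hpq⟩ := edgePt_eq_left f1 g1 e
        rcases Nat.eq_zero_or_pos k with rfl | hi0
        · exact orig _ _ _ _ _ _ hF hG
        · obtain rfl := hpq hi0
          exact axis _ _ _ _ _ _ hF hG hi0 hi ei
      · rw [facePt_bot] at e
        exact (off hG hF h2 e.symm).elim
    · rcases h2 with rfl | h2
      · rw [facePt_bot] at e
        exact (off hF hG h1 e).elim
      rcases h1 with ⟨rfl, h1⟩ | ⟨i0, i1, j0, j1⟩
      · rcases h2 with ⟨rfl, h2⟩ | ⟨k0, k1, l0, l1⟩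
        · rw [facePt_last _ _ _ _ _ hℓ, facePt_last _ _ _ _ _ hℓ] at e
          obtain ⟨rfl, rfl, hpq⟩ := edgePt_eq_right h1 h2 e
          -- A common cell of two far sides determines `z`, and only one square has the corners `x`
          -- and `z`; so the faces are equal or exchanged. If they are exchanged, the common cell is
          -- the corner `z`.
          have u1 := hT.square_unique _ _ _ _ _ _ hF hG
          have u2 := hT.square_unique _ _ _ _ _ _ hF (T.face_symm _ _ _ _ hG)
          rcases u1 with rfl | rfl
          · rcases u2 with rfl | rfl
            · exact absurd rfl g6
            · rfl
          · rcases u2 with rfl | rfl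
            · by_cases hl1 : l = ℓ - 1
              · subst hl1
                exact (swap _ _ _ _ _ hF hi hj ei ej).symm
              · exact absurd (hpq hl1).symm f6
            · exact absurd rfl g6
        · rw [facePt_last _ _ _ _ _ hℓ, facePt_mid _ _ _ _ k0 k1 l0 l1] at e
          exact (edgePt_ne_sq e).elim
      · rcases h2 with ⟨rfl, h2⟩ | ⟨k0, k1, l0, l1⟩
        · rw [facePt_last _ _ _ _ _ hℓ, facePt_mid _ _ _ _ i0 i1 j0 j1] at e
          exact (edgePt_ne_sq e.symm).elim
        · rw [facePt_mid _ _ _ _ i0 i1 j0 j1, facePt_mid _ _ _ _ k0 k1 l0 l1] at e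
          injection e with _ hz hs
          subst hz
          rcases Sym2.eq_iff.1 hs with ⟨h1, h2⟩ | ⟨h1, h2⟩
          · cases h1
            cases h2
            rfl
          · cases h1
            cases h2
            exact (swap _ _ _ _ _ hF hi hj ei ej).symm
  have hF' := T.face_symm _ _ _ _ hF
  have hG' := T.face_symm _ _ _ _ hG
  rcases norm i j hi hj with h1 | h1 <;> rcases norm k l hk hl with h2 | h2
  · exact core hF hG hi hj hk hl ei ej ek el h1 h2 e
  · rw [← swap _ _ _ _ _ hG hk hl ek el]
    rw [← facePt_swap _ _ _ _ k l hℓ] at e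
    exact core hF hG' hi hj hl hk ei ej el ek h1 h2 e
  · rw [← swap _ _ _ _ _ hF hi hj ei ej]
    rw [← facePt_swap _ _ _ _ i j hℓ] at e
    exact core hF' hG hj hi hk hl ej ei ek el h1 h2 e
  · rw [← swap _ _ _ _ _ hF hi hj ei ej, ← swap _ _ _ _ _ hG hk hl ek el]
    rw [← facePt_swap _ _ _ _ i j hℓ, ← facePt_swap _ _ _ _ k l hℓ] at e
    exact core hF' hG' hj hi hl hk ej ei el ek h1 h2 e

theorem inStar_facePt {x q z q' : T.V} (h : T.face x q z q') {i j : ℕ} (hi : i ≤ ℓ - 1)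
    (hj : j ≤ ℓ - 1) : T.InStar ℓ x (facePt ℓ x q z q' i j) :=
  Or.inl ⟨q, z, q', i, j, h, hi, hj, rfl⟩

theorem InStar.exists_facePt {x : T.V} (hx : T.deg x = 0) {c : Place T.V} (h : T.InStar ℓ x c) :
    ∃ q z q' i j, T.face x q z q' ∧ i ≤ ℓ - 1 ∧ j ≤ ℓ - 1 ∧ c = facePt ℓ x q z q' i j := by
  rcases h with h | h | h
  · exact h
  · have := h.1; omega
  · have := h.1; omega

/-- The link of a vertex in the subdivided star of an `X`-check is connected. -/
theorem IsRegular.star_link (hT : T.IsRegular) (hℓ : Odd ℓ ∧ 3 ≤ ℓ) {x : T.V} (hx : T.deg x = 0)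
    {p : Place T.V} (hp0 : p.dim = 0) {α : Type} (g : Place T.V → α)
    (hg : ∀ e f, T.InStar ℓ x f → T.Inc ℓ p e → T.Inc ℓ e f → g e = g f) {e e' : Place T.V}
    (he : T.InStar ℓ x e) (he' : T.InStar ℓ x e') (hp : T.Inc ℓ p e) (hp' : T.Inc ℓ p e') :
    g e = g e' := by
  have hn : 2 ≤ ℓ - 1 := by have := hℓ.2; omega
  -- the edges at `p` within a square
  have cross : ∀ {q z q' i j i' j'}, T.face x q z q' → p = facePt ℓ x q z q' i j → i ≤ ℓ - 1 →
      j ≤ ℓ - 1 → Even i → Even j → i' ≤ ℓ - 1 → j' ≤ ℓ - 1 → (i' = i + 1 ∨ i = i' + 1) →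
      (j' = j + 1 ∨ j = j' + 1) → g (facePt ℓ x q z q' i' j) = g (facePt ℓ x q z q' i j') := by
    rintro q z q' i j i' j' hF rfl hi hj ei ej hi' hj' hii hjj
    rw [hg _ (facePt ℓ x q z q' i' j') (inStar_facePt hF hi' hj')
      (inc_facePt_left hℓ.2 hF hi hi' hj ei hii) (inc_facePt_right hℓ.2 hF hi' hj hj' ej hjj),
      ← hg (facePt ℓ x q z q' i j') _ (inStar_facePt hF hi' hj')
      (inc_facePt_right hℓ.2 hF hi hj hj' ej hjj) (inc_facePt_left hℓ.2 hF hi hi' hj' ei hii)]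
  have step : ∀ i, i ≤ ℓ - 1 → ∃ i', i' ≤ ℓ - 1 ∧ (i' = i + 1 ∨ i = i' + 1) := by
    intro i hi
    rcases Nat.eq_zero_or_pos i with rfl | h
    · exact ⟨1, by omega, by omega⟩
    · exact ⟨i - 1, by omega, by omega⟩
  have line : ∀ {q z q' i j i' k}, T.face x q z q' → p = facePt ℓ x q z q' i j → i ≤ ℓ - 1 →
      j ≤ ℓ - 1 → Even i → Even j → i' ≤ ℓ - 1 → k ≤ ℓ - 1 → (i' = i + 1 ∨ i = i' + 1) →
      (k = i + 1 ∨ i = k + 1) → g (facePt ℓ x q z q' i' j) = g (facePt ℓ x q z q' k j) := by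
    intro q z q' i j i' k hF hp hi hj ei ej hi' hk hii hik
    obtain ⟨j', hj', hjj⟩ := step j hj
    rw [cross hF hp hi hj ei ej hi' hj' hii hjj, cross hF hp hi hj ei ej hk hj' hik hjj]
  -- Each square that contains `p` singles out one edge at `p`, along its first coordinate. On the
  -- axis `j = 0` this edge lies in the side from `x` to `q`, hence is the same for all squares at
  -- that side.
  let up : ℕ → ℕ := fun i => if i = 0 then 1 else i - 1
  have up1 : ∀ i, i ≤ ℓ - 1 → up i ≤ ℓ - 1 ∧ (up i = i + 1 ∨ i = up i + 1) := by
    intro i hi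
    simp only [up]
    split_ifs <;> omega
  have main : ∀ e, T.InStar ℓ x e → T.Inc ℓ p e → ∃ q z q' i j, T.face x q z q' ∧ i ≤ ℓ - 1 ∧
      j ≤ ℓ - 1 ∧ Even i ∧ Even j ∧ p = facePt ℓ x q z q' i j ∧
      g e = g (facePt ℓ x q z q' (up i) j) := by
    intro e he hp
    obtain ⟨q, z, q', k, l, hF, hk, hl, rfl⟩ := he.exists_facePt hx
    have hdp := inc_dim hℓ.1 hp
    rw [dim_facePt hℓ.1, hp0] at hdp
    rcases inc_facePt hℓ hk hl hp with ⟨i, hi, ei, hik, rfl⟩ | ⟨j, hj, ej, hjl, rfl⟩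
    · have el : Even l := by
        rw [Nat.even_iff] at ei ⊢
        omega
      refine ⟨q, z, q', i, l, hF, hi, hl, ei, el, rfl, ?_⟩
      exact line hF rfl hi hl ei el hk (up1 i hi).1 (by omega) (up1 i hi).2
    · have ek : Even k := by
        rw [Nat.even_iff] at ej ⊢
        omega
      have hs := facePt_swap x q z q' k l hℓ.2
      have hs' := facePt_swap x q z q' k j hℓ.2
      refine ⟨q', z, q, j, k, T.face_symm _ _ _ _ hF, hj, hk, ej, ek, hs'.symm, ?_⟩
      rw [← hs]
      exact line (T.face_symm _ _ _ _ hF) hs'.symm hj hk ej ek hl (up1 j hj).1 (by omega) (up1 j hj).2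
  obtain ⟨q, z, q', i, j, hF, hi, hj, ei, ej, hpF, h1⟩ := main e he hp
  obtain ⟨r, w, r', k, l, hG, hk, hl, ek, el, hpG, h2⟩ := main e' he' hp'
  -- The set is empty at every position that does not name `p`, so the gluing conditions have
  -- content only at `p`.
  let U : T.V → T.V → T.V → ℕ → ℕ → Set α := fun q z q' i j =>
    {y | p = facePt ℓ x q z q' i j ∧ y = g (facePt ℓ x q z q' (up i) j)}
  have hU : U q z q' i j = U r w r' k l := by
    refine hT.glue hℓ.2 U ?_ ?_ ?_ hF hG hi hj hk hl ei ej ek el (hpF.symm.trans hpG)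
    · intro q z q' i j hF hi hj ei ej
      ext y
      simp only [U, Set.mem_ofPred_eq, facePt_swap _ _ _ _ _ _ hℓ.2]
      refine and_congr_right fun hp => ?_
      rw [cross hF hp hi hj ei ej (up1 i hi).1 (up1 j hj).1 (up1 i hi).2 (up1 j hj).2]
    · intro q z q' w q'' i hF hG hi0 hi ei
      simp only [U, facePt_bot]
    · intro q z q' r w r' hF hG
      ext y
      simp only [U, facePt_bot, edgePt_zero, Set.mem_ofPred_eq]
      refine and_congr_right fun hp => ?_
      -- At the centre, the first edges towards `q` and `q'` bound a common corner square for each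
      -- face, so this case is the connectedness of `∂X_x` again.
      have : g (edgePt ℓ x q 1) = g (edgePt ℓ x r 1) := by
        refine hT.eq_of_face hx (fun q => g (edgePt ℓ x q 1)) (fun q z q' hF => ?_)
          (T.face_adj _ _ _ _ hF).1 (T.face_adj _ _ _ _ hG).1
        have := cross (i' := 1) (j' := 1) hF (hp.trans (by rw [facePt_bot, edgePt_zero]))
          (Nat.zero_le _) (Nat.zero_le _) Even.zero Even.zero (by omega) (by omega) (Or.inl rfl)
          (Or.inl rfl)
        rwa [facePt_bot, facePt_zero _ _ _ _ _ hℓ.2] at this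
      rw [show up 0 = 1 from rfl, this]
  have h3 : g e ∈ U q z q' i j := ⟨hpF, h1⟩
  rw [hU] at h3
  rw [h3.2, h2]

end StarGeometry

end TannerComplex

/-! ### The replacement of a regular complex is regular -/

namespace TannerComplex

open Place

section RegularReplacement

variable {T : TannerComplex} {ℓ : ℕ}

theorem boundary_connected_of_down {v : T.V} (hv : T.deg v = 2)
    (hne : ∃ b a, T.adj b v ∧ T.adj a b)
    (h : ∀ (α : Type) (f : T.V → α), (∀ a b, T.adj a b → T.adj b v → f b = f a) →
      ∀ b b', T.adj b v → T.adj b' v → f b = f b') :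
    ((T.boundaryGraph v).induce (T.boundaryGraph v).support).Connected := by
  have key : ∀ G : SimpleGraph T.V, G = T.boundaryGraph v → (G.induce G.support).Connected →
      ((T.boundaryGraph v).induce (T.boundaryGraph v).support).Connected := by
    rintro _ rfl h
    exact h
  refine key _ (dual_boundaryGraph T v) (boundary_connected_of_up (T := T.dual) ?_ hne ?_)
  · change 2 - T.deg v = 0
    omega
  · exact fun α f hf => h α f fun a b h1 h2 => hf b a h2 h1

theorem exists_step (hℓ : 3 ≤ ℓ) {i : ℕ} (hi : i ≤ ℓ - 1) :
    ∃ i', i' ≤ ℓ - 1 ∧ (i' = i + 1 ∨ i = i' + 1) := by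
  rcases Nat.eq_zero_or_pos i with rfl | h
  · exact ⟨1, by omega, by omega⟩
  · exact ⟨i - 1, by omega, by omega⟩

theorem InStar.exists_edgePt {v : T.V} (hv : T.deg v = 1) {c : Place T.V} (h : T.InStar ℓ v c) :
    ∃ z j, T.adj v z ∧ j ≤ ℓ - 1 ∧ c = edgePt ℓ v z j := by
  rcases h with ⟨q, z, q', i, j, hF, -⟩ | h | h
  · have := (face_corners hF).2.2.2.2.2.2.1
    omega
  · exact h.2
  · have := h.1; omega

theorem InStar.eq_vert {v : T.V} (hv : T.deg v = 2) {c : Place T.V} (h : T.InStar ℓ v c) :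
    c = vert v := by
  rcases h with ⟨q, z, q', i, j, hF, -⟩ | h | h
  · have := (face_corners hF).2.2.2.2.2.2.1
    omega
  · have := h.1; omega
  · exact h.2

theorem InBdry.exists_edgePt {v : T.V} (hv : T.deg v = 0) {c : Place T.V} (h : T.InBdry ℓ v c) :
    ∃ q z q' j, T.face v q z q' ∧ j ≤ ℓ - 1 ∧ c = edgePt ℓ q z j := by
  rcases h with h | h
  · exact h
  · have := h.1; omega

theorem InStar.exists_inc_below (hℓ : Odd ℓ ∧ 3 ≤ ℓ) {v : T.V} {c : Place T.V} (h : T.InStar ℓ v c)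
    (hc : 0 < c.dim) : ∃ p, T.Inc ℓ p c := by
  rcases h with ⟨q, z, q', i, j, hF, hi, hj, rfl⟩ | ⟨-, z, j, hz, hj, rfl⟩ | ⟨-, rfl⟩
  · rw [dim_facePt hℓ.1] at hc
    rcases Nat.even_or_odd i with ei | oi
    · rw [Nat.even_iff] at ei
      refine ⟨_, inc_facePt_right (j := j - 1) hℓ.2 hF hi (by omega) hj ?_ (by omega)⟩
      rw [Nat.even_iff]
      omega
    · rw [Nat.odd_iff] at oi
      refine ⟨_, inc_facePt_left (i := i - 1) hℓ.2 hF (by omega) hi hj ?_ (by omega)⟩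
      rw [Nat.even_iff]
      omega
  · rw [dim_edgePt hℓ.1] at hc
    refine ⟨_, inc_edgePt_of (i := j - 1) hz (by omega) hj ?_ (by omega)⟩
    rw [Nat.even_iff]
    omega
  · simp [dim] at hc

theorem InStar.exists_inc_above (hℓ : Odd ℓ ∧ 3 ≤ ℓ) {v : T.V} {c : Place T.V} (h : T.InStar ℓ v c)
    (hc : T.deg v + c.dim ≤ 1) : ∃ d, T.InStar ℓ v d ∧ T.Inc ℓ c d := by
  rcases h with ⟨q, z, q', i, j, hF, hi, hj, rfl⟩ | ⟨hv, z, j, hz, hj, rfl⟩ | ⟨hv, rfl⟩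
  · rw [dim_facePt hℓ.1] at hc
    rcases Nat.even_or_odd i with ei | oi
    · obtain ⟨i', hi', hii⟩ := exists_step hℓ.2 hi
      exact ⟨_, inStar_facePt hF hi' hj, inc_facePt_left hℓ.2 hF hi hi' hj ei hii⟩
    · rw [Nat.odd_iff] at oi
      obtain ⟨j', hj', hjj⟩ := exists_step hℓ.2 hj
      exact ⟨_, inStar_facePt hF hi hj', inc_facePt_right hℓ.2 hF hi hj hj'
        (by rw [Nat.even_iff]; omega) hjj⟩
  · rw [dim_edgePt hℓ.1] at hc
    obtain ⟨j', hj', hjj⟩ := exists_step hℓ.2 hj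
    exact ⟨_, Or.inr (Or.inl ⟨hv, z, j', hz, hj', rfl⟩),
      inc_edgePt_of hz hj hj' (by rw [Nat.even_iff]; omega) hjj⟩
  · omega

theorem InBdry.exists_inc_above (hℓ : Odd ℓ ∧ 3 ≤ ℓ) {v : T.V} {c : Place T.V} (h : T.InBdry ℓ v c)
    (hc : T.deg v + c.dim ≤ 0) : ∃ d, T.InBdry ℓ v d ∧ T.Inc ℓ c d := by
  obtain ⟨q, z, q', j, hF, hj, rfl⟩ := h.exists_edgePt (by omega)
  rw [dim_edgePt hℓ.1] at hc
  obtain ⟨j', hj', hjj⟩ := exists_step hℓ.2 hj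
  exact ⟨_, Or.inl ⟨q, z, q', j', hF, hj', rfl⟩,
    inc_edgePt_of (T.face_adj _ _ _ _ hF).2.1 hj hj' (by rw [Nat.even_iff]; omega) hjj⟩

namespace LocalCell

theorem adj_of_inc {a b : T.LocalCell ℓ} (h1 : a.own = b.own) (h2 : T.Inc ℓ a.pos b.pos)
    (h3 : a.layer = b.layer) : a.adj b := Or.inl ⟨h1, Or.inl ⟨h2, h3⟩⟩

theorem adj_of_layer {a b : T.LocalCell ℓ} (h1 : a.own = b.own) (h2 : a.pos = b.pos)
    (h3 : a.layer ≠ 1) (h4 : b.layer = 1) : a.adj b := Or.inl ⟨h1, Or.inr ⟨h2, h3, h4⟩⟩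

theorem adj_of_own {a b : T.LocalCell ℓ} (h1 : T.adj a.own b.own) (h2 : a.pos = b.pos)
    (h3 : a.layer = b.layer) : a.adj b := Or.inr ⟨h1, h2, h3⟩

/-- The copy of a cell in the local complex of a lower neighbour of its owner. -/
def lift (hℓ : Odd ℓ ∧ 3 ≤ ℓ) (b : T.LocalCell ℓ) (x : T.V) (h : T.adj x b.own) : T.LocalCell ℓ :=
  ⟨x, b.pos, b.layer, (b.mem_star.inBdry hℓ h).inStar hℓ, fun _ => b.mem_star.inBdry hℓ h⟩

theorem lift_adj (hℓ : Odd ℓ ∧ 3 ≤ ℓ) (b : T.LocalCell ℓ) (x : T.V) (h : T.adj x b.own) :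
    (b.lift hℓ x h).adj b := adj_of_own h rfl rfl

theorem exists_below (hT : T.IsRegular) (hℓ : Odd ℓ ∧ 3 ≤ ℓ) (b : T.LocalCell ℓ) (hb : 1 ≤ b.deg) :
    ∃ a : T.LocalCell ℓ, a.adj b := by
  unfold deg at hb
  by_cases h1 : T.deg b.own = 1
  · obtain ⟨x, hx⟩ := (hT.qubit_checked _ h1).1
    exact ⟨_, b.lift_adj hℓ x hx⟩
  by_cases hl : b.layer = 1
  · exact ⟨⟨b.own, b.pos, 0, b.mem_star, fun h => absurd h (by decide)⟩,
      adj_of_layer rfl rfl (show (0 : Fin 3) ≠ 1 by decide) hl⟩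
  · rw [if_neg hl] at hb
    have := T.deg_le b.own
    by_cases h2 : T.deg b.own = 2
    · obtain ⟨q, x, q', hF⟩ := hT.dual.exists_face (x := b.own) (by change 2 - T.deg b.own = 0; omega)
      have hF' : T.face x q b.own q' := hF
      exact ⟨_, b.lift_adj hℓ q (T.face_adj _ _ _ _ hF').2.1⟩
    obtain ⟨p, hp⟩ := b.mem_star.exists_inc_below hℓ (by omega)
    exact ⟨⟨b.own, p, b.layer, b.mem_star.of_inc hℓ hp, fun h => absurd h hl⟩,
      adj_of_inc rfl hp rfl⟩

theorem exists_above (hℓ : Odd ℓ ∧ 3 ≤ ℓ) (b : T.LocalCell ℓ) (hb : b.deg ≤ 1) : ∃ c : T.LocalCell ℓ, b.adj c := by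
  unfold deg at hb
  by_cases hl : b.layer = 1
  · rw [if_pos hl] at hb
    obtain ⟨d, hd, hbd⟩ := (b.mem_bdry hl).exists_inc_above hℓ (by omega)
    exact ⟨⟨b.own, d, 1, hd.inStar hℓ, fun _ => hd⟩, adj_of_inc rfl hbd hl⟩
  · rw [if_neg hl] at hb
    obtain ⟨d, hd, hbd⟩ := b.mem_star.exists_inc_above hℓ (by omega)
    exact ⟨⟨b.own, d, b.layer, hd, fun h => absurd h hl⟩, adj_of_inc rfl hbd rfl⟩

/-- The link of an `X`-check of the replacement is connected. -/
theorem up_link (hT : T.IsRegular) (hℓ : Odd ℓ ∧ 3 ≤ ℓ) {a : T.LocalCell ℓ} (ha : a.deg = 0)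
    {α : Type} (f : T.LocalCell ℓ → α) (hf : ∀ b c, a.adj b → b.adj c → f b = f c)
    {b b' : T.LocalCell ℓ} (hb : a.adj b) (hb' : a.adj b') : f b = f b' := by
  classical
  unfold deg at ha
  have hl : a.layer ≠ 1 := fun h => by rw [if_pos h] at ha; omega
  rw [if_neg hl] at ha
  have hx : T.deg a.own = 0 := by omega
  have hp : a.pos.dim = 0 := by omega
  let mk : ∀ e, T.InStar ℓ a.own e → T.LocalCell ℓ := fun e he =>
    ⟨a.own, e, a.layer, he, fun h => absurd h hl⟩
  let g : Place T.V → Option α := fun e => if h : T.InStar ℓ a.own e then some (f (mk e h)) else none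
  have hg : ∀ e (h : T.InStar ℓ a.own e), g e = some (f (mk e h)) := fun e h => dif_pos h
  have link : ∀ e e' (he : T.InStar ℓ a.own e) (he' : T.InStar ℓ a.own e'), T.Inc ℓ a.pos e →
      T.Inc ℓ a.pos e' → f (mk e he) = f (mk e' he') := by
    intro e e' he he' hpe hpe'
    have := hT.star_link hℓ hx hp g (fun e s hs h1 h2 => by
      rw [hg _ hs, hg _ (hs.of_inc hℓ h2)]
      exact congrArg some (hf _ _ (adj_of_inc rfl h1 rfl) (adj_of_inc rfl h2 rfl))) he he' hpe hpe'
    rw [hg _ he, hg _ he'] at this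
    exact Option.some_injective _ this
  -- Every neighbour of `a` is joined to an edge at `a` in the star and in the layer of `a`: a
  -- vertical edge through the square over a boundary edge, and a copy in the complex of a qubit
  -- through the copy of an edge of that complex. This reduces the claim to `star_link`.
  have main : ∀ b : T.LocalCell ℓ, a.adj b →
      ∃ e, ∃ he : T.InStar ℓ a.own e, T.Inc ℓ a.pos e ∧ f b = f (mk e he) := by
    rintro b (⟨o, ⟨hi, hlay⟩ | ⟨hpos, -, hlay⟩⟩ | ⟨o, hpos, hlay⟩)
    · refine ⟨b.pos, o ▸ b.mem_star, hi, congrArg f ?_⟩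
      exact LocalCell.ext' o.symm rfl hlay.symm
    · have hbd : T.InBdry ℓ a.own a.pos := by
        rw [o, hpos]
        exact b.mem_bdry hlay
      obtain ⟨e, he, hpe⟩ := hbd.exists_inc_above hℓ (by omega)
      refine ⟨e, he.inStar hℓ, hpe, ?_⟩
      let c : T.LocalCell ℓ := ⟨a.own, e, 1, he.inStar hℓ, fun _ => he⟩
      rw [hf b c (adj_of_layer o hpos hl hlay) (adj_of_inc o.symm (hpos ▸ hpe) hlay)]
      exact (hf (mk e _) c (adj_of_inc rfl hpe rfl) (adj_of_layer rfl rfl hl rfl)).symm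
    · have hd := T.adj_deg _ _ o
      obtain ⟨e, he, hpe⟩ := b.mem_star.exists_inc_above hℓ (by rw [← hpos]; omega)
      have he' := (he.inBdry hℓ o).inStar hℓ
      refine ⟨e, he', hpos ▸ hpe, ?_⟩
      let c : T.LocalCell ℓ := ⟨b.own, e, a.layer, he, fun h => absurd h hl⟩
      rw [hf b c (adj_of_own o hpos hlay) (adj_of_inc rfl hpe hlay.symm)]
      exact (hf (mk e he') c (adj_of_inc rfl (by rw [hpos]; exact hpe) rfl) (adj_of_own o rfl rfl)).symm
  obtain ⟨e, he, h1, h2⟩ := main b hb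
  obtain ⟨e', he', h1', h2'⟩ := main b' hb'
  rw [h2, h2', link e e' he he' h1 h1']

/-- The link of a `Z`-check of the replacement is connected. -/
theorem down_link (hT : T.IsRegular) (hℓ : Odd ℓ ∧ 3 ≤ ℓ) {c : T.LocalCell ℓ} (hc : c.deg = 2)
    {α : Type} (f : T.LocalCell ℓ → α) (hf : ∀ a b, a.adj b → b.adj c → f b = f a)
    {b b' : T.LocalCell ℓ} (hb : b.adj c) (hb' : b'.adj c) : f b = f b' := by
  have hle := T.deg_le c.own
  -- If the neighbours fall into two nonempty classes and each member of one is joined to each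
  -- member of the other, all are joined.
  have join : ∀ (P Q : T.LocalCell ℓ → Prop), (∃ b, P b) → (∃ b, Q b) →
      (∀ b b', P b → Q b' → f b = f b') → (∀ b, b.adj c → P b ∨ Q b) → f b = f b' := by
    rintro P Q ⟨b₁, h₁⟩ ⟨b₂, h₂⟩ hPQ hall
    rcases hall b hb with h | h <;> rcases hall b' hb' with h' | h'
    · rw [hPQ _ _ h h₂, hPQ _ _ h' h₂]
    · exact hPQ _ _ h h'
    · exact (hPQ _ _ h' h).symm
    · rw [← hPQ _ _ h₁ h, hPQ _ _ h₁ h']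
  have hdeg := hc
  unfold deg at hdeg
  have hv : T.deg c.own = 0 ∨ T.deg c.own = 1 ∨ T.deg c.own = 2 := by omega
  -- In `Y_x`, `c` is a small square, and the two classes are its two pairs of opposite sides,
  -- joined through corners. In `Y_q`, `c` is an edge, and its ends are joined to its copies in
  -- complexes of X-checks through the copies of the ends. In `Y_z`, `c` is a point, and all its
  -- neighbours are copies of it.
  rcases hv with hv | hv | hv
  · have low : ∀ b : T.LocalCell ℓ, b.adj c → b.own = c.own := fun b hb =>
      (own_adj hb).resolve_right fun h => by
        have := T.adj_deg _ _ h
        omega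
    by_cases hl : c.layer = 1
    · rw [if_pos hl] at hdeg
      obtain ⟨p, hp⟩ := c.mem_star.exists_inc_below hℓ (by omega)
      have hbd := c.mem_bdry hl
      refine join (fun b => b.adj c ∧ b.layer = 1 ∧ T.Inc ℓ b.pos c.pos)
        (fun b => b.adj c ∧ b.layer ≠ 1 ∧ b.pos = c.pos)
        ⟨⟨c.own, p, 1, c.mem_star.of_inc hℓ hp, fun _ => hbd.of_inc hℓ hp⟩,
          adj_of_inc rfl hp hl.symm, rfl, hp⟩
        ⟨⟨c.own, c.pos, 0, c.mem_star, fun h => absurd h (by decide)⟩,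
          adj_of_layer rfl rfl (show (0 : Fin 3) ≠ 1 by decide) hl, show (0 : Fin 3) ≠ 1 by decide, rfl⟩ ?_ ?_
      · rintro b b' ⟨h1, h2, h3⟩ ⟨h1', h2', h3'⟩
        let a : T.LocalCell ℓ := ⟨b.own, b.pos, b'.layer, b.mem_star, fun h => absurd h h2'⟩
        rw [hf a b (adj_of_layer rfl rfl h2' h2) h1]
        exact (hf a b' (adj_of_inc ((low _ h1).trans (low _ h1').symm) (h3' ▸ h3) rfl) h1').symm
      · intro b hb
        rcases adj_local (low b hb) hb with ⟨h1, h2⟩ | ⟨h1, h2, -⟩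
        · exact Or.inl ⟨hb, h2.trans hl, h1⟩
        · exact Or.inr ⟨hb, h2, h1⟩
    · rw [if_neg hl] at hdeg
      obtain ⟨q, z, q', k, l, hF, hk, hl', hpos⟩ := c.mem_star.exists_facePt hv
      have hdim := dim_facePt hℓ.1 c.own q z q' k l
      rw [← hpos] at hdim
      have star : ∀ {p}, T.Inc ℓ p c.pos → T.InStar ℓ c.own p := fun h => c.mem_star.of_inc hℓ h
      have e1 : Even (k - 1) := by rw [Nat.even_iff]; omega
      have e2 : Even (l - 1) := by rw [Nat.even_iff]; omega
      have i1 : T.Inc ℓ (facePt ℓ c.own q z q' (k - 1) l) c.pos := by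
        rw [hpos]
        exact inc_facePt_left hℓ.2 hF (by omega) hk hl' e1 (by omega)
      have i2 : T.Inc ℓ (facePt ℓ c.own q z q' k (l - 1)) c.pos := by
        rw [hpos]
        exact inc_facePt_right hℓ.2 hF hk (by omega) hl' e2 (by omega)
      refine join
        (fun b => b.adj c ∧ ∃ i, i ≤ ℓ - 1 ∧ Even i ∧ (k = i + 1 ∨ i = k + 1) ∧
          b.pos = facePt ℓ c.own q z q' i l)
        (fun b => b.adj c ∧ ∃ j, j ≤ ℓ - 1 ∧ Even j ∧ (l = j + 1 ∨ j = l + 1) ∧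
          b.pos = facePt ℓ c.own q z q' k j)
        ⟨⟨c.own, _, c.layer, star i1, fun h => absurd h hl⟩, adj_of_inc rfl i1 rfl, k - 1,
          by omega, e1, by omega, rfl⟩
        ⟨⟨c.own, _, c.layer, star i2, fun h => absurd h hl⟩, adj_of_inc rfl i2 rfl, l - 1,
          by omega, e2, by omega, rfl⟩ ?_ ?_
      · rintro b b' ⟨h1, i, hi, ei, hik, hp⟩ ⟨h1', j, hj, ej, hjl, hp'⟩
        have lay : ∀ b : T.LocalCell ℓ, b.adj c → b.layer = c.layer := by
          intro b hb
          rcases adj_local (low b hb) hb with ⟨-, h2⟩ | ⟨-, -, h2⟩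
          · exact h2
          · exact absurd h2 hl
        let a : T.LocalCell ℓ := ⟨c.own, facePt ℓ c.own q z q' i j, c.layer,
          inStar_facePt hF hi hj, fun h => absurd h hl⟩
        rw [hf a b (adj_of_inc (low b h1).symm
          (hp ▸ inc_facePt_right hℓ.2 hF hi hj hl' ej hjl) (lay b h1).symm) h1]
        exact (hf a b' (adj_of_inc (low b' h1').symm
          (hp' ▸ inc_facePt_left hℓ.2 hF hi hk hj ei hik) (lay b' h1').symm) h1').symm
      · intro b hb
        rcases adj_local (low b hb) hb with ⟨h1, -⟩ | ⟨-, -, h2⟩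
        · rw [hpos] at h1
          rcases inc_facePt hℓ hk hl' h1 with h | h
          · exact Or.inl ⟨hb, h⟩
          · exact Or.inr ⟨hb, h⟩
        · exact absurd h2 hl
  · obtain ⟨x₀, hx₀⟩ := (hT.qubit_checked _ hv).1
    have hloc : ∃ b : T.LocalCell ℓ, b.adj c ∧ b.own = c.own := by
      by_cases hl : c.layer = 1
      · exact ⟨⟨c.own, c.pos, 0, c.mem_star, fun h => absurd h (by decide)⟩,
          adj_of_layer rfl rfl (show (0 : Fin 3) ≠ 1 by decide) hl, rfl⟩
      · rw [if_neg hl] at hdeg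
        obtain ⟨p, hp⟩ := c.mem_star.exists_inc_below hℓ (by omega)
        exact ⟨⟨c.own, p, c.layer, c.mem_star.of_inc hℓ hp, fun h => absurd h hl⟩,
          adj_of_inc rfl hp rfl, rfl⟩
    refine join (fun b => b.adj c ∧ b.own = c.own) (fun b => b.adj c ∧ T.adj b.own c.own) hloc
      ⟨_, c.lift_adj hℓ x₀ hx₀, hx₀⟩ ?_ ?_
    · rintro b b' ⟨h1, h2⟩ ⟨h1', h2'⟩
      have o : T.adj b'.own b.own := h2 ▸ h2'
      rw [hf _ b (b.lift_adj hℓ b'.own o) h1]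
      obtain ⟨p3, l3⟩ := adj_connect h2' h1'
      refine (hf (b.lift hℓ b'.own o) b' (Or.inl ⟨rfl, ?_⟩) h1').symm
      rw [p3, l3]
      have h3 := adj_local h2 h1
      exact h3
    · intro b hb
      rcases own_adj hb with h | h
      · exact Or.inl ⟨hb, h⟩
      · exact Or.inr ⟨hb, h⟩
  · have hpos := c.mem_star.eq_vert hv
    rw [hpos] at hdeg
    have hl : c.layer ≠ 1 := fun h => by
      rw [if_pos h] at hdeg
      omega
    have up : ∀ b : T.LocalCell ℓ, b.adj c → T.adj b.own c.own ∧ b.pos = c.pos ∧ b.layer = c.layer := by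
      intro b hb
      rcases own_adj hb with h | h
      · rcases adj_local h hb with ⟨h1, -⟩ | ⟨-, -, h1⟩
        · rw [hpos] at h1
          exact (inc_vert hℓ.1 h1).elim
        · exact absurd h1 hl
      · exact ⟨h, adj_connect h hb⟩
    classical
    let g : T.V → Option α := fun q => if h : T.adj q c.own then some (f (c.lift hℓ q h)) else none
    have hg : ∀ q (h : T.adj q c.own), g q = some (f (c.lift hℓ q h)) := fun q h => dif_pos h
    have hlift : ∀ b (hb : b.adj c), b = c.lift hℓ b.own (up b hb).1 := fun b hb =>
      LocalCell.ext' rfl (up b hb).2.1 (up b hb).2.2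
    -- The neighbours correspond to the qubits at the Z-check. Two qubits of one face are joined
    -- through the copy of `c` in the complex of the X-check of that face, so the connectedness
    -- around this Z-check in `T` applies.
    have := hT.dual.eq_of_face (x := c.own) (q := b.own) (q' := b'.own)
      (by change 2 - T.deg c.own = 0; omega) g (fun q x q' hF => ?_) (up b hb).1 (up b' hb').1
    · rw [hg _ (up b hb).1, hg _ (up b' hb').1, ← hlift b hb, ← hlift b' hb'] at this
      exact Option.some_injective _ this
    · have hF' : T.face x q c.own q' := hF
      obtain ⟨h1, h2, h3, h4⟩ := T.face_adj _ _ _ _ hF'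
      rw [hg q h2, hg q' h4,
        hf _ (c.lift hℓ q h2) ((c.lift hℓ q h2).lift_adj hℓ x h1) (c.lift_adj hℓ q h2),
        hf _ (c.lift hℓ q' h4) ((c.lift hℓ q' h4).lift_adj hℓ x h3) (c.lift_adj hℓ q' h4)]
      rfl

end LocalCell

/-- A path through three local complexes keeps its place and layer, so uniqueness of squares is
inherited from `T`; every other path has a single partner by `LocalCell.diamond`. Connectedness is
`up_link` and `down_link`. -/
theorem IsRegular.replaceX (hT : T.IsRegular) (hℓ : Odd ℓ ∧ 3 ≤ ℓ) :
    (T.replaceX ℓ hℓ).tot.IsRegular where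
  square_unique := by
    rintro a b c b' r r' ⟨h1, h2, h3, h4, h5, h6⟩ ⟨g1, g2, g3, g4, g5, g6⟩
    by_cases hb : T.adj a.own b.own ∧ T.adj b.own c.own
    · obtain ⟨o1, o2⟩ := LocalCell.through_own hb.1 hb.2 g1 g2
      obtain ⟨o3, o4⟩ := LocalCell.through_own hb.1 hb.2 h3 h4
      have eq : ∀ b : T.LocalCell ℓ, T.adj a.own b.own → a.adj b → r.own = b.own → r = b := by
        intro b ho hab e
        obtain ⟨p1, l1⟩ := LocalCell.adj_connect ho hab
        obtain ⟨p2, l2⟩ := LocalCell.adj_connect o1 g1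
        exact LocalCell.ext' e (p2.symm.trans p1) (l2.symm.trans l1)
      rcases hT.square_unique _ _ _ _ _ _ (h6 hb.1 hb.2) (g6 o1 o2) with h | h
      · exact Or.inl (eq _ hb.1 h1 h)
      · exact Or.inr (eq _ o3 h3 h)
    · obtain ⟨d, -, -, -, hd⟩ := LocalCell.diamond hℓ h1 h2 hb
      rcases hd _ h3 h4 with h | h
      · exact absurd h.symm h5
      · rw [h]
        exact hd _ g1 g2
  boundary_connected := by
    intro v hv
    have hle : LocalCell.deg v ≤ 2 := LocalCell.deg_le hℓ v
    have hv : LocalCell.deg v ≠ 1 := hv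
    have h02 : LocalCell.deg v = 0 ∨ LocalCell.deg v = 2 := by omega
    rcases h02 with h0 | h2
    · refine boundary_connected_of_up h0 ?_ fun α f hf b b' => LocalCell.up_link hT hℓ h0 f hf
      obtain ⟨b, hb⟩ := LocalCell.exists_above hℓ v (by omega)
      have hb1 := LocalCell.adj_deg hℓ hb
      obtain ⟨c, hc⟩ := LocalCell.exists_above hℓ b (by omega)
      exact ⟨b, c, hb, hc⟩
    · refine boundary_connected_of_down h2 ?_ fun α f hf b b' => LocalCell.down_link hT hℓ h2 f hf
      obtain ⟨b, hb⟩ := LocalCell.exists_below hT hℓ v (by omega)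
      have hb1 := LocalCell.adj_deg hℓ hb
      obtain ⟨a, ha⟩ := LocalCell.exists_below hT hℓ b (by omega)
      exact ⟨b, a, hb, ha⟩
  qubit_checked := by
    intro b hb
    have hb : LocalCell.deg b = 1 := hb
    exact ⟨LocalCell.exists_below hT hℓ b hb.ge, LocalCell.exists_above hℓ b hb.le⟩

theorem IsRegular.replaceZ (hT : T.IsRegular) (hℓ : Odd ℓ ∧ 3 ≤ ℓ) :
    (T.replaceZ ℓ hℓ).tot.IsRegular := (hT.dual.replaceX hℓ).dual

theorem IsRegular.level (hT : T.IsRegular) (hℓ : Odd ℓ ∧ 3 ≤ ℓ) (i : ℕ) :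
    (T.level ℓ hℓ i).IsRegular := by
  induction i with
  | zero => exact hT
  | succ i ih =>
    unfold TannerComplex.level
    split_ifs
    · exact ih.replaceX hℓ
    · exact ih.replaceZ hℓ

end RegularReplacement

end TannerComplex

/-! ### The seed -/

namespace TannerComplex

theorem surfaceCode_isRegular : surfaceCode.IsRegular := by
  let D : Fin 9 → ℕ := ![0, 0, 1, 1, 1, 1, 1, 2, 2]
  refine ⟨?_, fun v hv => ?_, ?_⟩
  · have : ∀ x q : Fin 9, surfaceEdge x q → ∀ z, surfaceEdge q z → ∀ q', surfaceEdge x q' →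
        surfaceEdge q' z → q ≠ q' → ∀ r, surfaceEdge x r → surfaceEdge r z → r = q ∨ r = q' := by
      decide
    rintro x q z q' r r' ⟨⟨h1, h2, h3, h4⟩, h5⟩ ⟨⟨g1, g2, -⟩, -⟩
    exact this x q h1 z h2 q' h3 h4 h5 r g1 g2
  · have h3 : surfaceCode.deg v = 0 ∨ surfaceCode.deg v = 2 := by
      have := surfaceCode.deg_le v
      omega
    rcases h3 with h3 | h3
    · have ne : ∀ v : Fin 9, D v = 0 → ∃ b c, surfaceEdge v b ∧ surfaceEdge b c := by decide
      refine boundary_connected_of_up h3 (ne v h3) fun α f hf => ?_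
      -- Qubit `4` belongs to all four checks. Every other qubit of `v` shares with it a check of
      -- the other type, so the whole link is connected through `4`.
      have hub : ∀ v : Fin 9, D v = 0 → surfaceEdge v 4 ∧ ∀ b, surfaceEdge v b →
          b = 4 ∨ ∃ c, surfaceEdge b c ∧ surfaceEdge 4 c := by decide
      have key : ∀ b : Fin 9, surfaceEdge v b → f b = f (4 : Fin 9) := by
        intro b hb
        rcases (hub v h3).2 b hb with rfl | ⟨c, h1, h2⟩
        · rfl
        · exact (hf b c hb h1).trans (hf (4 : Fin 9) c (hub v h3).1 h2).symm
      exact fun b b' hb hb' => (key b hb).trans (key b' hb').symm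
    · have ne : ∀ v : Fin 9, D v = 2 → ∃ b a, surfaceEdge b v ∧ surfaceEdge a b := by decide
      refine boundary_connected_of_down h3 (ne v h3) fun α f hf => ?_
      have hub : ∀ v : Fin 9, D v = 2 → surfaceEdge 4 v ∧ ∀ b, surfaceEdge b v →
          b = 4 ∨ ∃ a, surfaceEdge a b ∧ surfaceEdge a 4 := by decide
      have key : ∀ b : Fin 9, surfaceEdge b v → f b = f (4 : Fin 9) := by
        intro b hb
        rcases (hub v h3).2 b hb with rfl | ⟨a, h1, h2⟩
        · rfl
        · exact (hf a b h1 hb).trans (hf a (4 : Fin 9) h2 (hub v h3).1).symm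
      exact fun b b' hb hb' => (key b hb).trans (key b' hb').symm
  · have : ∀ q : Fin 9, D q = 1 → (∃ x, surfaceEdge x q) ∧ ∃ z, surfaceEdge q z := by decide
    exact this

end TannerComplex

/-! ### Potentials on lines and grids -/

section Grid

/-- Even positions are the vertices of a subdivided edge, so this is constancy along that edge. -/
theorem eq_zero_of_even_step {α : Type*} {n : ℕ} (h : ℕ → α)
    (hh : ∀ i, Even i → i + 2 ≤ n → h (i + 2) = h i) {i : ℕ} (ei : Even i) (hi : i ≤ n) :
    h i = h 0 := by
  obtain ⟨k, rfl⟩ := ei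
  induction k with
  | zero => rfl
  | succ k ih =>
    rw [show k + 1 + (k + 1) = k + k + 2 by ring, hh _ ⟨k, rfl⟩ (by omega)]
    exact ih (by omega)

theorem ZMod.add_eq_iff_two (a b c : ZMod 2) : a + b = c ↔ b = a + c := by
  revert a b c
  decide

/-- A potential on a line is determined by its initial value, since the sum of two potentials for
the same data has no increments. Here `a (i + 1)` is the value on the edge between the vertices `i`
and `i + 2`. -/
theorem eq_of_even_step {n : ℕ} (a w w' : ℕ → ZMod 2) (h0 : w 0 = w' 0)
    (h : ∀ i, Even i → i + 2 ≤ n → w i + w (i + 2) = a (i + 1))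
    (h' : ∀ i, Even i → i + 2 ≤ n → w' i + w' (i + 2) = a (i + 1)) {i : ℕ} (ei : Even i)
    (hi : i ≤ n) : w i = w' i := by
  have key := eq_zero_of_even_step (n := n) (fun i => w i + w' i) (fun i ei hi => by
    have h1 := h i ei hi
    have h2 := h' i ei hi
    rw [ZMod.add_eq_iff_two] at h1 h2
    rw [h1, h2]
    have := CharTwo.add_self_eq_zero (a (i + 1))
    linear_combination this) ei hi
  have h2 : w i + w' i = 0 := by
    rw [key, h0]
    exact CharTwo.add_self_eq_zero _
  exact CharTwo.add_eq_zero.1 h2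

/-- A closed one-cochain on a grid is exact. -/
theorem exists_grid_potential {n : ℕ} (a : ℕ → ℕ → ZMod 2)
    (ha : ∀ i j, Even i → Even j → i + 2 ≤ n → j + 2 ≤ n →
      a i (j + 1) + a (i + 2) (j + 1) + a (i + 1) j + a (i + 1) (j + 2) = 0) :
    ∃ w : ℕ → ℕ → ZMod 2, w 0 0 = 0 ∧
      (∀ i j, Even i → Even j → i + 2 ≤ n → j ≤ n → w i j + w (i + 2) j = a (i + 1) j) ∧
      ∀ i j, Even i → Even j → i ≤ n → j + 2 ≤ n → w i j + w i (j + 2) = a i (j + 1) := by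
  -- Integration along the bottom row and then up the column. Vertical increments are right by
  -- construction; horizontal ones follow by induction on the row, with closedness on each small
  -- square.
  let w : ℕ → ℕ → ZMod 2 := fun i j => ∑ s ∈ Finset.range (i / 2), a (2 * s + 1) 0 +
    ∑ t ∈ Finset.range (j / 2), a i (2 * t + 1)
  have hv : ∀ i j, Even j → w i j + w i (j + 2) = a i (j + 1) := by
    rintro i j ⟨k, rfl⟩
    simp only [w]
    rw [show (k + k + 2) / 2 = k + 1 by omega, show (k + k) / 2 = k by omega,
      Finset.sum_range_succ, show 2 * k + 1 = k + k + 1 by ring]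
    have h1 := CharTwo.add_self_eq_zero (∑ s ∈ Finset.range (i / 2), a (2 * s + 1) 0)
    have h2 := CharTwo.add_self_eq_zero (∑ t ∈ Finset.range k, a i (2 * t + 1))
    linear_combination h1 + h2
  refine ⟨w, by simp [w], ?_, fun i j _ ej _ _ => hv i j ej⟩
  rintro i j ei ⟨k, rfl⟩ hi hj
  induction k with
  | zero =>
    obtain ⟨m, rfl⟩ := ei
    simp only [w]
    rw [show (m + m + 2) / 2 = m + 1 by omega, show (m + m) / 2 = m by omega,
      Finset.sum_range_succ, show 2 * m + 1 = m + m + 1 by ring]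
    have h1 := CharTwo.add_self_eq_zero (∑ s ∈ Finset.range m, a (2 * s + 1) 0)
    simp only [add_zero, Nat.zero_div, Finset.range_zero, Finset.sum_empty]
    linear_combination h1
  | succ k ih =>
    have h1 := ih (by omega)
    have h2 := hv i (k + k) ⟨k, rfl⟩
    have h3 := hv (i + 2) (k + k) ⟨k, rfl⟩
    have h4 := ha i (k + k) ei ⟨k, rfl⟩ hi (by omega)
    rw [show k + 1 + (k + 1) = k + k + 2 by ring]
    rw [ZMod.add_eq_iff_two] at h1 h2 h3
    rw [h2, h3, h1]
    have h5 := CharTwo.add_self_eq_zero (w i (k + k))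
    have h6 := CharTwo.add_self_eq_zero (a (i + 1) (k + k + 2))
    linear_combination h4 + h5 - h6
end Grid

/-! ### Exactness on the star and on its double -/

namespace TannerComplex

open Place

section StarPotential

variable {T : TannerComplex} {ℓ : ℕ}

/-- A closed one-cochain on the subdivided star of an `X`-check is exact. -/
theorem IsRegular.exists_star_potential (hT : T.IsRegular) (hℓ : Odd ℓ ∧ 3 ≤ ℓ) {x : T.V}
    (u : Place T.V → ZMod 2)
    (hu : ∀ q z q' i j, T.face x q z q' → Even i → Even j → i + 2 ≤ ℓ - 1 → j + 2 ≤ ℓ - 1 →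
      u (facePt ℓ x q z q' i (j + 1)) + u (facePt ℓ x q z q' (i + 2) (j + 1)) +
      u (facePt ℓ x q z q' (i + 1) j) + u (facePt ℓ x q z q' (i + 1) (j + 2)) = 0) :
    ∃ w : Place T.V → ZMod 2, ∀ q z q' i j, T.face x q z q' → Even i → Even j → i + 2 ≤ ℓ - 1 →
      j ≤ ℓ - 1 → w (facePt ℓ x q z q' i j) + w (facePt ℓ x q z q' (i + 2) j) =
        u (facePt ℓ x q z q' (i + 1) j) := by
  classical
  have h1 := fun q z q' (hF : T.face x q z q') =>
    exists_grid_potential (n := ℓ - 1) (fun i j => u (facePt ℓ x q z q' i j))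
      fun i j ei ej hi hj => hu q z q' i j hF ei ej hi hj
  choose w w0 wh wv using h1
  -- The potential on each square is normalised to vanish at `x`. Along a side through `x` it is
  -- then determined by `u`, so squares that share such a side induce the same values, and the
  -- potentials glue.
  let U : T.V → T.V → T.V → ℕ → ℕ → ZMod 2 := fun q z q' i j =>
    if h : T.face x q z q' then w q z q' h i j else 0
  have hU : ∀ q z q' i j (h : T.face x q z q'), U q z q' i j = w q z q' h i j :=
    fun q z q' i j h => dif_pos h
  have axis : ∀ q z q' r q'' i, T.face x q z q' → T.face x q r q'' → i ≤ ℓ - 1 → Even i →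
      U q z q' i 0 = U q r q'' i 0 := by
    intro q z q' r q'' i hF hG hi ei
    rw [hU _ _ _ _ _ hF, hU _ _ _ _ _ hG]
    refine eq_of_even_step (n := ℓ - 1) (fun i => u (edgePt ℓ x q i)) (fun i => w q z q' hF i 0)
      (fun i => w q r q'' hG i 0) ?_ ?_ ?_ ei hi
    · simp only [w0]
    · intro i ei hi
      simpa only [facePt_bot] using wh q z q' hF i 0 ei Even.zero hi (Nat.zero_le _)
    · intro i ei hi
      simpa only [facePt_bot] using wh q r q'' hG i 0 ei Even.zero hi (Nat.zero_le _)
  have glue := fun {q z q' p r p' : T.V} {i j k l : ℕ} =>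
    hT.glue (q := q) (z := z) (q' := q') (p := p) (w := r) (p' := p') (i := i) (j := j) (k := k)
      (l := l) (x := x) hℓ.2 U
      (by
        intro q z q' i j hF hi hj ei ej
        have hF' := T.face_symm _ _ _ _ hF
        have col : ∀ i, i ≤ ℓ - 1 → Even i → w q' z q hF' 0 i = w q z q' hF i 0 := by
          intro i hi ei
          refine eq_of_even_step (n := ℓ - 1) (fun i => u (edgePt ℓ x q i))
            (fun i => w q' z q hF' 0 i) (fun i => w q z q' hF i 0) ?_ ?_ ?_ ei hi
          · simp only [w0]
          · intro i ei hi
            simpa only [facePt_zero _ _ _ _ _ hℓ.2] using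
              wv q' z q hF' 0 i Even.zero ei (Nat.zero_le _) hi
          · intro i ei hi
            simpa only [facePt_bot] using wh q z q' hF i 0 ei Even.zero hi (Nat.zero_le _)
        rw [hU _ _ _ _ _ hF, hU _ _ _ _ _ hF']
        refine eq_of_even_step (n := ℓ - 1) (fun j => u (facePt ℓ x q z q' i j))
          (fun j => w q' z q hF' j i) (fun j => w q z q' hF i j) (col i hi ei) ?_ ?_ ej hj
        · intro j ej hj
          simpa only [facePt_swap _ _ _ _ _ _ hℓ.2] using wh q' z q hF' j i ej ei hj hi
        · intro j ej hj
          exact wv q z q' hF i j ei ej hi hj)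
      (fun q z q' r q'' i hF hG _ hi ei => axis q z q' r q'' i hF hG hi ei)
      (fun q z q' p r p' hF hG => by rw [hU _ _ _ _ _ hF, hU _ _ _ _ _ hG, w0, w0])
  let P : Place T.V → ZMod 2 → Prop := fun c y => ∃ q z q' i j, T.face x q z q' ∧ i ≤ ℓ - 1 ∧
    j ≤ ℓ - 1 ∧ Even i ∧ Even j ∧ c = facePt ℓ x q z q' i j ∧ y = U q z q' i j
  let W : Place T.V → ZMod 2 := fun c => if h : ∃ y, P c y then h.choose else 0
  have hW : ∀ q z q' i j, T.face x q z q' → i ≤ ℓ - 1 → j ≤ ℓ - 1 → Even i → Even j →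
      W (facePt ℓ x q z q' i j) = U q z q' i j := by
    intro q z q' i j hF hi hj ei ej
    have h : ∃ y, P (facePt ℓ x q z q' i j) y := ⟨_, q, z, q', i, j, hF, hi, hj, ei, ej, rfl, rfl⟩
    have h2 : W (facePt ℓ x q z q' i j) = h.choose := dif_pos h
    obtain ⟨p, r, p', k, l, hG, hk, hl, ek, el, e, hy⟩ := h.choose_spec
    rw [h2, hy]
    exact (glue hF hG hi hj hk hl ei ej ek el e).symm
  refine ⟨W, fun q z q' i j hF ei ej hi hj => ?_⟩
  rw [hW _ _ _ _ _ hF (by omega) hj ei ej, hW _ _ _ _ _ hF hi hj (ei.add even_two) ej,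
    hU _ _ _ _ _ hF, hU _ _ _ _ _ hF]
  exact wh q z q' hF i j ei ej hi hj

/-- A closed one-cochain on the double of the subdivided star of an `X`-check, given by its values `u₀`
and `u₂` on the edges of the two copies of the star and its values `u₁` on the edges that connect them,
is exact. -/
theorem IsRegular.exists_double_potential (hT : T.IsRegular) (hℓ : Odd ℓ ∧ 3 ≤ ℓ) {x : T.V}
    (hx : T.deg x = 0) (u₀ u₁ u₂ : Place T.V → ZMod 2)
    (hu : ∀ u, u = u₀ ∨ u = u₂ → ∀ q z q' i j, T.face x q z q' → Even i → Even j → i + 2 ≤ ℓ - 1 →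
      j + 2 ≤ ℓ - 1 →
      u (facePt ℓ x q z q' i (j + 1)) + u (facePt ℓ x q z q' (i + 2) (j + 1)) +
      u (facePt ℓ x q z q' (i + 1) j) + u (facePt ℓ x q z q' (i + 1) (j + 2)) = 0)
    (hb : ∀ q z q' j, T.face x q z q' → Even j → j + 2 ≤ ℓ - 1 →
      u₁ (edgePt ℓ q z j) + u₁ (edgePt ℓ q z (j + 2)) + u₀ (edgePt ℓ q z (j + 1)) +
      u₂ (edgePt ℓ q z (j + 1)) = 0) :
    ∃ w₀ w₂ : Place T.V → ZMod 2,
      (∀ q z q' i j, T.face x q z q' → Even i → Even j → i + 2 ≤ ℓ - 1 → j ≤ ℓ - 1 →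
        w₀ (facePt ℓ x q z q' i j) + w₀ (facePt ℓ x q z q' (i + 2) j) =
          u₀ (facePt ℓ x q z q' (i + 1) j) ∧
        w₂ (facePt ℓ x q z q' i j) + w₂ (facePt ℓ x q z q' (i + 2) j) =
          u₂ (facePt ℓ x q z q' (i + 1) j)) ∧
      ∀ q z q' j, T.face x q z q' → Even j → j ≤ ℓ - 1 →
        w₀ (edgePt ℓ q z j) + w₂ (edgePt ℓ q z j) = u₁ (edgePt ℓ q z j) := by
  obtain ⟨w₀, h₀⟩ := hT.exists_star_potential hℓ u₀ (hu u₀ (Or.inl rfl))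
  obtain ⟨w₂, h₂⟩ := hT.exists_star_potential hℓ u₂ (hu u₂ (Or.inr rfl))
  have hn : Even (ℓ - 1) := by
    obtain ⟨k, rfl⟩ := hℓ.1
    exact ⟨k, by omega⟩
  have side : ∀ (w u : Place T.V → ZMod 2), (∀ q z q' i j, T.face x q z q' → Even i → Even j →
      i + 2 ≤ ℓ - 1 → j ≤ ℓ - 1 → w (facePt ℓ x q z q' i j) + w (facePt ℓ x q z q' (i + 2) j) =
        u (facePt ℓ x q z q' (i + 1) j)) → ∀ q z q' j, T.face x q z q' → Even j → j + 2 ≤ ℓ - 1 →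
      w (edgePt ℓ q z j) + w (edgePt ℓ q z (j + 2)) = u (edgePt ℓ q z (j + 1)) := by
    intro w u h q z q' j hF ej hj
    have := h q' z q j (ℓ - 1) (T.face_symm _ _ _ _ hF) ej hn hj le_rfl
    simpa only [facePt_top _ _ _ _ _ hℓ.2] using this
  -- The defect of the two potentials on the vertical edges. Closedness on the vertical squares
  -- makes `m` constant along each boundary edge, and connectedness of `∂X_x` makes it one constant,
  -- which can be added to the potential of the upper layer without changing its increments.
  let m : Place T.V → ZMod 2 := fun p => u₁ p + w₀ p + w₂ p
  have hm : ∀ q z q' j, T.face x q z q' → Even j → j ≤ ℓ - 1 → m (edgePt ℓ q z j) = m (vert q) := by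
    intro q z q' j hF ej hj
    have := eq_zero_of_even_step (n := ℓ - 1) (fun j => m (edgePt ℓ q z j)) (fun j ej hj => by
      have h1 := side w₀ u₀ h₀ q z q' j hF ej hj
      have h2 := side w₂ u₂ h₂ q z q' j hF ej hj
      have h3 := hb q z q' j hF ej hj
      rw [← h1, ← h2] at h3
      refine (CharTwo.add_eq_zero.1 ?_).symm
      simp only [m]
      linear_combination h3) ej hj
    simpa only [edgePt_zero] using this
  obtain ⟨r, s, r', hG⟩ := hT.exists_face hx
  have hc : ∀ q, T.adj x q → m (vert q) = m (vert r) := by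
    intro q hq
    refine hT.eq_of_face hx (fun q => m (vert q)) (fun q z q' hF => ?_) hq (T.face_adj _ _ _ _ hG).1
    have h1 := hm q z q' _ hF hn le_rfl
    have h2 := hm q' z q _ (T.face_symm _ _ _ _ hF) hn le_rfl
    rw [edgePt_last hℓ.2] at h1 h2
    exact h1.symm.trans h2
  refine ⟨w₀, fun p => w₂ p + m (vert r), fun q z q' i j hF ei ej hi hj =>
    ⟨h₀ q z q' i j hF ei ej hi hj, ?_⟩, fun q z q' j hF ej hj => ?_⟩
  · rw [← h₂ q z q' i j hF ei ej hi hj]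
    have := CharTwo.add_self_eq_zero (m (vert r))
    linear_combination this
  · have h1 := (hm q z q' j hF ej hj).trans (hc q (T.face_adj _ _ _ _ hF).1)
    rw [← h1]
    simp only [m]
    have h2 := CharTwo.add_self_eq_zero (w₀ (edgePt ℓ q z j))
    have h3 := CharTwo.add_self_eq_zero (w₂ (edgePt ℓ q z j))
    linear_combination h2 + h3

end StarPotential

end TannerComplex

/-! ### Cohomology of the local complexes in degrees 0 and 1 -/

theorem relMap_apply_of_list {α β : Type} [Finite α] (r : α → β → Prop) (φ : α → ZMod 2) (b : β)
    (l : List α) (hl : l.Nodup) (h : ∀ a, r a b ↔ a ∈ l) : relMap r φ b = (l.map φ).sum := by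
  classical
  let _ := Fintype.ofFinite α
  rw [relMap_apply, ← Finset.sum_filter, ← List.sum_toFinset _ hl]
  refine Finset.sum_congr ?_ fun _ _ => rfl
  ext a
  simp [h]

namespace TannerComplex

open Place

variable {T : TannerComplex} {ℓ : ℕ}

/-- An edge of a subdivided star has two ends. -/
theorem InStar.exists_ends (hℓ : Odd ℓ ∧ 3 ≤ ℓ) {v : T.V} {c : Place T.V} (h : T.InStar ℓ v c)
    (hc : c.dim = 1) : ∃ p p', p ≠ p' ∧ ∀ r, T.Inc ℓ r c ↔ r = p ∨ r = p' := by
  have hn : (ℓ - 1) % 2 = 0 := by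
    obtain ⟨k, rfl⟩ := hℓ.1
    omega
  have main : ∀ {x q z q' k l}, T.face x q z q' → k ≤ ℓ - 1 → l ≤ ℓ - 1 → k % 2 = 1 → l % 2 = 0 →
      ∃ p p', p ≠ p' ∧ ∀ r, T.Inc ℓ r (facePt ℓ x q z q' k l) ↔ r = p ∨ r = p' := by
    intro x q z q' k l hF hk hl ek el
    refine ⟨facePt ℓ x q z q' (k - 1) l, facePt ℓ x q z q' (k + 1) l, fun e => ?_, fun r => ⟨?_, ?_⟩⟩
    · have := (facePt_inj hF hℓ.2 e).1
      omega
    · intro hr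
      rcases inc_facePt hℓ hk hl hr with ⟨i, hi, -, hik, rfl⟩ | ⟨j, -, hj, hjl, rfl⟩
      · rcases hik with rfl | rfl
        · exact Or.inl rfl
        · exact Or.inr rfl
      · rw [Nat.even_iff] at hj
        omega
    · rintro (rfl | rfl)
      · exact inc_facePt_left hℓ.2 hF (by omega) hk hl (by rw [Nat.even_iff]; omega) (by omega)
      · exact inc_facePt_left hℓ.2 hF (by omega) hk hl (by rw [Nat.even_iff]; omega) (by omega)
  rcases h with ⟨q, z, q', k, l, hF, hk, hl, rfl⟩ | ⟨-, z, j, hz, hj, rfl⟩ | ⟨-, rfl⟩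
  · rw [dim_facePt hℓ.1] at hc
    have h2 : k % 2 = 1 ∧ l % 2 = 0 ∨ l % 2 = 1 ∧ k % 2 = 0 := by omega
    rcases h2 with ⟨h2, h3⟩ | ⟨h2, h3⟩
    · exact main hF hk hl h2 h3
    · rw [← facePt_swap _ _ _ _ _ _ hℓ.2]
      exact main (T.face_symm _ _ _ _ hF) hl hk h2 h3
  · rw [dim_edgePt hℓ.1] at hc
    refine ⟨edgePt ℓ v z (j - 1), edgePt ℓ v z (j + 1), fun e => ?_, fun r => ⟨?_, ?_⟩⟩
    · have := (edgePt_eq_left (adj_ne hz) (adj_ne hz) e).1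
      omega
    · intro hr
      obtain ⟨-, -, -, i, -, -, hi | hi, rfl⟩ := inc_edgePt hℓ hr
      · rw [hi]
        exact Or.inl rfl
      · rw [hi]
        exact Or.inr rfl
    · rintro (rfl | rfl)
      · exact inc_edgePt_of hz (by omega) hj (by rw [Nat.even_iff]; omega) (by omega)
      · exact inc_edgePt_of hz (by omega) hj (by rw [Nat.even_iff]; omega) (by omega)
  · simp [dim] at hc

namespace LocalCell

theorem layer_eq {L : Fin 3} (h : L ≠ 1) : L = 0 ∨ L = 2 := by
  revert L
  decide

/-- A one-cell of a local complex has two ends. -/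
theorem exists_ends (hℓ : Odd ℓ ∧ 3 ≤ ℓ) (b : T.LocalCell ℓ) (hb : b.deg = T.deg b.own + 1) :
    ∃ a a' : T.LocalCell ℓ, a ≠ a' ∧ a.own = b.own ∧ a'.own = b.own ∧
      ∀ d : T.LocalCell ℓ, (d.adj b ∧ d.own = b.own) ↔ d = a ∨ d = a' := by
  unfold deg at hb
  by_cases hl : b.layer = 1
  · rw [if_pos hl] at hb
    refine ⟨⟨b.own, b.pos, 0, b.mem_star, fun h => absurd h (by decide)⟩,
      ⟨b.own, b.pos, 2, b.mem_star, fun h => absurd h (by decide)⟩, ?_, rfl, rfl, fun d => ⟨?_, ?_⟩⟩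
    · intro e
      exact absurd (congrArg layer e) (show (0 : Fin 3) ≠ 2 by decide)
    · rintro ⟨h1, h2⟩
      rcases adj_local h2 h1 with ⟨h3, -⟩ | ⟨h3, h4, -⟩
      · have := inc_dim hℓ.1 h3
        omega
      · rcases layer_eq h4 with h5 | h5
        · exact Or.inl (LocalCell.ext' h2 h3 h5)
        · exact Or.inr (LocalCell.ext' h2 h3 h5)
    · rintro (rfl | rfl)
      · exact ⟨adj_of_layer rfl rfl (show (0 : Fin 3) ≠ 1 by decide) hl, rfl⟩
      · exact ⟨adj_of_layer rfl rfl (show (2 : Fin 3) ≠ 1 by decide) hl, rfl⟩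
  · rw [if_neg hl] at hb
    obtain ⟨p, p', hne, hp⟩ := b.mem_star.exists_ends hℓ (by omega)
    have h1 := (hp p).2 (Or.inl rfl)
    have h2 := (hp p').2 (Or.inr rfl)
    refine ⟨⟨b.own, p, b.layer, b.mem_star.of_inc hℓ h1, fun h => absurd h hl⟩,
      ⟨b.own, p', b.layer, b.mem_star.of_inc hℓ h2, fun h => absurd h hl⟩,
      fun e => hne (congrArg pos e), rfl, rfl, fun d => ⟨?_, ?_⟩⟩
    · rintro ⟨h3, h4⟩
      rcases adj_local h4 h3 with ⟨h5, h6⟩ | ⟨-, -, h5⟩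
      · rcases (hp _).1 h5 with h7 | h7
        · exact Or.inl (LocalCell.ext' h4 h7 h6)
        · exact Or.inr (LocalCell.ext' h4 h7 h6)
      · exact absurd h5 hl
    · rintro (rfl | rfl)
      · exact ⟨adj_of_inc rfl h1 rfl, rfl⟩
      · exact ⟨adj_of_inc rfl h2 rfl, rfl⟩

/-- The local complexes of `X`-checks and qubits are connected. -/
theorem eq_of_ends (hT : T.IsRegular) (hℓ : Odd ℓ ∧ 3 ≤ ℓ) {v : T.V} (hv : T.deg v ≤ 1) {α : Type}
    (f : T.LocalCell ℓ → α)
    (hf : ∀ a a' b : T.LocalCell ℓ, a.own = v → a'.own = v → b.own = v → b.deg = T.deg v + 1 →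
      a.adj b → a'.adj b → f a = f a')
    {c c' : T.LocalCell ℓ} (hc : c.own = v) (hc' : c'.own = v) (dc : c.deg = T.deg v)
    (dc' : c'.deg = T.deg v) : f c = f c' := by
  classical
  have hn : Even (ℓ - 1) := by
    obtain ⟨k, rfl⟩ := hℓ.1
    exact ⟨k, by omega⟩
  let k : Fin 3 → Place T.V → Option α := fun L p =>
    if h : T.InStar ℓ v p ∧ L ≠ 1 then some (f ⟨v, p, L, h.1, fun h' => absurd h' h.2⟩) else none
  have hk : ∀ L p (h : T.InStar ℓ v p) (hL : L ≠ 1),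
      k L p = some (f ⟨v, p, L, h, fun h' => absurd h' hL⟩) := fun L p h hL => dif_pos ⟨h, hL⟩
  have hinc : ∀ L p p' e, L ≠ 1 → T.InStar ℓ v e → e.dim = 1 → T.Inc ℓ p e → T.Inc ℓ p' e →
      k L p = k L p' := by
    intro L p p' e hL he hd h1 h2
    rw [hk L p (he.of_inc hℓ h1) hL, hk L p' (he.of_inc hℓ h2) hL]
    refine congrArg some (hf _ _ ⟨v, e, L, he, fun h' => absurd h' hL⟩ rfl rfl rfl ?_
      (adj_of_inc rfl h1 rfl) (adj_of_inc rfl h2 rfl))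
    unfold deg
    rw [if_neg hL, hd]
  have hlay : ∀ p, T.InBdry ℓ v p → p.dim = 0 → k 0 p = k 2 p := by
    intro p hp hd
    have hs := hp.inStar hℓ
    rw [hk 0 p hs (by decide), hk 2 p hs (by decide)]
    refine congrArg some (hf _ _ ⟨v, p, 1, hs, fun _ => hp⟩ rfl rfl rfl ?_
      (adj_of_layer rfl rfl (show (0 : Fin 3) ≠ 1 by decide) rfl)
      (adj_of_layer rfl rfl (show (2 : Fin 3) ≠ 1 by decide) rfl))
    simp [deg, hd]
  -- Each layer is joined to its centre along grid lines, and the layers are joined by the vertical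
  -- edge over one boundary vertex. A Z-check has empty boundary, and its two points are not joined;
  -- hence the bound on the degree of `v`.
  have hub : (∀ L p, L ≠ 1 → T.InStar ℓ v p → p.dim = 0 → k L p = k L (vert v)) ∧
      k 0 (vert v) = k 2 (vert v) := by
    have hv' : T.deg v = 0 ∨ T.deg v = 1 := by omega
    rcases hv' with h0 | h1
    · have grid : ∀ L q z q' i j, L ≠ 1 → T.face v q z q' → i ≤ ℓ - 1 → j ≤ ℓ - 1 → Even i → Even j →
          k L (facePt ℓ v q z q' i j) = k L (vert v) := by
        have row : ∀ L q z q' i j, L ≠ 1 → T.face v q z q' → i ≤ ℓ - 1 → j ≤ ℓ - 1 → Even i → Even j →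
            k L (facePt ℓ v q z q' i j) = k L (facePt ℓ v q z q' 0 j) := by
          intro L q z q' i j hL hF hi hj ei ej
          refine eq_zero_of_even_step (n := ℓ - 1) (fun i => k L (facePt ℓ v q z q' i j))
            (fun i ei hi => ?_) ei hi
          refine hinc L _ _ (facePt ℓ v q z q' (i + 1) j) hL (inStar_facePt hF (by omega) hj) ?_
            (inc_facePt_left hℓ.2 hF hi (by omega) hj (ei.add even_two) (Or.inr rfl))
            (inc_facePt_left hℓ.2 hF (by omega) (by omega) hj ei (Or.inl rfl))
          rw [dim_facePt hℓ.1]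
          rw [Nat.even_iff] at ei ej
          omega
        intro L q z q' i j hL hF hi hj ei ej
        rw [row L q z q' i j hL hF hi hj ei ej, ← facePt_swap _ _ _ _ _ _ hℓ.2,
          row L q' z q j 0 hL (T.face_symm _ _ _ _ hF) hj (Nat.zero_le _) ej Even.zero,
          facePt_bot, edgePt_zero]
      refine ⟨fun L p hL hp hd => ?_, ?_⟩
      · obtain ⟨q, z, q', i, j, hF, hi, hj, rfl⟩ := hp.exists_facePt h0
        rw [dim_facePt hℓ.1] at hd
        exact grid L q z q' i j hL hF hi hj (by rw [Nat.even_iff]; omega) (by rw [Nat.even_iff]; omega)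
      · obtain ⟨q, z, q', hF⟩ := hT.exists_face h0
        have h2 := fun L hL => grid L q z q' (ℓ - 1) 0 hL hF le_rfl (Nat.zero_le _) hn Even.zero
        simp only [facePt_bot, edgePt_last hℓ.2] at h2
        rw [← h2 0 (by decide), ← h2 2 (by decide)]
        exact hlay _ (Or.inl ⟨q, z, q', 0, hF, Nat.zero_le _, (edgePt_zero _ _ _).symm⟩) rfl
    · have line : ∀ L z j, L ≠ 1 → T.adj v z → j ≤ ℓ - 1 → Even j →
          k L (edgePt ℓ v z j) = k L (vert v) := by
        intro L z j hL hz hj ej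
        rw [← edgePt_zero ℓ v z]
        refine eq_zero_of_even_step (n := ℓ - 1) (fun j => k L (edgePt ℓ v z j))
          (fun j ej hj => ?_) ej hj
        refine hinc L _ _ (edgePt ℓ v z (j + 1)) hL
          (Or.inr (Or.inl ⟨h1, z, j + 1, hz, by omega, rfl⟩)) ?_
          (inc_edgePt_of hz hj (by omega) (ej.add even_two) (Or.inr rfl))
          (inc_edgePt_of hz (by omega) (by omega) ej (Or.inl rfl))
        rw [dim_edgePt hℓ.1]
        rw [Nat.even_iff] at ej
        omega
      refine ⟨fun L p hL hp hd => ?_, ?_⟩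
      · obtain ⟨z, j, hz, hj, rfl⟩ := hp.exists_edgePt h1
        rw [dim_edgePt hℓ.1] at hd
        exact line L z j hL hz hj (by rw [Nat.even_iff]; omega)
      · obtain ⟨z, hz⟩ := (hT.qubit_checked v h1).2
        have h2 := fun L hL => line L z (ℓ - 1) hL hz le_rfl hn
        simp only [edgePt_last hℓ.2] at h2
        rw [← h2 0 (by decide), ← h2 2 (by decide)]
        exact hlay _ (Or.inr ⟨h1, z, hz, rfl⟩) rfl
  have main : ∀ c : T.LocalCell ℓ, c.own = v → c.deg = T.deg v → some (f c) = k 0 (vert v) := by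
    rintro c rfl dc
    unfold deg at dc
    have hL : c.layer ≠ 1 := fun h => by rw [if_pos h] at dc; omega
    rw [if_neg hL] at dc
    have h1 := hub.1 c.layer c.pos hL c.mem_star (by omega)
    rw [hk _ _ c.mem_star hL] at h1
    refine h1.trans ?_
    rcases layer_eq hL with h | h
    · rw [h]
    · rw [h, hub.2]
  exact Option.some_injective _ ((main c hc dc).trans (main c' hc' dc').symm)

end LocalCell

/-- The local coboundary at a one-cell of a local complex is the sum over its two ends. -/
theorem exists_δloc_ends (hℓ : Odd ℓ ∧ 3 ≤ ℓ) {n : ℕ} (b : (T.replaceX ℓ hℓ).tot.Cells (n + 1))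
    (hb : T.deg ((T.replaceX ℓ hℓ).own b.1) = n) :
    ∃ a a' : (T.replaceX ℓ hℓ).tot.Cells n, a ≠ a' ∧
      (∀ d : (T.replaceX ℓ hℓ).tot.Cells n, ((T.replaceX ℓ hℓ).tot.adj d.1 b.1 ∧
        (T.replaceX ℓ hℓ).own d.1 = (T.replaceX ℓ hℓ).own b.1) ↔ d = a ∨ d = a') ∧
      ∀ φ, (T.replaceX ℓ hℓ).δloc n (n + 1) φ b = φ a + φ a' := by
  obtain ⟨b, hbn⟩ := b
  obtain ⟨a, a', hne, o1, o2, hd⟩ := LocalCell.exists_ends hℓ b (hbn.trans (congrArg (· + 1) hb.symm))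
  have h1 := ((hd a).2 (Or.inl rfl)).1
  have h2 := ((hd a').2 (Or.inr rfl)).1
  have e1 := LocalCell.adj_deg hℓ h1
  have e2 := LocalCell.adj_deg hℓ h2
  have hbn' : LocalCell.deg b = n + 1 := hbn
  let A : (T.replaceX ℓ hℓ).tot.Cells n := ⟨a, show LocalCell.deg a = n by omega⟩
  let A' : (T.replaceX ℓ hℓ).tot.Cells n := ⟨a', show LocalCell.deg a' = n by omega⟩
  have key : ∀ d : (T.replaceX ℓ hℓ).tot.Cells n, ((T.replaceX ℓ hℓ).tot.adj d.1 b ∧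
      (T.replaceX ℓ hℓ).own d.1 = (T.replaceX ℓ hℓ).own b) ↔ d = A ∨ d = A' := by
    intro d
    refine (hd d.1).trans ?_
    rw [Subtype.ext_iff, Subtype.ext_iff]
    exact Iff.rfl
  have hAA : A ≠ A' := fun e => hne (congrArg Subtype.val e)
  refine ⟨A, A', hAA, key, fun φ => ?_⟩
  rw [CodeEmbedding.δloc, relMap_apply_of_list _ φ _ [A, A'] (by simpa using hAA)
    (fun d => (key d).trans (by simp))]
  simp

/-- The local complexes of `X`-checks have no cohomology in degree one. -/
theorem IsRegular.exists_δloc_eq (hT : T.IsRegular) (hℓ : Odd ℓ ∧ 3 ≤ ℓ)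
    (φ : (T.replaceX ℓ hℓ).tot.Cochain 1)
    (hφ : ∀ c : (T.replaceX ℓ hℓ).tot.Cells 2, T.deg ((T.replaceX ℓ hℓ).own c.1) = 0 →
      (T.replaceX ℓ hℓ).δloc 1 2 φ c = 0) :
    ∃ ψ : (T.replaceX ℓ hℓ).tot.Cochain 0, ∀ b : (T.replaceX ℓ hℓ).tot.Cells 1,
      T.deg ((T.replaceX ℓ hℓ).own b.1) = 0 → (T.replaceX ℓ hℓ).δloc 0 1 ψ b = φ b := by
  classical
  -- The cochain as a function of owner, layer and place, extended by zero, so that the potentials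
  -- can be applied without proofs of membership.
  let u : T.V → Fin 3 → Place T.V → ZMod 2 := fun x L p =>
    if h : ∃ (h1 : T.InStar ℓ x p) (h2 : L = 1 → T.InBdry ℓ x p),
      LocalCell.deg (⟨x, p, L, h1, h2⟩ : T.LocalCell ℓ) = 1 then
      φ ⟨⟨x, p, L, h.choose, h.choose_spec.choose⟩, h.choose_spec.choose_spec⟩ else 0
  have hu : ∀ b : (T.replaceX ℓ hℓ).tot.Cells 1, φ b = u b.1.own b.1.layer b.1.pos := by
    rintro ⟨b, hb⟩
    have h : ∃ (h1 : T.InStar ℓ b.own b.pos) (h2 : b.layer = 1 → T.InBdry ℓ b.own b.pos),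
      LocalCell.deg (⟨b.own, b.pos, b.layer, h1, h2⟩ : T.LocalCell ℓ) = 1 :=
      ⟨b.mem_star, b.mem_bdry, hb⟩
    have e : u b.own b.layer b.pos = φ ⟨⟨b.own, b.pos, b.layer, h.choose, h.choose_spec.choose⟩,
      h.choose_spec.choose_spec⟩ := dif_pos h
    exact e.symm
  -- The cocycle condition on a small square in one of the two layers, written as a sum over its
  -- four sides.
  have sq : ∀ x L, T.deg x = 0 → L ≠ 1 → ∀ q z q' i j, T.face x q z q' → Even i → Even j →
      i + 2 ≤ ℓ - 1 → j + 2 ≤ ℓ - 1 →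
      u x L (facePt ℓ x q z q' i (j + 1)) + u x L (facePt ℓ x q z q' (i + 2) (j + 1)) +
      u x L (facePt ℓ x q z q' (i + 1) j) + u x L (facePt ℓ x q z q' (i + 1) (j + 2)) = 0 := by
    intro x L hx hL q z q' i j hF ei ej hi hj
    rw [Nat.even_iff] at ei ej
    let mk : ∀ k l, k ≤ ℓ - 1 → l ≤ ℓ - 1 → T.LocalCell ℓ := fun k l hk hl =>
      ⟨x, facePt ℓ x q z q' k l, L, inStar_facePt hF hk hl, fun h => absurd h hL⟩
    have hdeg : ∀ k l hk hl, (mk k l hk hl).deg = k % 2 + l % 2 := by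
      intro k l hk hl
      simp only [LocalCell.deg, mk, if_neg hL, hx, dim_facePt hℓ.1]
      omega
    let m1 : ∀ k l, k ≤ ℓ - 1 → l ≤ ℓ - 1 → k % 2 + l % 2 = 1 → (T.replaceX ℓ hℓ).tot.Cells 1 :=
      fun k l hk hl h => ⟨mk k l hk hl, (hdeg k l hk hl).trans h⟩
    have hpos : ∀ k l hk hl h, LocalCell.pos (m1 k l hk hl h).1 = facePt ℓ x q z q' k l :=
      fun _ _ _ _ _ => rfl
    have := hφ ⟨mk (i + 1) (j + 1) (by omega) (by omega), (hdeg (i + 1) (j + 1) (by omega) (by omega)).trans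
      (by omega)⟩ hx
    rw [CodeEmbedding.δloc, relMap_apply_of_list _ φ _
      [m1 i (j + 1) (by omega) (by omega) (by omega), m1 (i + 2) (j + 1) (by omega) (by omega) (by omega),
       m1 (i + 1) j (by omega) (by omega) (by omega), m1 (i + 1) (j + 2) (by omega) (by omega) (by omega)]
      ?_ ?_] at this
    · simp only [List.map_cons, List.map_nil, List.sum_cons, List.sum_nil, hu] at this
      rw [← this]
      simp only [m1, mk]
      ring
    · simp only [List.nodup_cons, List.mem_cons, List.not_mem_nil, or_false, not_or, not_false_eq_true,
        List.nodup_nil, and_true]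
      refine ⟨⟨?_, ?_, ?_⟩, ⟨?_, ?_⟩, ?_⟩ <;>
      · intro e
        have e' := congrArg (fun b => LocalCell.pos b.1) e
        simp only [hpos] at e'
        have := facePt_inj hF hℓ.2 e'
        omega
    · intro d
      simp only [List.mem_cons, List.not_mem_nil, or_false]
      constructor
      · rintro ⟨h1, h2⟩
        have ext : ∀ k l hk hl h, d.1.pos = facePt ℓ x q z q' k l → d.1.layer = L →
            d = m1 k l hk hl h := fun k l hk hl h e e' => Subtype.ext (LocalCell.ext' h2 e e')
        rcases LocalCell.adj_local h2 h1 with ⟨h3, h4⟩ | ⟨-, -, h4⟩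
        · have h3 : T.Inc ℓ d.1.pos (facePt ℓ x q z q' (i + 1) (j + 1)) := h3
          rcases inc_facePt hℓ (by omega) (by omega) h3 with ⟨k, -, -, hk, hp⟩ | ⟨l, -, -, hl, hp⟩
          · rcases hk with hk | rfl
            · obtain rfl : k = i := by omega
              exact Or.inl (ext _ _ (by omega) (by omega) (by omega) hp h4)
            · exact Or.inr (Or.inl (ext _ _ (by omega) (by omega) (by omega) hp h4))
          · rcases hl with hl | rfl
            · obtain rfl : l = j := by omega
              exact Or.inr (Or.inr (Or.inl (ext _ _ (by omega) (by omega) (by omega) hp h4)))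
            · exact Or.inr (Or.inr (Or.inr (ext _ _ (by omega) (by omega) (by omega) hp h4)))
        · exact absurd h4 hL
      · have left : ∀ k hk, Even k → (i + 1 = k + 1 ∨ k = i + 1 + 1) → ∀ h,
            (m1 k (j + 1) hk (by omega) h).1.adj (mk (i + 1) (j + 1) (by omega) (by omega)) :=
          fun k hk ek hki _ => LocalCell.adj_of_inc rfl (show T.Inc ℓ (facePt ℓ x q z q' k (j + 1))
            (facePt ℓ x q z q' (i + 1) (j + 1)) from
            inc_facePt_left hℓ.2 hF hk (by omega) (by omega) ek hki) rfl
        have right : ∀ l hl, Even l → (j + 1 = l + 1 ∨ l = j + 1 + 1) → ∀ h,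
            (m1 (i + 1) l (by omega) hl h).1.adj (mk (i + 1) (j + 1) (by omega) (by omega)) :=
          fun l hl el hlj _ => LocalCell.adj_of_inc rfl (show T.Inc ℓ (facePt ℓ x q z q' (i + 1) l)
            (facePt ℓ x q z q' (i + 1) (j + 1)) from
            inc_facePt_right hℓ.2 hF (by omega) hl (by omega) el hlj) rfl
        have ei := Nat.even_iff.2 ei
        have ej := Nat.even_iff.2 ej
        rintro (rfl | rfl | rfl | rfl)
        · exact ⟨left i (by omega) ei (Or.inl rfl) (by omega), rfl⟩
        · exact ⟨left (i + 2) (by omega) (ei.add even_two) (Or.inr rfl) (by omega), rfl⟩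
        · exact ⟨right j (by omega) ej (Or.inl rfl) (by omega), rfl⟩
        · exact ⟨right (j + 2) (by omega) (ej.add even_two) (Or.inr rfl) (by omega), rfl⟩
  -- The cocycle condition on the vertical square over a small boundary edge: two vertical sides and
  -- the two copies of the edge.
  have bd : ∀ x, T.deg x = 0 → ∀ q z q' j, T.face x q z q' → Even j → j + 2 ≤ ℓ - 1 →
      u x 1 (edgePt ℓ q z j) + u x 1 (edgePt ℓ q z (j + 2)) + u x 0 (edgePt ℓ q z (j + 1)) +
      u x 2 (edgePt ℓ q z (j + 1)) = 0 := by
    intro x hx q z q' j hF ej hj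
    rw [Nat.even_iff] at ej
    have hqz := (T.face_adj _ _ _ _ hF).2.1
    have bdry : ∀ k, k ≤ ℓ - 1 → T.InBdry ℓ x (edgePt ℓ q z k) := fun k hk =>
      Or.inl ⟨q, z, q', k, hF, hk, rfl⟩
    let mk : ∀ (k : ℕ) (L : Fin 3), k ≤ ℓ - 1 → T.LocalCell ℓ := fun k L hk =>
      ⟨x, edgePt ℓ q z k, L, (bdry k hk).inStar hℓ, fun _ => bdry k hk⟩
    have hdeg : ∀ k L hk, (mk k L hk).deg = k % 2 + if L = 1 then 1 else 0 := by
      intro k L hk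
      simp only [LocalCell.deg, mk, hx, dim_edgePt hℓ.1]
      omega
    let m1 : ∀ (k : ℕ) (L : Fin 3), k ≤ ℓ - 1 → (k % 2 + if L = 1 then 1 else 0) = 1 →
        (T.replaceX ℓ hℓ).tot.Cells 1 := fun k L hk h => ⟨mk k L hk, (hdeg k L hk).trans h⟩
    have hpos : ∀ k L hk h, LocalCell.pos (m1 k L hk h).1 = edgePt ℓ q z k := fun _ _ _ _ => rfl
    have hlayer : ∀ k L hk h, LocalCell.layer (m1 k L hk h).1 = L := fun _ _ _ _ => rfl
    have := hφ ⟨mk (j + 1) 1 (by omega), (hdeg (j + 1) 1 (by omega)).trans (by simp; omega)⟩ hx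
    rw [CodeEmbedding.δloc, relMap_apply_of_list _ φ _
      [m1 j 1 (by omega) (by simp; omega), m1 (j + 2) 1 (by omega) (by simp; omega),
       m1 (j + 1) 0 (by omega) (by simp; omega), m1 (j + 1) 2 (by omega) (by simp; omega)]
      ?_ ?_] at this
    · simp only [List.map_cons, List.map_nil, List.sum_cons, List.sum_nil, hu] at this
      rw [← this]
      simp only [m1, mk]
      ring
    · simp only [List.nodup_cons, List.mem_cons, List.not_mem_nil, or_false, not_or, not_false_eq_true,
        List.nodup_nil, and_true]
      refine ⟨⟨?_, ?_, ?_⟩, ⟨?_, ?_⟩, ?_⟩ <;>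
      · intro e
        have h1 := congrArg (fun b => LocalCell.pos b.1) e
        have h2 := congrArg (fun b => LocalCell.layer b.1) e
        simp only [hpos] at h1
        simp only [hlayer] at h2
        first
          | exact absurd h2 (by decide)
          | (have h3 := (edgePt_eq_left (adj_ne hqz) (adj_ne hqz) h1).1
             omega)
    · intro d
      simp only [List.mem_cons, List.not_mem_nil, or_false]
      constructor
      · rintro ⟨h1, h2⟩
        have ext : ∀ k L hk h, d.1.pos = edgePt ℓ q z k → d.1.layer = L → d = m1 k L hk h :=
          fun k L hk h e e' => Subtype.ext (LocalCell.ext' h2 e e')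
        rcases LocalCell.adj_local h2 h1 with ⟨h3, h4⟩ | ⟨h3, h4, -⟩
        · have h3 : T.Inc ℓ d.1.pos (edgePt ℓ q z (j + 1)) := h3
          obtain ⟨-, -, -, i, -, -, hi | rfl, hp⟩ := inc_edgePt hℓ h3
          · obtain rfl : i = j := by omega
            exact Or.inl (ext _ _ (by omega) (by simp; omega) hp h4)
          · exact Or.inr (Or.inl (ext _ _ (by omega) (by simp; omega) hp h4))
        · rcases LocalCell.layer_eq h4 with h4 | h4
          · exact Or.inr (Or.inr (Or.inl (ext _ _ (by omega) (by simp; omega) h3 h4)))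
          · exact Or.inr (Or.inr (Or.inr (ext _ _ (by omega) (by simp; omega) h3 h4)))
      · have side : ∀ k hk, Even k → (j + 1 = k + 1 ∨ k = j + 1 + 1) → ∀ h,
            (m1 k 1 hk h).1.adj (mk (j + 1) 1 (by omega)) :=
          fun k hk ek hkj _ => LocalCell.adj_of_inc rfl
            (show T.Inc ℓ (edgePt ℓ q z k) (edgePt ℓ q z (j + 1)) from
            inc_edgePt_of hqz hk (by omega) ek hkj) rfl
        have ej := Nat.even_iff.2 ej
        rintro (rfl | rfl | rfl | rfl)
        · exact ⟨side j (by omega) ej (Or.inl rfl) (by simp; omega), rfl⟩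
        · exact ⟨side (j + 2) (by omega) (ej.add even_two) (Or.inr rfl) (by simp; omega), rfl⟩
        · exact ⟨LocalCell.adj_of_layer rfl rfl (show (0 : Fin 3) ≠ 1 by decide) rfl, rfl⟩
        · exact ⟨LocalCell.adj_of_layer rfl rfl (show (2 : Fin 3) ≠ 1 by decide) rfl, rfl⟩
  have main : ∀ x : T.V, ∃ w : Fin 3 → Place T.V → ZMod 2, T.deg x = 0 →
      (∀ L q z q' i j, L ≠ 1 → T.face x q z q' → Even i → Even j → i + 2 ≤ ℓ - 1 → j ≤ ℓ - 1 →
        w L (facePt ℓ x q z q' i j) + w L (facePt ℓ x q z q' (i + 2) j) =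
          u x L (facePt ℓ x q z q' (i + 1) j)) ∧
      ∀ q z q' j, T.face x q z q' → Even j → j ≤ ℓ - 1 →
        w 0 (edgePt ℓ q z j) + w 2 (edgePt ℓ q z j) = u x 1 (edgePt ℓ q z j) := by
    intro x
    by_cases hx : T.deg x = 0
    · obtain ⟨w₀, w₂, h1, h2⟩ := hT.exists_double_potential hℓ hx (u x 0) (u x 1) (u x 2)
        (by
          rintro _ (rfl | rfl)
          · exact sq x 0 hx (by decide)
          · exact sq x 2 hx (by decide)) (bd x hx)
      refine ⟨fun L => if L = 0 then w₀ else w₂, fun _ => ⟨?_, h2⟩⟩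
      intro L q z q' i j hL hF ei ej hi hj
      rcases LocalCell.layer_eq hL with rfl | rfl
      · exact (h1 q z q' i j hF ei ej hi hj).1
      · exact (h1 q z q' i j hF ei ej hi hj).2
    · exact ⟨0, fun h => absurd h hx⟩
  choose w hw using main
  refine ⟨fun a => w a.1.own a.1.layer a.1.pos, fun b hb => ?_⟩
  obtain ⟨a, a', hne, hd, hψ⟩ := exists_δloc_ends hℓ b hb
  rw [hψ, hu]
  obtain ⟨⟨x, p, L, hs, hbd⟩, hbn⟩ := b
  have hb : T.deg x = 0 := hb
  obtain ⟨h1, h2⟩ := hw x hb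
  obtain ⟨k1, (o1 : a.1.own = x)⟩ := (hd a).2 (Or.inl rfl)
  obtain ⟨k2, (o2 : a'.1.own = x)⟩ := (hd a').2 (Or.inr rfl)
  have l1 := LocalCell.adj_local o1 k1
  have l2 := LocalCell.adj_local o2 k2
  have hne' : ¬ (a.1.pos = a'.1.pos ∧ a.1.layer = a'.1.layer) := fun e =>
    hne (Subtype.ext (LocalCell.ext' (o1.trans o2.symm) e.1 e.2))
  simp only [o1, o2]
  have hdeg : T.deg x + p.dim + (if L = 1 then 1 else 0) = 1 := hbn
  by_cases hL : L = 1
  · subst hL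
    rw [if_pos rfl] at hdeg
    have vert : ∀ a : T.LocalCell ℓ, (T.Inc ℓ a.pos p ∧ a.layer = 1) ∨
        (a.pos = p ∧ a.layer ≠ 1 ∧ (1 : Fin 3) = 1) → a.pos = p ∧ a.layer ≠ 1 := by
      rintro a (⟨h, -⟩ | ⟨h, h', -⟩)
      · have := inc_dim hℓ.1 h
        omega
      · exact ⟨h, h'⟩
    obtain ⟨p1, L1⟩ := vert _ l1
    obtain ⟨p2, L2⟩ := vert _ l2
    rw [p1, p2] at hne' ⊢
    obtain ⟨q, z, q', j, hF, hj, rfl⟩ := (hbd rfl).exists_edgePt hb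
    rw [dim_edgePt hℓ.1] at hdeg
    have h3 := h2 q z q' j hF (by rw [Nat.even_iff]; omega) hj
    rcases LocalCell.layer_eq L1 with L1 | L1 <;> rcases LocalCell.layer_eq L2 with L2 | L2
    · exact absurd ⟨rfl, L1.trans L2.symm⟩ hne'
    · rw [L1, L2]
      exact h3
    · rw [L1, L2, add_comm]
      exact h3
    · exact absurd ⟨rfl, L1.trans L2.symm⟩ hne'
  · rw [if_neg hL] at hdeg
    have hor : ∀ a : T.LocalCell ℓ, (T.Inc ℓ a.pos p ∧ a.layer = L) ∨
        (a.pos = p ∧ a.layer ≠ 1 ∧ L = 1) → T.Inc ℓ a.pos p ∧ a.layer = L := by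
      rintro a (h | ⟨-, -, h⟩)
      · exact h
      · exact absurd h hL
    obtain ⟨p1, L1⟩ := hor _ l1
    obtain ⟨p2, L2⟩ := hor _ l2
    rw [L1, L2] at hne' ⊢
    -- Exchanging `q` and `q'` if necessary, the edge runs along the first coordinate, which is then
    -- the odd one.
    have hs' : ∃ q z q' k l, T.face x q z q' ∧ k ≤ ℓ - 1 ∧ l ≤ ℓ - 1 ∧ k % 2 = 1 ∧ l % 2 = 0 ∧
        p = facePt ℓ x q z q' k l := by
      obtain ⟨q, z, q', k, l, hF, hk, hl, rfl⟩ := hs.exists_facePt hb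
      rw [dim_facePt hℓ.1] at hdeg
      have h5 : k % 2 = 1 ∧ l % 2 = 0 ∨ l % 2 = 1 ∧ k % 2 = 0 := by omega
      rcases h5 with ⟨h5, h6⟩ | ⟨h5, h6⟩
      · exact ⟨q, z, q', k, l, hF, hk, hl, h5, h6, rfl⟩
      · exact ⟨q', z, q, l, k, T.face_symm _ _ _ _ hF, hl, hk, h5, h6,
          (facePt_swap _ _ _ _ _ _ hℓ.2).symm⟩
    obtain ⟨q, z, q', k, l, hF, hk, hl, ek, el, rfl⟩ := hs'
    have ends : ∀ r, T.Inc ℓ r (facePt ℓ x q z q' k l) →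
        r = facePt ℓ x q z q' (k - 1) l ∨ (k + 1 ≤ ℓ - 1 ∧ r = facePt ℓ x q z q' (k - 1 + 2) l) := by
      intro r hr
      rcases inc_facePt hℓ hk hl hr with ⟨i, hi, -, hik, rfl⟩ | ⟨j, -, hj, hjl, rfl⟩
      · rcases hik with rfl | rfl
        · exact Or.inl rfl
        · exact Or.inr ⟨hi, by rw [show k - 1 + 2 = k + 1 by omega]⟩
      · rw [Nat.even_iff] at hj
        omega
    have h3 := fun h => h1 L q z q' (k - 1) l hL hF (by rw [Nat.even_iff]; omega)
      (by rw [Nat.even_iff]; omega) h hl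
    rw [show k - 1 + 1 = k by omega] at h3
    rcases ends _ p1 with e1 | ⟨hk1, e1⟩ <;> rcases ends _ p2 with e2 | ⟨hk2, e2⟩
    · exact absurd ⟨e1.trans e2.symm, rfl⟩ hne'
    · rw [e1, e2]
      exact h3 (by omega)
    · rw [e1, e2, add_comm]
      exact h3 (by omega)
    · exact absurd ⟨e1.trans e2.symm, rfl⟩ hne'

end TannerComplex

/-! ### Locally constant cochains, sums, and the interpolated coboundary -/

namespace CodeEmbedding

open TannerComplex

variable {T : TannerComplex} (E : CodeEmbedding T)

/-- The extension of a cochain of `T` to a cochain that is constant on the cells of lowest degree of each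
local code. -/
noncomputable def pull (n : ℕ) : T.Cochain n →ₗ[ZMod 2] E.tot.Cochain n :=
  relMap fun v b => E.own b.1 = v.1

/-- The sums of a cochain over the cells of lowest degree of the local codes. -/
noncomputable def sumOwn (n : ℕ) : E.tot.Cochain n →ₗ[ZMod 2] T.Cochain n :=
  relMap fun b v => E.own b.1 = v.1

theorem pull_apply {n : ℕ} (φ : T.Cochain n) (b : E.tot.Cells n) (h : T.deg (E.own b.1) = n) :
    E.pull n φ b = φ ⟨E.own b.1, h⟩ := by
  rw [pull, relMap_apply_of_list _ φ b [⟨E.own b.1, h⟩] (by simp) fun v => ?_]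
  · simp
  · rw [List.mem_singleton, Subtype.ext_iff]
    exact eq_comm

theorem pull_apply_of_ne {n : ℕ} (φ : T.Cochain n) (b : E.tot.Cells n) (h : T.deg (E.own b.1) ≠ n) :
    E.pull n φ b = 0 := by
  rw [pull, relMap_apply_of_list _ φ b [] (by simp) fun v => ?_]
  · simp
  · simp only [List.not_mem_nil, iff_false]
    intro e
    exact h (e ▸ v.2)

theorem δloc_shape {i j : ℕ} (hij : i + 1 ≠ j) : E.δloc i j = 0 :=
  relMap_false _ fun a b h => hij (by rw [← b.2, E.tot.adj_deg _ _ h.1, a.2])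

theorem g_apply_eq_zero {i j : ℕ} (φ : E.tot.Cochain i)
    (b : E.tot.Cells j) (h : ∀ a : E.tot.Cells i, T.adj (E.own a.1) (E.own b.1) → φ a = 0) :
    E.g i j φ b = 0 := by
  classical
  let _ := Fintype.ofFinite (E.tot.Cells i)
  rw [CodeEmbedding.g, relMap_apply]
  refine Finset.sum_eq_zero fun a _ => ?_
  split_ifs with hab
  · exact h a ((E.own_adj _ _ hab.1).resolve_left hab.2)
  · rfl

/-- Vertices of degree 0 have no lower neighbours, so on their local complexes the total coboundary
is the local one. -/
theorem g_apply_of_deg_eq_zero {i j : ℕ}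
    (φ : E.tot.Cochain i) (b : E.tot.Cells j) (h : T.deg (E.own b.1) = 0) : E.g i j φ b = 0 :=
  E.g_apply_eq_zero φ b fun a ha => by
    have := T.adj_deg _ _ ha
    omega

/-- Interpolation between the local coboundary (`ε = 0`) and the total one (`ε = 1`). -/
noncomputable def partialδ (ε : ZMod 2) (i j : ℕ) :
    E.tot.Cochain i →ₗ[ZMod 2] E.tot.Cochain j :=
  E.δloc i j + ε • E.g i j

theorem partialδ_apply (ε : ZMod 2) (i j : ℕ)
    (φ : E.tot.Cochain i) (b : E.tot.Cells j) :
    E.partialδ ε i j φ b = E.δloc i j φ b + ε * E.g i j φ b := rfl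

/-- Besides `δ_loc² = g² = 0`, only the mixed terms occur, and these are equal and cancel modulo 2.
-/
theorem partialδ_comp (ε : ZMod 2) (i j k : ℕ)
    (φ : E.tot.Cochain i) : E.partialδ ε j k (E.partialδ ε i j φ) = 0 := by
  have h2 := LinearMap.congr_fun (E.δloc_comp i j k) φ
  have h3 := LinearMap.congr_fun (E.g_comp i j k) φ
  simp only [LinearMap.comp_apply, LinearMap.zero_apply] at h2 h3
  simp only [CodeEmbedding.partialδ, LinearMap.add_apply, LinearMap.smul_apply, map_add, map_smul,
    E.δloc_g, h2, h3]
  simp only [smul_zero, zero_add, add_zero]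
  exact funext fun c => CharTwo.add_self_eq_zero (R := ZMod 2) _

/-- The restriction of a cochain to the local complexes of the checks of degree `0`. -/
noncomputable def restrictZero (n : ℕ) :
    E.tot.Cochain n →ₗ[ZMod 2] ({b : E.tot.Cells n // T.deg (E.own b.1) = 0} → ZMod 2) :=
  LinearMap.funLeft _ _ Subtype.val

theorem partialδ_zero (i j : ℕ) :
    E.partialδ 0 i j = E.δloc i j := by
  rw [CodeEmbedding.partialδ, zero_smul, add_zero]

theorem partialδ_one (i j : ℕ) :
    E.partialδ 1 i j = E.tot.δ i j := by
  rw [CodeEmbedding.partialδ, one_smul, E.δ_eq]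

end CodeEmbedding

/-! ### Constants on the local complexes of `R_X` -/

namespace TannerComplex

open Place

variable {T : TannerComplex} {ℓ : ℕ}

theorem IsRegular.inStar_vert (hT : T.IsRegular) (ℓ : ℕ) (v : T.V) : T.InStar ℓ v (vert v) := by
  have h : T.deg v = 0 ∨ T.deg v = 1 ∨ T.deg v = 2 := by
    have := T.deg_le v
    omega
  rcases h with h | h | h
  · obtain ⟨q, z, q', hF⟩ := hT.exists_face h
    rw [← edgePt_zero ℓ v q, ← facePt_bot v q z q']
    exact inStar_facePt hF (Nat.zero_le _) (Nat.zero_le _)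
  · obtain ⟨z, hz⟩ := (hT.qubit_checked v h).2
    exact Or.inr (Or.inl ⟨h, z, 0, hz, Nat.zero_le _, (edgePt_zero _ _ _).symm⟩)
  · exact Or.inr (Or.inr ⟨h, rfl⟩)

namespace LocalCell

/-- The central vertex of the local complex of `v`, in the lower layer. -/
def center (hT : T.IsRegular) (ℓ : ℕ) (v : T.V) : T.LocalCell ℓ :=
  ⟨v, vert v, 0, hT.inStar_vert ℓ v, fun h => absurd h (by decide)⟩

theorem deg_center (hT : T.IsRegular) (ℓ : ℕ) (v : T.V) : (center hT ℓ v).deg = T.deg v := by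
  simp [center, deg, dim]

theorem own_deg_le (a : T.LocalCell ℓ) : T.deg a.own ≤ a.deg := by
  unfold deg
  omega

/-- A 1-cell has two ends, and no other cell lies directly above a 0-cell of its own complex. Read
in one direction, this makes constants on the 0-cells local cocycles; read in the other, it makes
sums over the 0-cells vanish on the local coboundaries of `R_Z`. -/
theorem even_card_local (hℓ : Odd ℓ ∧ 3 ≤ ℓ) (b : T.LocalCell ℓ) (v : T.V) :
    Even (Nat.card {a : T.LocalCell ℓ // a.adj b ∧ a.own = b.own ∧ a.own = v ∧ a.deg = T.deg v}) := by
  by_cases h : b.own = v ∧ b.deg = T.deg v + 1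
  · obtain ⟨rfl, hb⟩ := h
    obtain ⟨a, a', hne, -, -, hd⟩ := exists_ends hℓ b hb
    have : {d : T.LocalCell ℓ | d.adj b ∧ d.own = b.own ∧ d.own = b.own ∧ d.deg = T.deg b.own}
        = {a, a'} := by
      ext d
      rw [Set.mem_insert_iff, Set.mem_singleton_iff, ← hd]
      constructor
      · exact fun h => ⟨h.1, h.2.1⟩
      · rintro ⟨h1, h2⟩
        have := adj_deg hℓ h1
        exact ⟨h1, h2, h2, by omega⟩
    have h2 : Nat.card {d : T.LocalCell ℓ // d.adj b ∧ d.own = b.own ∧ d.own = b.own ∧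
        d.deg = T.deg b.own} = 2 := by
      change Nat.card ({d : T.LocalCell ℓ | d.adj b ∧ d.own = b.own ∧ d.own = b.own ∧
        d.deg = T.deg b.own} : Set _) = 2
      rw [Nat.card_coe_set_eq, this, Set.ncard_pair hne]
    rw [h2]
    exact even_two
  · have : IsEmpty {a : T.LocalCell ℓ // a.adj b ∧ a.own = b.own ∧ a.own = v ∧ a.deg = T.deg v} := by
      refine ⟨fun ⟨a, h1, h2, h3, h4⟩ => h ⟨h2.symm.trans h3, ?_⟩⟩
      rw [adj_deg hℓ h1, h4]
    simp

/-- The connecting maps are restrictions, so the only cell of another local complex that can lie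
below `b` is the copy of `b`; it exists because `X'_w ⊆ ∂X'_v` whenever `w` is an upper neighbour of
`v`. -/
theorem card_connect (hℓ : Odd ℓ ∧ 3 ≤ ℓ) (b : T.LocalCell ℓ) (v : T.V) (hb : b.deg = T.deg v + 1) :
    (Nat.card {a : T.LocalCell ℓ // a.adj b ∧ a.own ≠ b.own ∧ a.own = v} = 1 ∧ T.adj v b.own) ∨
    (Nat.card {a : T.LocalCell ℓ // a.adj b ∧ a.own ≠ b.own ∧ a.own = v} = 0 ∧ ¬ T.adj v b.own) := by
  by_cases h : T.adj v b.own
  · refine Or.inl ⟨?_, h⟩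
    rw [Nat.card_eq_one_iff_unique]
    refine ⟨⟨?_⟩, ⟨⟨b.lift hℓ v h, b.lift_adj hℓ v h, adj_ne h, rfl⟩⟩⟩
    rintro ⟨a, h1, h2, rfl⟩ ⟨a', h3, h4, h5⟩
    obtain ⟨p1, l1⟩ := adj_connect h h1
    obtain ⟨p2, l2⟩ := adj_connect (h5 ▸ h) h3
    exact Subtype.ext (LocalCell.ext' h5.symm (p1.trans p2.symm) (l1.trans l2.symm))
  · refine Or.inr ⟨?_, h⟩
    have : IsEmpty {a : T.LocalCell ℓ // a.adj b ∧ a.own ≠ b.own ∧ a.own = v} := by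
      refine ⟨fun ⟨a, h1, h2, h3⟩ => h ?_⟩
      rw [← h3]
      exact (own_adj h1).resolve_left h2
    simp

end LocalCell

section Pull

variable (hℓ : Odd ℓ ∧ 3 ≤ ℓ)

theorem replaceX_own_deg_le (b : (T.replaceX ℓ hℓ).tot.V) :
    T.deg ((T.replaceX ℓ hℓ).own b) ≤ (T.replaceX ℓ hℓ).tot.deg b := LocalCell.own_deg_le b

theorem replaceX_δloc_pull (n : ℕ) (φ : T.Cochain n) :
    (T.replaceX ℓ hℓ).δloc n (n + 1) ((T.replaceX ℓ hℓ).pull n φ) = 0 := by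
  classical
  let _ := Fintype.ofFinite (T.Cells n)
  funext b
  rw [CodeEmbedding.δloc, CodeEmbedding.pull, relMap_comp_apply]
  refine Finset.sum_eq_zero fun v _ => ?_
  rw [(T.replaceX ℓ hℓ).tot.card_cells n (fun a => (T.replaceX ℓ hℓ).own a = v.1 ∧
    (T.replaceX ℓ hℓ).tot.adj a b.1 ∧ (T.replaceX ℓ hℓ).own a = (T.replaceX ℓ hℓ).own b.1)
    fun a ha => ?_]
  · have : Nat.card {a // (T.replaceX ℓ hℓ).own a = v.1 ∧
        (T.replaceX ℓ hℓ).tot.adj a b.1 ∧ (T.replaceX ℓ hℓ).own a = (T.replaceX ℓ hℓ).own b.1} =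
        Nat.card {a : T.LocalCell ℓ // a.adj b.1 ∧ a.own = LocalCell.own b.1 ∧ a.own = v.1 ∧
          a.deg = T.deg v.1} := by
      refine Nat.card_congr (Equiv.subtypeEquivRight fun a => ⟨?_, fun h => ⟨h.2.2.1, h.1, h.2.1⟩⟩)
      rintro ⟨h1, h2, h3⟩
      have h4 := LocalCell.adj_deg hℓ h2
      have h5 : LocalCell.deg b.1 = n + 1 := b.2
      have h6 := v.2
      exact ⟨h2, h3, h1, by omega⟩
    rw [(ZMod.natCast_eq_zero_iff_even).2 (this ▸ LocalCell.even_card_local hℓ _ _), zero_mul]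
  · have h4 := (T.replaceX ℓ hℓ).tot.adj_deg _ _ ha.2.1
    have h5 := b.2
    omega

/-- By `card_connect`, restricting constants reproduces the adjacency of `T` with multiplicity one.
The identity holds for cochains and not merely for their classes. -/
theorem replaceX_g_pull (n : ℕ) (φ : T.Cochain n) :
    (T.replaceX ℓ hℓ).g n (n + 1) ((T.replaceX ℓ hℓ).pull n φ) =
      (T.replaceX ℓ hℓ).pull (n + 1) (T.δ n (n + 1) φ) := by
  classical
  let _ := Fintype.ofFinite (T.Cells n)
  funext b
  have hbd : LocalCell.deg b.1 = n + 1 := b.2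
  rw [CodeEmbedding.g, CodeEmbedding.pull, CodeEmbedding.pull, δ, relMap_comp_apply, relMap_comp_apply]
  refine Finset.sum_congr rfl fun v _ => ?_
  congr 2
  rw [(T.replaceX ℓ hℓ).tot.card_cells n (fun a => (T.replaceX ℓ hℓ).own a = v.1 ∧
    (T.replaceX ℓ hℓ).tot.adj a b.1 ∧ (T.replaceX ℓ hℓ).own a ≠ (T.replaceX ℓ hℓ).own b.1)
    fun a ha => by
      have h4 := (T.replaceX ℓ hℓ).tot.adj_deg _ _ ha.2.1
      have h5 := b.2
      omega,
    T.card_cells (n + 1) (fun w => T.adj v.1 w ∧ (T.replaceX ℓ hℓ).own b.1 = w) fun w hw => by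
      rw [T.adj_deg _ _ hw.1, v.2]]
  have : Nat.card {a // (T.replaceX ℓ hℓ).own a = v.1 ∧
      (T.replaceX ℓ hℓ).tot.adj a b.1 ∧ (T.replaceX ℓ hℓ).own a ≠ (T.replaceX ℓ hℓ).own b.1} =
      Nat.card {a : T.LocalCell ℓ // a.adj b.1 ∧ a.own ≠ LocalCell.own b.1 ∧ a.own = v.1} :=
    Nat.card_congr (Equiv.subtypeEquivRight fun a =>
      ⟨fun h => ⟨h.2.1, h.2.2, h.1⟩, fun h => ⟨h.2.2, h.1, h.2.1⟩⟩)
  rw [this]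
  rcases LocalCell.card_connect hℓ b.1 v.1 (by rw [hbd, v.2]) with ⟨h1, h2⟩ | ⟨h1, h2⟩
  · rw [h1, eq_comm, Nat.card_eq_one_iff_unique]
    refine ⟨⟨?_⟩, ⟨⟨_, h2, rfl⟩⟩⟩
    rintro ⟨w, -, h3⟩ ⟨w', -, h4⟩
    exact Subtype.ext (h3.symm.trans h4)
  · rw [h1, eq_comm]
    have : IsEmpty {w // T.adj v.1 w ∧ (T.replaceX ℓ hℓ).own b.1 = w} := by
      refine ⟨fun ⟨w, h3, h4⟩ => h2 ?_⟩
      subst h4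
      exact h3
    simp

theorem replaceX_δloc_zeroCell {i n : ℕ} (ψ : (T.replaceX ℓ hℓ).tot.Cochain i)
    (b : (T.replaceX ℓ hℓ).tot.Cells n) (hb : T.deg ((T.replaceX ℓ hℓ).own b.1) = n) :
    (T.replaceX ℓ hℓ).δloc i n ψ b = 0 := by
  rw [CodeEmbedding.δloc, relMap_apply_of_list _ ψ b [] (by simp) fun a => ?_]
  · simp
  · simp only [List.not_mem_nil, iff_false]
    rintro ⟨h1, h2⟩
    have h3 := replaceX_own_deg_le hℓ a.1
    have h4 := (T.replaceX ℓ hℓ).tot.adj_deg _ _ h1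
    have h5 := b.2
    rw [h2] at h3
    omega

theorem replaceX_exists_zeroCell (hT : T.IsRegular) {n : ℕ} (v : T.Cells n) :
    ∃ b : (T.replaceX ℓ hℓ).tot.Cells n, (T.replaceX ℓ hℓ).own b.1 = v.1 :=
  ⟨⟨LocalCell.center hT ℓ v.1, (LocalCell.deg_center hT ℓ v.1).trans v.2⟩, rfl⟩

theorem replaceX_pull_injective (hT : T.IsRegular) (n : ℕ) :
    Function.Injective ((T.replaceX ℓ hℓ).pull n) := by
  intro φ φ' h
  funext v
  obtain ⟨b, hb⟩ := replaceX_exists_zeroCell hℓ hT v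
  have h1 := congrFun h b
  have h2 : T.deg ((T.replaceX ℓ hℓ).own b.1) = n := by rw [hb, v.2]
  rw [CodeEmbedding.pull_apply _ _ _ h2, CodeEmbedding.pull_apply _ _ _ h2] at h1
  have h3 : (⟨_, h2⟩ : T.Cells n) = v := Subtype.ext hb
  rwa [h3] at h1

/-- A cochain whose local coboundary vanishes is constant on the vertices of the local complexes. -/
theorem IsRegular.exists_eq_pull (hT : T.IsRegular) {n : ℕ} (hn : n ≤ 1)
    (φ : (T.replaceX ℓ hℓ).tot.Cochain n)
    (hφ : ∀ b : (T.replaceX ℓ hℓ).tot.Cells (n + 1), T.deg ((T.replaceX ℓ hℓ).own b.1) = n →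
      (T.replaceX ℓ hℓ).δloc n (n + 1) φ b = 0) :
    ∃ c : T.Cochain n, ∀ a : (T.replaceX ℓ hℓ).tot.Cells n, T.deg ((T.replaceX ℓ hℓ).own a.1) = n →
      φ a = (T.replaceX ℓ hℓ).pull n c a := by
  classical
  choose pt hpt using replaceX_exists_zeroCell hℓ hT (n := n)
  refine ⟨fun v => φ (pt v), fun a ha => ?_⟩
  rw [CodeEmbedding.pull_apply _ _ _ ha]
  let f : T.LocalCell ℓ → ZMod 2 := fun c => if h : LocalCell.deg c = n then φ ⟨c, h⟩ else 0
  have hf : ∀ c : (T.replaceX ℓ hℓ).tot.Cells n, φ c = f c.1 := fun c => by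
    have h : LocalCell.deg c.1 = n := c.2
    have e : f c.1 = φ ⟨c.1, h⟩ := dif_pos h
    exact e.symm
  rw [hf, hf]
  refine LocalCell.eq_of_ends hT hℓ (v := (T.replaceX ℓ hℓ).own a.1) (by rw [ha]; exact hn) f ?_
    rfl (hpt ⟨_, ha⟩) (a.2.trans ha.symm) ((pt ⟨_, ha⟩).2.trans ha.symm)
  intro c c' b o1 o2 o3 hb hc hc'
  rw [ha] at hb
  have e1 := LocalCell.adj_deg hℓ hc
  have e2 := LocalCell.adj_deg hℓ hc'
  let b' : (T.replaceX ℓ hℓ).tot.Cells (n + 1) := ⟨b, hb⟩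
  let C : (T.replaceX ℓ hℓ).tot.Cells n := ⟨c, show LocalCell.deg c = n by omega⟩
  let C' : (T.replaceX ℓ hℓ).tot.Cells n := ⟨c', show LocalCell.deg c' = n by omega⟩
  have hb' : T.deg ((T.replaceX ℓ hℓ).own b'.1) = n := (congrArg T.deg o3).trans ha
  obtain ⟨d, d', -, hd, hsum⟩ := exists_δloc_ends hℓ b' hb'
  have h0 := hsum φ
  rw [hφ b' hb'] at h0
  have h1 := CharTwo.add_eq_zero.1 h0.symm
  rw [← hf C, ← hf C']
  rcases (hd C).1 ⟨hc, o1.trans o3.symm⟩ with h2 | h2 <;>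
  rcases (hd C').1 ⟨hc', o2.trans o3.symm⟩ with h3 | h3 <;> rw [h2, h3]
  · exact h1
  · exact h1.symm

end Pull

end TannerComplex

/-! ### The rank equation for `R_X` -/

namespace TannerComplex

open Module

variable {T : TannerComplex} {ℓ : ℕ} (hℓ : Odd ℓ ∧ 3 ≤ ℓ)

theorem replaceX_partialδ_pull (ε : ZMod 2) (n : ℕ) (φ : T.Cochain n) :
    (T.replaceX ℓ hℓ).partialδ ε n (n + 1) ((T.replaceX ℓ hℓ).pull n φ) =
      (T.replaceX ℓ hℓ).pull (n + 1) ((ε • T.δ n (n + 1)) φ) := by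
  rw [CodeEmbedding.partialδ, LinearMap.add_apply, replaceX_δloc_pull, zero_add,
    LinearMap.smul_apply, replaceX_g_pull, LinearMap.smul_apply, map_smul]

/-- All cells of degree 0 are 0-cells of the connected complexes of X-checks, where `g` contributes
nothing; so a cocycle is constant on each of them, for either value of `ε`. On such constants the
coboundary is `ε` times that of `T`. -/
theorem replaceX_ker_partialδ_zero (hT : T.IsRegular) (ε : ZMod 2) :
    LinearMap.ker ((T.replaceX ℓ hℓ).partialδ ε 0 1) =
      (LinearMap.ker (ε • T.δ 0 1)).map ((T.replaceX ℓ hℓ).pull 0) := by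
  ext φ
  constructor
  · intro hφ
    obtain ⟨c, hc⟩ := hT.exists_eq_pull hℓ (Nat.zero_le 1) φ fun b hb => by
      have h := congrFun hφ b
      rw [CodeEmbedding.partialδ_apply, CodeEmbedding.g_apply_of_deg_eq_zero _ _ _ hb] at h
      simpa using h
    have e : (T.replaceX ℓ hℓ).pull 0 c = φ := by
      funext a
      refine (hc a ?_).symm
      have := replaceX_own_deg_le hℓ a.1
      have := a.2
      omega
    refine ⟨c, replaceX_pull_injective hℓ hT 1 ?_, e⟩
    rw [map_zero, ← replaceX_partialδ_pull hℓ ε 0, e]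
    exact hφ
  · rintro ⟨c, hc, rfl⟩
    refine (replaceX_partialδ_pull hℓ ε 0 c).trans ?_
    rw [show (ε • T.δ 0 1) c = 0 from hc, map_zero]

theorem replaceX_finrank_partialδ_zero (hT : T.IsRegular) (ε : ZMod 2) :
    finrank (ZMod 2) (LinearMap.range ((T.replaceX ℓ hℓ).partialδ ε 0 1)) +
      finrank (ZMod 2) (T.Cochain 0) = finrank (ZMod 2) ((T.replaceX ℓ hℓ).tot.Cochain 0) +
      finrank (ZMod 2) (LinearMap.range (ε • T.δ 0 1)) := by
  have h1 := LinearMap.finrank_range_add_finrank_ker ((T.replaceX ℓ hℓ).partialδ ε 0 1)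
  have h2 := LinearMap.finrank_range_add_finrank_ker (ε • T.δ 0 1)
  rw [replaceX_ker_partialδ_zero hℓ hT,
    ← (Submodule.equivMapOfInjective _ (replaceX_pull_injective hℓ hT 0) _).finrank_eq] at h1
  omega

/-- On the complexes of X-checks a cocycle is locally closed, hence exact by the vanishing of their
first cohomology. Conversely `partialδ ε` of the primitive is a cocycle on all cells with the
prescribed restriction. -/
theorem replaceX_map_restrictZero (hT : T.IsRegular) (ε : ZMod 2) :
    (LinearMap.ker ((T.replaceX ℓ hℓ).partialδ ε 1 2)).map ((T.replaceX ℓ hℓ).restrictZero 1) =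
      LinearMap.range ((T.replaceX ℓ hℓ).restrictZero 1 ∘ₗ (T.replaceX ℓ hℓ).δloc 0 1) := by
  ext χ
  constructor
  · rintro ⟨φ, hφ, rfl⟩
    obtain ⟨ψ, hψ⟩ := hT.exists_δloc_eq hℓ φ fun c hc => by
      have h := congrFun hφ c
      rw [CodeEmbedding.partialδ_apply, CodeEmbedding.g_apply_of_deg_eq_zero _ _ _ hc] at h
      simpa using h
    exact ⟨ψ, funext fun b => hψ b.1 b.2⟩
  · rintro ⟨ψ, rfl⟩
    refine ⟨(T.replaceX ℓ hℓ).partialδ ε 0 1 ψ, CodeEmbedding.partialδ_comp _ ε 0 1 2 ψ,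
      funext fun b => ?_⟩
    change (T.replaceX ℓ hℓ).partialδ ε 0 1 ψ b.1 = (T.replaceX ℓ hℓ).δloc 0 1 ψ b.1
    rw [CodeEmbedding.partialδ_apply, CodeEmbedding.g_apply_of_deg_eq_zero _ _ _ b.2]
    simp

/-- The remaining cells of degree 1 are 0-cells of qubit complexes, which the local coboundary never
reaches, so the restriction loses nothing. -/
theorem replaceX_ker_restrictZero_δloc :
    LinearMap.ker ((T.replaceX ℓ hℓ).restrictZero 1 ∘ₗ (T.replaceX ℓ hℓ).δloc 0 1) =
      LinearMap.ker ((T.replaceX ℓ hℓ).δloc 0 1) := by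
  refine le_antisymm (fun ψ hψ => funext fun b => ?_) (LinearMap.ker_le_ker_comp _ _)
  by_cases hb : T.deg ((T.replaceX ℓ hℓ).own b.1) = 0
  · exact congrFun hψ ⟨b, hb⟩
  · refine replaceX_δloc_zeroCell hℓ ψ b ?_
    have := replaceX_own_deg_le hℓ b.1
    have := b.2
    omega

/-- If a cochain vanishes on the complexes of X-checks, then `g` contributes nothing at the 1-cells
of the qubit complexes, and the cocycle condition there forces constancy on each of these connected
complexes. -/
theorem replaceX_ker_partialδ_inf (hT : T.IsRegular) (ε : ZMod 2) :
    LinearMap.ker ((T.replaceX ℓ hℓ).partialδ ε 1 2) ⊓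
        LinearMap.ker ((T.replaceX ℓ hℓ).restrictZero 1) =
      (LinearMap.ker (ε • T.δ 1 2)).map ((T.replaceX ℓ hℓ).pull 1) := by
  ext φ
  constructor
  · rintro ⟨hφ, h0⟩
    have h0' : ∀ a : (T.replaceX ℓ hℓ).tot.Cells 1, T.deg ((T.replaceX ℓ hℓ).own a.1) = 0 → φ a = 0 :=
      fun a ha => congrFun h0 ⟨a, ha⟩
    obtain ⟨c, hc⟩ := hT.exists_eq_pull hℓ le_rfl φ fun b hb => by
      have h := congrFun hφ b
      rw [CodeEmbedding.partialδ_apply, CodeEmbedding.g_apply_eq_zero _ _ _ fun a ha => h0' a (by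
        have := T.adj_deg _ _ ha
        omega)] at h
      simpa using h
    have e : (T.replaceX ℓ hℓ).pull 1 c = φ := by
      funext a
      by_cases ha : T.deg ((T.replaceX ℓ hℓ).own a.1) = 1
      · exact (hc a ha).symm
      · rw [CodeEmbedding.pull_apply_of_ne _ _ _ ha, h0' a]
        have := replaceX_own_deg_le hℓ a.1
        have := a.2
        omega
    refine ⟨c, replaceX_pull_injective hℓ hT 2 ?_, e⟩
    rw [map_zero, ← replaceX_partialδ_pull hℓ ε 1, e]
    exact hφ
  · rintro ⟨c, hc, rfl⟩
    refine ⟨(replaceX_partialδ_pull hℓ ε 1 c).trans ?_, funext fun b => ?_⟩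
    · rw [show (ε • T.δ 1 2) c = 0 from hc, map_zero]
    · exact CodeEmbedding.pull_apply_of_ne _ _ _ (by rw [b.2]; exact zero_ne_one)

/-- Restriction to the complexes of X-checks splits the space of 1-cocycles: its image has the rank
of `δloc 0 1`, and its kernel is a copy of the kernel of `ε • T.δ 1 2`. -/
theorem replaceX_finrank_partialδ_one (hT : T.IsRegular) (ε : ZMod 2) :
    finrank (ZMod 2) (LinearMap.range ((T.replaceX ℓ hℓ).partialδ ε 1 2)) +
      finrank (ZMod 2) (LinearMap.range ((T.replaceX ℓ hℓ).δloc 0 1)) +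
      finrank (ZMod 2) (T.Cochain 1) = finrank (ZMod 2) ((T.replaceX ℓ hℓ).tot.Cochain 1) +
      finrank (ZMod 2) (LinearMap.range (ε • T.δ 1 2)) := by
  have h1 := LinearMap.finrank_range_add_finrank_ker ((T.replaceX ℓ hℓ).partialδ ε 1 2)
  have h2 := LinearMap.finrank_range_add_finrank_ker (ε • T.δ 1 2)
  have h3 := LinearMap.finrank_range_add_finrank_ker (((T.replaceX ℓ hℓ).restrictZero 1).domRestrict
    (LinearMap.ker ((T.replaceX ℓ hℓ).partialδ ε 1 2)))
  have h4 := LinearMap.finrank_range_add_finrank_ker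
    ((T.replaceX ℓ hℓ).restrictZero 1 ∘ₗ (T.replaceX ℓ hℓ).δloc 0 1)
  have h5 := LinearMap.finrank_range_add_finrank_ker ((T.replaceX ℓ hℓ).δloc 0 1)
  rw [replaceX_ker_restrictZero_δloc] at h4
  rw [LinearMap.range_domRestrict, replaceX_map_restrictZero hℓ hT, LinearMap.ker_domRestrict,
    ← Submodule.finrank_map_subtype_eq, Submodule.map_comap_subtype,
    replaceX_ker_partialδ_inf hℓ hT,
    ← (Submodule.equivMapOfInjective _ (replaceX_pull_injective hℓ hT 1) _).finrank_eq] at h3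
  omega

theorem replaceX_finrank_δloc_zero (hT : T.IsRegular) :
    finrank (ZMod 2) (LinearMap.range ((T.replaceX ℓ hℓ).δloc 0 1)) +
      finrank (ZMod 2) (T.Cochain 0) = finrank (ZMod 2) ((T.replaceX ℓ hℓ).tot.Cochain 0) := by
  have h := replaceX_finrank_partialδ_zero hℓ hT 0
  rwa [CodeEmbedding.partialδ_zero, CodeEmbedding.finrank_range_zero (zero_smul _ _), add_zero] at h

theorem replaceX_finrank_δloc_one (hT : T.IsRegular) :
    finrank (ZMod 2) (LinearMap.range ((T.replaceX ℓ hℓ).δloc 1 2)) +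
      finrank (ZMod 2) (LinearMap.range ((T.replaceX ℓ hℓ).δloc 0 1)) +
      finrank (ZMod 2) (T.Cochain 1) = finrank (ZMod 2) ((T.replaceX ℓ hℓ).tot.Cochain 1) := by
  have h := replaceX_finrank_partialδ_one hℓ hT 0
  rwa [CodeEmbedding.partialδ_zero, CodeEmbedding.finrank_range_zero (zero_smul _ _), add_zero] at h

/-- The formulas for `ε = 0` and `ε = 1` differ only in the rank of `ε • T.δ`, so subtraction gives
the claim. -/
theorem replaceX_finrank_δ (hT : T.IsRegular) (i j : ℕ) :
    finrank (ZMod 2) (LinearMap.range ((T.replaceX ℓ hℓ).tot.δ i j)) =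
      finrank (ZMod 2) (LinearMap.range ((T.replaceX ℓ hℓ).δloc i j)) +
      finrank (ZMod 2) (LinearMap.range (T.δ i j)) := by
  by_cases hij : i + 1 = j
  · subst hij
    match i with
    | 0 =>
      have h := replaceX_finrank_partialδ_zero hℓ hT 1
      rw [CodeEmbedding.partialδ_one, one_smul] at h
      have h' := replaceX_finrank_δloc_zero hℓ hT
      change finrank (ZMod 2) (LinearMap.range ((T.replaceX ℓ hℓ).tot.δ 0 1)) =
        finrank (ZMod 2) (LinearMap.range ((T.replaceX ℓ hℓ).δloc 0 1)) +
        finrank (ZMod 2) (LinearMap.range (T.δ 0 1))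
      omega
    | 1 =>
      have h := replaceX_finrank_partialδ_one hℓ hT 1
      rw [CodeEmbedding.partialδ_one, one_smul] at h
      have h' := replaceX_finrank_δloc_one hℓ hT
      change finrank (ZMod 2) (LinearMap.range ((T.replaceX ℓ hℓ).tot.δ 1 2)) =
        finrank (ZMod 2) (LinearMap.range ((T.replaceX ℓ hℓ).δloc 1 2)) +
        finrank (ZMod 2) (LinearMap.range (T.δ 1 2))
      omega
    | i + 2 =>
      have h1 := CodeEmbedding.subsingleton_cochain (T.replaceX ℓ hℓ).tot
        (show 2 < i + 2 + 1 by omega)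
      have h2 := CodeEmbedding.subsingleton_cochain T (show 2 < i + 2 + 1 by omega)
      simp only [finrank_zero_of_subsingleton]
  · rw [CodeEmbedding.finrank_range_zero (CodeEmbedding.δ_shape _ hij),
      CodeEmbedding.finrank_range_zero (CodeEmbedding.δloc_shape _ hij),
      CodeEmbedding.finrank_range_zero (CodeEmbedding.δ_shape _ hij)]

end TannerComplex

/-! ### Maps into the induced complex, and the theorem for `R_X` -/

namespace CodeEmbedding

open CategoryTheory TannerComplex

variable {T : TannerComplex} (E : CodeEmbedding T)

/-- The cochain map into the induced complex given by linear maps that commute with the differentials. -/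
noncomputable def inducedHom (f : ∀ n, T.Cochain n →ₗ[ZMod 2] E.Hloc n)
    (comm : ∀ n φ, E.Hg n (n + 1) (f n φ) = f (n + 1) (T.δ n (n + 1) φ)) : T.complex ⟶ E.induced where
  f n := ModuleCat.ofHom (f n)
  comm' := by
    rintro i _ rfl
    exact ModuleCat.hom_ext (LinearMap.ext fun φ => comm i φ)

/-- The linear map to the local cohomology given by a linear map to the local cocycles. -/
noncomputable def toHloc {n : ℕ} (f : T.Cochain n →ₗ[ZMod 2] E.tot.Cochain n)
    (hf : ∀ φ, E.δloc n (n + 1) (f φ) = 0) : T.Cochain n →ₗ[ZMod 2] E.Hloc n :=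
  (E.Bloc n).mkQ ∘ₗ f.codRestrict (E.Zloc n) hf

theorem toHloc_eq_zero_iff {n : ℕ} (f : T.Cochain n →ₗ[ZMod 2] E.tot.Cochain n)
    (hf : ∀ φ, E.δloc n (n + 1) (f φ) = 0) (φ : T.Cochain n) :
    E.toHloc f hf φ = 0 ↔ ∃ ψ, E.δloc (n - 1) n ψ = f φ :=
  Submodule.Quotient.mk_eq_zero _

theorem Hg_toHloc {n : ℕ} (f : T.Cochain n →ₗ[ZMod 2] E.tot.Cochain n)
    (hf : ∀ φ, E.δloc n (n + 1) (f φ) = 0) (f' : T.Cochain (n + 1) →ₗ[ZMod 2] E.tot.Cochain (n + 1))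
    (hf' : ∀ φ, E.δloc (n + 1) (n + 1 + 1) (f' φ) = 0) (φ : T.Cochain n)
    (h : ∃ ψ, E.δloc n (n + 1) ψ = E.g n (n + 1) (f φ) - f' (T.δ n (n + 1) φ)) :
    E.Hg n (n + 1) (E.toHloc f hf φ) = E.toHloc f' hf' (T.δ n (n + 1) φ) :=
  (Submodule.Quotient.eq _).2 h

end CodeEmbedding

namespace TannerComplex

open Module CategoryTheory

variable {T : TannerComplex} {ℓ : ℕ} (hℓ : Odd ℓ ∧ 3 ≤ ℓ)

/-- Local coboundaries vanish on the 0-cells of every local complex, whereas `pull` takes there the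
values of the original cochain. -/
theorem replaceX_toHloc_injective (hT : T.IsRegular) (n : ℕ) :
    Function.Injective ((T.replaceX ℓ hℓ).toHloc ((T.replaceX ℓ hℓ).pull n)
      (replaceX_δloc_pull hℓ n)) := by
  rw [injective_iff_map_eq_zero]
  intro φ h
  obtain ⟨ψ, hψ⟩ := (CodeEmbedding.toHloc_eq_zero_iff _ _ _ _).1 h
  funext v
  obtain ⟨b, hb⟩ := replaceX_exists_zeroCell hℓ hT v
  have h2 : T.deg ((T.replaceX ℓ hℓ).own b.1) = n := by rw [hb, v.2]
  have h1 := congrFun hψ b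
  rw [replaceX_δloc_zeroCell hℓ ψ b h2, CodeEmbedding.pull_apply _ _ _ h2] at h1
  have h3 : (⟨_, h2⟩ : T.Cells n) = v := Subtype.ext hb
  rw [h3] at h1
  exact h1.symm

/-- Here and in degree 1, equality of dimensions turns the injectivity of `ι` into bijectivity. -/
theorem replaceX_finrank_Hloc_zero (hT : T.IsRegular) :
    finrank (ZMod 2) ((T.replaceX ℓ hℓ).Hloc 0) = finrank (ZMod 2) (T.Cochain 0) := by
  have h1 := (T.replaceX ℓ hℓ).finrank_Hloc 0
  rw [CodeEmbedding.finrank_range_zero (CodeEmbedding.δloc_shape _ (by omega)),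
    zero_add] at h1
  have h2 := replaceX_finrank_δloc_zero hℓ hT
  omega

theorem replaceX_finrank_Hloc_one (hT : T.IsRegular) :
    finrank (ZMod 2) ((T.replaceX ℓ hℓ).Hloc 1) = finrank (ZMod 2) (T.Cochain 1) := by
  have h1 : finrank (ZMod 2) ((T.replaceX ℓ hℓ).Hloc 1) +
    finrank (ZMod 2) (LinearMap.range ((T.replaceX ℓ hℓ).δloc 0 1)) +
    finrank (ZMod 2) (LinearMap.range ((T.replaceX ℓ hℓ).δloc 1 2)) = _ :=
      (T.replaceX ℓ hℓ).finrank_Hloc 1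
  have h2 := replaceX_finrank_δloc_one hℓ hT
  omega

theorem replaceX_pull_single [DecidableEq (T.Cells n)] (v : T.Cells n) :
    (T.replaceX ℓ hℓ).localSum n v ((T.replaceX ℓ hℓ).pull n (Pi.single v 1)) := by
  classical
  funext b
  rw [CodeEmbedding.pull, relMap_single, Set.indicator_apply]
  rfl

theorem IsRegular.replaceX_hasCochainMap (hT : T.IsRegular) :
    (T.replaceX ℓ hℓ).HasCochainMap (T.replaceX ℓ hℓ).localSum ∧
      T.numLogical = (T.replaceX ℓ hℓ).tot.numLogical := by
  classical
  have comm : ∀ n φ, (T.replaceX ℓ hℓ).Hg n (n + 1)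
      ((T.replaceX ℓ hℓ).toHloc _ (replaceX_δloc_pull hℓ n) φ) =
      (T.replaceX ℓ hℓ).toHloc _ (replaceX_δloc_pull hℓ (n + 1)) (T.δ n (n + 1) φ) := fun n φ =>
    CodeEmbedding.Hg_toHloc _ _ _ _ _ _ ⟨0, by rw [map_zero, replaceX_g_pull, sub_self]⟩
  have inj := replaceX_toHloc_injective hℓ hT
  have surj0 : Function.Surjective ((T.replaceX ℓ hℓ).toHloc _ (replaceX_δloc_pull hℓ 0)) :=
    (LinearMap.injective_iff_surjective_of_finrank_eq_finrank
      (replaceX_finrank_Hloc_zero hℓ hT).symm).1 (inj 0)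
  have surj1 : Function.Surjective ((T.replaceX ℓ hℓ).toHloc _ (replaceX_δloc_pull hℓ 1)) :=
    (LinearMap.injective_iff_surjective_of_finrank_eq_finrank
      (replaceX_finrank_Hloc_one hℓ hT).symm).1 (inj 1)
  refine CodeEmbedding.hasCochainMap_of _ _ (CodeEmbedding.inducedHom _ _ comm) inj surj1
    (fun y => ?_) (fun n v => ⟨⟨_, replaceX_δloc_pull hℓ n _⟩, replaceX_pull_single hℓ v, rfl⟩)
    (replaceX_finrank_δ hℓ hT)
  obtain ⟨x, rfl⟩ := surj0 y
  exact ⟨x, (comm 0 x).symm⟩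

end TannerComplex

/-! ### Transposition from `R_X` to `R_Z` -/

namespace TannerComplex

open Module

section Transposition

/-- The cells of the dual complex are the cells of complementary degree. -/
def dualCells (S : TannerComplex) {n : ℕ} (hn : n ≤ 2) : S.dual.Cells n ≃ S.Cells (2 - n) :=
  Equiv.subtypeEquivRight fun v => by
    have := S.deg_le v
    change 2 - S.deg v = n ↔ _
    omega

/-- Dualising transposes the matrix and reindexes rows and columns by complementary degrees; neither
changes the rank. -/
theorem finrank_range_relMap_dual (S : TannerComplex) {i j : ℕ} (hi : i ≤ 2) (hj : j ≤ 2)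
    (r : S.V → S.V → Prop) :
    finrank (ZMod 2) (LinearMap.range
      (relMap fun (a : S.dual.Cells i) (b : S.dual.Cells j) => r b.1 a.1)) =
    finrank (ZMod 2) (LinearMap.range
      (relMap fun (b : S.Cells (2 - j)) (a : S.Cells (2 - i)) => r b.1 a.1)) := by
  rw [← finrank_range_relMap_swap fun (b : S.Cells (2 - j)) (a : S.Cells (2 - i)) => r b.1 a.1]
  exact finrank_range_relMap_congr _ _ (S.dualCells hi) (S.dualCells hj) fun _ _ => Iff.rfl

theorem finrank_range_δ_dual (S : TannerComplex) {i j : ℕ} (hi : i ≤ 2) (hj : j ≤ 2) :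
    finrank (ZMod 2) (LinearMap.range (S.dual.δ i j)) =
      finrank (ZMod 2) (LinearMap.range (S.δ (2 - j) (2 - i))) :=
  finrank_range_relMap_dual S hi hj S.adj

theorem finrank_cochain_dual (S : TannerComplex) {n : ℕ} (hn : n ≤ 2) :
    finrank (ZMod 2) (S.dual.Cochain n) = finrank (ZMod 2) (S.Cochain (2 - n)) :=
  (LinearEquiv.funCongrLeft (ZMod 2) (ZMod 2) (S.dualCells hn)).finrank_eq.symm

theorem _root_.CodeEmbedding.finrank_range_δloc_dual {T : TannerComplex} (E : CodeEmbedding T.dual)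
    {i j : ℕ} (hi : i ≤ 2) (hj : j ≤ 2) :
    finrank (ZMod 2) (LinearMap.range (E.dual.δloc i j)) =
      finrank (ZMod 2) (LinearMap.range (E.δloc (2 - j) (2 - i))) := by
  rw [CodeEmbedding.δloc, CodeEmbedding.δloc,
    ← finrank_range_relMap_dual E.tot hi hj fun b a => E.tot.adj b a ∧ E.own b = E.own a]
  refine finrank_range_relMap_congr _ _ (Equiv.refl _) (Equiv.refl _) fun a b => ?_
  exact and_congr Iff.rfl eq_comm

end Transposition

variable {T : TannerComplex} {ℓ : ℕ} (hℓ : Odd ℓ ∧ 3 ≤ ℓ)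

theorem replaceZ_finrank_δ (hT : T.IsRegular) (i j : ℕ) :
    finrank (ZMod 2) (LinearMap.range ((T.replaceZ ℓ hℓ).tot.δ i j)) =
      finrank (ZMod 2) (LinearMap.range ((T.replaceZ ℓ hℓ).δloc i j)) +
      finrank (ZMod 2) (LinearMap.range (T.δ i j)) := by
  by_cases hj : j ≤ 2
  · by_cases hi : i ≤ 2
    · have h1 := replaceX_finrank_δ hℓ hT.dual (2 - j) (2 - i)
      have h2 := finrank_range_δ_dual T (Nat.sub_le 2 j) (Nat.sub_le 2 i)
      rw [Nat.sub_sub_self hi, Nat.sub_sub_self hj] at h2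
      rw [← h2]
      refine (finrank_range_δ_dual (T.dual.replaceX ℓ hℓ).tot hi hj).trans (h1.trans ?_)
      rw [← CodeEmbedding.finrank_range_δloc_dual _ hi hj]
      rfl
    · have hij : i + 1 ≠ j := by omega
      rw [CodeEmbedding.finrank_range_zero (CodeEmbedding.δ_shape _ hij),
        CodeEmbedding.finrank_range_zero (CodeEmbedding.δloc_shape _ hij),
        CodeEmbedding.finrank_range_zero (CodeEmbedding.δ_shape _ hij)]
  · have h1 := CodeEmbedding.subsingleton_cochain (T.replaceZ ℓ hℓ).tot (not_le.1 hj)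
    have h2 := CodeEmbedding.subsingleton_cochain T (not_le.1 hj)
    simp only [finrank_zero_of_subsingleton]

theorem replaceZ_finrank_Hloc_one (hT : T.IsRegular) :
    finrank (ZMod 2) ((T.replaceZ ℓ hℓ).Hloc 1) = finrank (ZMod 2) (T.Cochain 1) := by
  have h1 : finrank (ZMod 2) ((T.replaceZ ℓ hℓ).Hloc 1) +
    finrank (ZMod 2) (LinearMap.range ((T.replaceZ ℓ hℓ).δloc 0 1)) +
    finrank (ZMod 2) (LinearMap.range ((T.replaceZ ℓ hℓ).δloc 1 2)) =
    finrank (ZMod 2) ((T.replaceZ ℓ hℓ).tot.Cochain 1) := (T.replaceZ ℓ hℓ).finrank_Hloc 1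
  have h2 := replaceX_finrank_δloc_one hℓ hT.dual
  have h3 : finrank (ZMod 2) (LinearMap.range ((T.replaceZ ℓ hℓ).δloc 0 1)) =
      finrank (ZMod 2) (LinearMap.range ((T.dual.replaceX ℓ hℓ).δloc 1 2)) :=
    CodeEmbedding.finrank_range_δloc_dual _ (by norm_num) (by norm_num)
  have h4 : finrank (ZMod 2) (LinearMap.range ((T.replaceZ ℓ hℓ).δloc 1 2)) =
      finrank (ZMod 2) (LinearMap.range ((T.dual.replaceX ℓ hℓ).δloc 0 1)) :=
    CodeEmbedding.finrank_range_δloc_dual _ (by norm_num) (by norm_num)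
  have h5 : finrank (ZMod 2) ((T.replaceZ ℓ hℓ).tot.Cochain 1) =
      finrank (ZMod 2) ((T.dual.replaceX ℓ hℓ).tot.Cochain 1) :=
    finrank_cochain_dual _ (by norm_num)
  have h6 : finrank (ZMod 2) (T.dual.Cochain 1) = finrank (ZMod 2) (T.Cochain 1) :=
    finrank_cochain_dual _ (by norm_num)
  omega

/-- The transpose of `replaceX_δloc_pull`: a local coboundary contains an even number of the
top-degree cells of each local code. -/
theorem replaceZ_sumOwn_δloc (i j : ℕ) (ψ : (T.replaceZ ℓ hℓ).tot.Cochain i) :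
    (T.replaceZ ℓ hℓ).sumOwn j ((T.replaceZ ℓ hℓ).δloc i j ψ) = 0 := by
  classical
  by_cases hij : i + 1 = j
  swap
  · rw [CodeEmbedding.δloc_shape _ hij, LinearMap.zero_apply, map_zero]
  let _ := Fintype.ofFinite ((T.replaceZ ℓ hℓ).tot.Cells i)
  funext v
  rw [CodeEmbedding.δloc, CodeEmbedding.sumOwn, relMap_comp_apply]
  refine Finset.sum_eq_zero fun a _ => ?_
  rw [(T.replaceZ ℓ hℓ).tot.card_cells j (fun b => ((T.replaceZ ℓ hℓ).tot.adj a.1 b ∧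
    (T.replaceZ ℓ hℓ).own a.1 = (T.replaceZ ℓ hℓ).own b) ∧ (T.replaceZ ℓ hℓ).own b = v.1)
    fun b hb => by rw [(T.replaceZ ℓ hℓ).tot.adj_deg _ _ hb.1.1, a.2, hij]]
  have : Nat.card {b // ((T.replaceZ ℓ hℓ).tot.adj a.1 b ∧
      (T.replaceZ ℓ hℓ).own a.1 = (T.replaceZ ℓ hℓ).own b) ∧ (T.replaceZ ℓ hℓ).own b = v.1} =
      Nat.card {b : T.dual.LocalCell ℓ // b.adj a.1 ∧ b.own = LocalCell.own a.1 ∧ b.own = v.1 ∧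
        b.deg = T.dual.deg v.1} := by
    refine Nat.card_congr (Equiv.subtypeEquivRight fun b =>
      ⟨?_, fun h => ⟨⟨h.1, h.2.1.symm⟩, h.2.2.1⟩⟩)
    rintro ⟨⟨h1, h2⟩, h3⟩
    refine ⟨h1, h2.symm, h3, ?_⟩
    have h4 := LocalCell.adj_deg hℓ h1
    have h5 : 2 - LocalCell.deg a.1 = i := a.2
    have h6 := LocalCell.deg_le hℓ a.1
    have h7 := v.2
    change _ = 2 - T.deg v.1
    change LocalCell.deg a.1 = LocalCell.deg b + 1 at h4
    omega
  rw [(ZMod.natCast_eq_zero_iff_even).2 (this ▸ LocalCell.even_card_local hℓ _ _), zero_mul]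

/-- The transpose of `replaceX_g_pull`, resting on the same count `card_connect`. -/
theorem replaceZ_sumOwn_g (n : ℕ) (ψ : (T.replaceZ ℓ hℓ).tot.Cochain n) :
    (T.replaceZ ℓ hℓ).sumOwn (n + 1) ((T.replaceZ ℓ hℓ).g n (n + 1) ψ) =
      T.δ n (n + 1) ((T.replaceZ ℓ hℓ).sumOwn n ψ) := by
  classical
  let _ := Fintype.ofFinite ((T.replaceZ ℓ hℓ).tot.Cells n)
  funext v
  rw [CodeEmbedding.g, CodeEmbedding.sumOwn, CodeEmbedding.sumOwn, δ, relMap_comp_apply,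
    relMap_comp_apply]
  refine Finset.sum_congr rfl fun a _ => ?_
  have had : 2 - LocalCell.deg a.1 = n := a.2
  have hv := v.2
  have hv2 := T.deg_le v.1
  have ha2 := LocalCell.deg_le hℓ a.1
  congr 2
  rw [(T.replaceZ ℓ hℓ).tot.card_cells (n + 1) (fun b => ((T.replaceZ ℓ hℓ).tot.adj a.1 b ∧
    (T.replaceZ ℓ hℓ).own a.1 ≠ (T.replaceZ ℓ hℓ).own b) ∧ (T.replaceZ ℓ hℓ).own b = v.1)
    fun b hb => by rw [(T.replaceZ ℓ hℓ).tot.adj_deg _ _ hb.1.1, a.2],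
    T.card_cells n (fun w => (T.replaceZ ℓ hℓ).own a.1 = w ∧ T.adj w v.1) fun w hw => by
      have := T.adj_deg _ _ hw.2
      omega]
  have : Nat.card {b // ((T.replaceZ ℓ hℓ).tot.adj a.1 b ∧
      (T.replaceZ ℓ hℓ).own a.1 ≠ (T.replaceZ ℓ hℓ).own b) ∧ (T.replaceZ ℓ hℓ).own b = v.1} =
      Nat.card {b : T.dual.LocalCell ℓ // b.adj a.1 ∧ b.own ≠ LocalCell.own a.1 ∧ b.own = v.1} :=
    Nat.card_congr (Equiv.subtypeEquivRight fun b =>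
      ⟨fun h => ⟨h.1.1, h.1.2.symm, h.2⟩, fun h => ⟨⟨h.1, h.2.1.symm⟩, h.2.2⟩⟩)
  rw [this]
  rcases LocalCell.card_connect hℓ (T := T.dual) a.1 v.1 (by
    change _ = 2 - T.deg v.1 + 1
    omega) with ⟨h1, h2⟩ | ⟨h1, h2⟩
  · rw [h1, eq_comm, Nat.card_eq_one_iff_unique]
    refine ⟨⟨?_⟩, ⟨⟨_, rfl, h2⟩⟩⟩
    rintro ⟨w, h3, -⟩ ⟨w', h4, -⟩
    exact Subtype.ext (h3.symm.trans h4)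
  · rw [h1, eq_comm]
    have : IsEmpty {w // (T.replaceZ ℓ hℓ).own a.1 = w ∧ T.adj w v.1} := by
      refine ⟨fun ⟨w, h3, h4⟩ => h2 ?_⟩
      subst h3
      exact h4
    simp

end TannerComplex

/-! ### Point classes and the theorem for `R_Z` -/

namespace TannerComplex

open Module CategoryTheory

variable {T : TannerComplex} {ℓ : ℕ} (hℓ : Odd ℓ ∧ 3 ≤ ℓ)

/-- The central cell of the local complex of `v`, as a cell of the replacement `R_Z`. -/
def centerZ (hT : T.IsRegular) {n : ℕ} (v : T.Cells n) : (T.replaceZ ℓ hℓ).tot.Cells n :=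
  ⟨LocalCell.center hT.dual ℓ v.1, by
    have h1 : 2 - (LocalCell.center hT.dual ℓ v.1).deg = 2 - (2 - T.deg v.1) :=
      congrArg (2 - ·) (LocalCell.deg_center hT.dual ℓ v.1)
    have := T.deg_le v.1
    refine h1.trans ?_
    rw [Nat.sub_sub_self this, v.2]⟩

/-- The cochain that is supported on the central cells of the local complexes. -/
noncomputable def pushZ (hT : T.IsRegular) (n : ℕ) :
    T.Cochain n →ₗ[ZMod 2] (T.replaceZ ℓ hℓ).tot.Cochain n :=
  relMap fun v b => b = centerZ hℓ hT v

theorem pushZ_single (hT : T.IsRegular) {n : ℕ} [DecidableEq (T.Cells n)]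
    [DecidableEq ((T.replaceZ ℓ hℓ).tot.Cells n)] (v : T.Cells n) :
    pushZ hℓ hT n (Pi.single v 1) = Pi.single (centerZ hℓ hT v) 1 := by
  funext b
  rw [pushZ, relMap_single, Pi.single_apply]

theorem replaceZ_sumOwn_single {n : ℕ} [DecidableEq (T.Cells n)]
    [DecidableEq ((T.replaceZ ℓ hℓ).tot.Cells n)] (b : (T.replaceZ ℓ hℓ).tot.Cells n)
    (hb : T.deg ((T.replaceZ ℓ hℓ).own b.1) = n) :
    (T.replaceZ ℓ hℓ).sumOwn n (Pi.single b 1) = Pi.single ⟨_, hb⟩ 1 := by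
  classical
  funext v
  rw [CodeEmbedding.sumOwn, relMap_single, Pi.single_apply]
  exact if_congr ⟨fun h => Subtype.ext h.symm, fun h => (congrArg Subtype.val h).symm⟩ rfl rfl

theorem replaceZ_sumOwn_pushZ (hT : T.IsRegular) (n : ℕ) (φ : T.Cochain n) :
    (T.replaceZ ℓ hℓ).sumOwn n (pushZ hℓ hT n φ) = φ := by
  classical
  have h : (T.replaceZ ℓ hℓ).sumOwn n ∘ₗ pushZ hℓ hT n = LinearMap.id := by
    refine LinearMap.pi_ext' fun v => LinearMap.ext_ring ?_
    change (T.replaceZ ℓ hℓ).sumOwn n (pushZ hℓ hT n (Pi.single v 1)) = Pi.single v 1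
    rw [pushZ_single, replaceZ_sumOwn_single hℓ _ v.2]
    rfl
  exact LinearMap.congr_fun h φ

/-- Vanishing away from the cells of highest degree of the local complexes. -/
def IsCentral {n : ℕ} (φ : (T.replaceZ ℓ hℓ).tot.Cochain n) : Prop :=
  ∀ a : (T.replaceZ ℓ hℓ).tot.Cells n, T.deg ((T.replaceZ ℓ hℓ).own a.1) ≠ n → φ a = 0

theorem isCentral_pushZ (hT : T.IsRegular) (n : ℕ) (φ : T.Cochain n) :
    IsCentral hℓ (pushZ hℓ hT n φ) := by
  intro a ha
  rw [pushZ, relMap_apply_of_list _ φ a [] (by simp) fun v => ?_]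
  · simp
  · simp only [List.not_mem_nil, iff_false]
    rintro rfl
    exact ha v.2

theorem le_replaceZ_own_deg (a : (T.replaceZ ℓ hℓ).tot.V) :
    (T.replaceZ ℓ hℓ).tot.deg a ≤ T.deg ((T.replaceZ ℓ hℓ).own a) := by
  have h : 2 - T.deg ((T.replaceZ ℓ hℓ).own a) ≤ LocalCell.deg a := LocalCell.own_deg_le a
  change 2 - LocalCell.deg a ≤ _
  omega

/-- In `R_Z` the 0-cells of `Y_v` have the highest degree of their local code, so nothing lies above
them locally. -/
theorem IsCentral.δloc {n : ℕ} {φ : (T.replaceZ ℓ hℓ).tot.Cochain n} (h : IsCentral hℓ φ) (j : ℕ) :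
    (T.replaceZ ℓ hℓ).δloc n j φ = 0 := by
  classical
  let _ := Fintype.ofFinite ((T.replaceZ ℓ hℓ).tot.Cells n)
  funext b
  rw [CodeEmbedding.δloc, relMap_apply]
  refine Finset.sum_eq_zero fun a _ => ?_
  split_ifs with hab
  · refine h a fun e => ?_
    have h1 := (T.replaceZ ℓ hℓ).tot.adj_deg _ _ hab.1
    have h2 := le_replaceZ_own_deg hℓ b.1
    rw [← hab.2, e, h1, a.2] at h2
    omega
  · rfl

theorem IsCentral.g {n : ℕ} {φ : (T.replaceZ ℓ hℓ).tot.Cochain n} (h : IsCentral hℓ φ) :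
    IsCentral hℓ ((T.replaceZ ℓ hℓ).g n (n + 1) φ) := by
  intro b hb
  refine CodeEmbedding.g_apply_eq_zero _ _ _ fun a hab => h a fun e => hb ?_
  rw [T.adj_deg _ _ hab, e]

/-- In `R_Z` the local coboundary of a 1-cell of `Y_v` is the sum of its two ends, so all 0-cells of
a connected `Y_v` are cohomologous. The degree `m + 1` excludes the X-checks of `T`, whose local
codes are two unconnected points. -/
theorem replaceZ_mkQ_eq_of_ends (hT : T.IsRegular) {m : ℕ}
    [DecidableEq ((T.replaceZ ℓ hℓ).tot.Cells (m + 1))]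
    (a a' : (T.replaceZ ℓ hℓ).tot.Cells (m + 1)) (h : T.deg ((T.replaceZ ℓ hℓ).own a.1) = m + 1)
    (e : (T.replaceZ ℓ hℓ).own a'.1 = (T.replaceZ ℓ hℓ).own a.1) :
    (LinearMap.range ((T.replaceZ ℓ hℓ).δloc m (m + 1))).mkQ (Pi.single a 1) =
      (LinearMap.range ((T.replaceZ ℓ hℓ).δloc m (m + 1))).mkQ (Pi.single a' 1) := by
  classical
  have hm : m + 1 ≤ 2 := h ▸ T.deg_le _
  let f : T.dual.LocalCell ℓ → _ := fun c => if h : (T.replaceZ ℓ hℓ).tot.deg c = m + 1 then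
    (LinearMap.range ((T.replaceZ ℓ hℓ).δloc m (m + 1))).mkQ
      (Pi.single (⟨c, h⟩ : (T.replaceZ ℓ hℓ).tot.Cells (m + 1)) 1) else 0
  have hf : ∀ c : (T.replaceZ ℓ hℓ).tot.Cells (m + 1), f c.1 =
      (LinearMap.range ((T.replaceZ ℓ hℓ).δloc m (m + 1))).mkQ (Pi.single c 1) := fun c =>
    dif_pos c.2
  have hdeg : ∀ c : (T.replaceZ ℓ hℓ).tot.Cells (m + 1), LocalCell.deg c.1 = 2 - (m + 1) := fun c => by
    have h1 : 2 - LocalCell.deg c.1 = m + 1 := c.2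
    have h2 := LocalCell.deg_le hℓ c.1
    omega
  have hv : T.dual.deg ((T.replaceZ ℓ hℓ).own a.1) = 2 - (m + 1) := congrArg (2 - ·) h
  rw [← hf, ← hf]
  refine LocalCell.eq_of_ends hT.dual hℓ (v := (T.replaceZ ℓ hℓ).own a.1) (by omega) f ?_ rfl e
    ((hdeg a).trans hv.symm) ((hdeg a').trans hv.symm)
  intro c c' b o1 o2 o3 hb hc hc'
  have e1 := LocalCell.adj_deg hℓ hc
  have e2 := LocalCell.adj_deg hℓ hc'
  have e3 : ∀ d : T.dual.LocalCell ℓ, (T.replaceZ ℓ hℓ).tot.deg d = 2 - LocalCell.deg d := fun _ => rfl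
  rw [hv] at hb
  let b' : (T.replaceZ ℓ hℓ).tot.Cells m := ⟨b, by rw [e3]; omega⟩
  let C : (T.replaceZ ℓ hℓ).tot.Cells (m + 1) := ⟨c, by rw [e3]; omega⟩
  let C' : (T.replaceZ ℓ hℓ).tot.Cells (m + 1) := ⟨c', by rw [e3]; omega⟩
  change f C.1 = f C'.1
  rw [hf, hf]
  by_cases hcc : C = C'
  · rw [hcc]
  obtain ⟨d, d', hne, -, -, hd⟩ := LocalCell.exists_ends hℓ b (by
    rw [o3, hb, hv])
  have hends : ∀ x : (T.replaceZ ℓ hℓ).tot.Cells (m + 1), ((T.replaceZ ℓ hℓ).tot.adj b x.1 ∧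
      (T.replaceZ ℓ hℓ).own b = (T.replaceZ ℓ hℓ).own x.1) ↔ x = C ∨ x = C' := by
    have h1 := (hd c).1 ⟨hc, o1.trans o3.symm⟩
    have h2 := (hd c').1 ⟨hc', o2.trans o3.symm⟩
    have h3 : c ≠ c' := fun h => hcc (Subtype.ext h)
    intro x
    have h4 : ((T.replaceZ ℓ hℓ).tot.adj b x.1 ∧
        (T.replaceZ ℓ hℓ).own b = (T.replaceZ ℓ hℓ).own x.1) ↔ x.1 = d ∨ x.1 = d' :=
      Iff.trans (and_congr Iff.rfl eq_comm) (hd x.1)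
    rw [h4, Subtype.ext_iff, Subtype.ext_iff]
    change _ ↔ x.1 = c ∨ x.1 = c'
    rcases h1 with rfl | rfl <;> rcases h2 with rfl | rfl
    · exact absurd rfl h3
    · exact Iff.rfl
    · exact or_comm
    · exact absurd rfl h3
  refine (Submodule.Quotient.eq _).2 ⟨Pi.single b' 1, funext fun x => ?_⟩
  rw [CodeEmbedding.δloc, relMap_single, Pi.sub_apply, Pi.single_apply, Pi.single_apply]
  rw [if_congr (hends x) rfl rfl]
  by_cases h1 : x = C
  · rw [if_pos (Or.inl h1), if_pos h1, if_neg (fun h2 => hcc (h1.symm.trans h2)), sub_zero]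
  · by_cases h2 : x = C'
    · rw [if_pos (Or.inr h2), if_neg h1, if_pos h2]
      rfl
    · rw [if_neg (not_or.2 ⟨h1, h2⟩), if_neg h1, if_neg h2, sub_zero]

/-- A cochain on the cells of highest degree is cohomologous to one on the central cells. -/
theorem IsCentral.exists_δloc_eq (hT : T.IsRegular) {m : ℕ}
    {φ : (T.replaceZ ℓ hℓ).tot.Cochain (m + 1)} (h : IsCentral hℓ φ) :
    ∃ ψ, (T.replaceZ ℓ hℓ).δloc m (m + 1) ψ =
      φ - pushZ hℓ hT (m + 1) ((T.replaceZ ℓ hℓ).sumOwn (m + 1) φ) := by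
  classical
  let _ := Fintype.ofFinite ((T.replaceZ ℓ hℓ).tot.Cells (m + 1))
  refine (Submodule.Quotient.eq (LinearMap.range ((T.replaceZ ℓ hℓ).δloc m (m + 1)))).1 ?_
  change (LinearMap.range ((T.replaceZ ℓ hℓ).δloc m (m + 1))).mkQ φ =
    ((LinearMap.range ((T.replaceZ ℓ hℓ).δloc m (m + 1))).mkQ ∘ₗ pushZ hℓ hT (m + 1) ∘ₗ
      (T.replaceZ ℓ hℓ).sumOwn (m + 1)) φ
  rw [pi_eq_sum_univ' φ, map_sum, map_sum]
  refine Finset.sum_congr rfl fun a _ => ?_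
  rw [map_smul, map_smul]
  by_cases ha : T.deg ((T.replaceZ ℓ hℓ).own a.1) = m + 1
  · congr 1
    rw [LinearMap.comp_apply, LinearMap.comp_apply, replaceZ_sumOwn_single hℓ a ha, pushZ_single]
    exact replaceZ_mkQ_eq_of_ends hℓ hT a _ ha rfl
  · rw [h a ha, zero_smul, zero_smul]

theorem replaceZ_δloc_pushZ (hT : T.IsRegular) (n : ℕ) (φ : T.Cochain n) :
    (T.replaceZ ℓ hℓ).δloc n (n + 1) (pushZ hℓ hT n φ) = 0 :=
  (isCentral_pushZ hℓ hT n φ).δloc hℓ _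

/-- The sums over local codes recover a cochain from its image under `pushZ` and vanish on local
coboundaries. -/
theorem replaceZ_toHloc_injective (hT : T.IsRegular) (n : ℕ) :
    Function.Injective ((T.replaceZ ℓ hℓ).toHloc (pushZ hℓ hT n) (replaceZ_δloc_pushZ hℓ hT n)) := by
  rw [injective_iff_map_eq_zero]
  intro φ h
  obtain ⟨ψ, hψ⟩ := (CodeEmbedding.toHloc_eq_zero_iff _ _ _ _).1 h
  rw [← replaceZ_sumOwn_pushZ hℓ hT n φ, ← hψ, replaceZ_sumOwn_δloc]

/-- Unlike for `R_X`, `ι` commutes with the differentials only on classes: `g` sends a central cell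
to copies of it that need not be central in their new local codes, and `IsCentral.exists_δloc_eq`
moves them to the centres. -/
theorem IsRegular.replaceZ_hasCochainMap (hT : T.IsRegular) :
    (T.replaceZ ℓ hℓ).HasCochainMap (T.replaceZ ℓ hℓ).localPoint ∧
      T.numLogical = (T.replaceZ ℓ hℓ).tot.numLogical := by
  classical
  have comm : ∀ n φ, (T.replaceZ ℓ hℓ).Hg n (n + 1)
      ((T.replaceZ ℓ hℓ).toHloc _ (replaceZ_δloc_pushZ hℓ hT n) φ) =
      (T.replaceZ ℓ hℓ).toHloc _ (replaceZ_δloc_pushZ hℓ hT (n + 1)) (T.δ n (n + 1) φ) := fun n φ =>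
    CodeEmbedding.Hg_toHloc _ _ _ _ _ _ (by
      have h := ((isCentral_pushZ hℓ hT n φ).g hℓ).exists_δloc_eq hℓ hT
      rwa [replaceZ_sumOwn_g, replaceZ_sumOwn_pushZ] at h)
  have inj := replaceZ_toHloc_injective hℓ hT
  have surj1 : Function.Surjective ((T.replaceZ ℓ hℓ).toHloc _ (replaceZ_δloc_pushZ hℓ hT 1)) :=
    (LinearMap.injective_iff_surjective_of_finrank_eq_finrank
      (replaceZ_finrank_Hloc_one hℓ hT).symm).1 (inj 1)
  refine CodeEmbedding.hasCochainMap_of _ _ (CodeEmbedding.inducedHom _ _ comm) inj surj1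
    (fun y => ?_) (fun n v => ⟨⟨_, replaceZ_δloc_pushZ hℓ hT n _⟩,
      ⟨centerZ hℓ hT v, rfl, pushZ_single hℓ hT v⟩, rfl⟩)
    (replaceZ_finrank_δ hℓ hT)
  obtain ⟨z, rfl⟩ := Submodule.mkQ_surjective _ y
  -- The class of `z` need not lie in the image of `ι`, but its image under `H(g)` is `ι u` for some
  -- `u`. Applying the sums over local codes identifies `u` as the coboundary in `T` of the sums of
  -- `z`.
  obtain ⟨u, hu⟩ := surj1 ((T.replaceZ ℓ hℓ).Hg 0 1 (((T.replaceZ ℓ hℓ).Bloc 0).mkQ z))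
  obtain ⟨ψ, hψ⟩ := (Submodule.Quotient.eq _).1 hu
  have h : (T.replaceZ ℓ hℓ).δloc 0 1 ψ = pushZ hℓ hT 1 u - (T.replaceZ ℓ hℓ).g 0 1 z.1 := hψ
  have h1 := congrArg ((T.replaceZ ℓ hℓ).sumOwn 1) h
  rw [replaceZ_sumOwn_δloc, map_sub, replaceZ_sumOwn_pushZ, replaceZ_sumOwn_g hℓ 0, eq_comm,
    sub_eq_zero] at h1
  refine ⟨(T.replaceZ ℓ hℓ).sumOwn 0 z.1, ?_⟩
  refine Eq.trans ?_ hu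
  exact congrArg ((T.replaceZ ℓ hℓ).toHloc _ (replaceZ_δloc_pushZ hℓ hT 1)) h1.symm

end TannerComplex

/-- For the replacements `R_X` and `R_Z` of a regular Tanner square complex `T` there is a cochain map
from the code of `T` to the new code that is an isomorphism on `H¹` and factors through the induced
complex, which is homotopy equivalent to the new code. The same holds at every level of the alternating
construction, in particular for the `[[5, 1, 2]]` surface code as a seed. -/
theorem mainTheorem3 (ℓ : ℕ) (hℓ : Odd ℓ ∧ 3 ≤ ℓ) :
    TannerComplex.surfaceCode.IsRegular ∧
    ∀ T : TannerComplex, T.IsRegular →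
      ((T.replaceX ℓ hℓ).HasCochainMap (T.replaceX ℓ hℓ).localSum ∧
        T.numLogical = (T.replaceX ℓ hℓ).tot.numLogical) ∧
      ((T.replaceZ ℓ hℓ).HasCochainMap (T.replaceZ ℓ hℓ).localPoint ∧
        T.numLogical = (T.replaceZ ℓ hℓ).tot.numLogical) ∧
      ∀ i : ℕ,
        (Even i → ((T.level ℓ hℓ i).replaceX ℓ hℓ).HasCochainMap
          ((T.level ℓ hℓ i).replaceX ℓ hℓ).localSum) ∧
        (Odd i → ((T.level ℓ hℓ i).replaceZ ℓ hℓ).HasCochainMap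
          ((T.level ℓ hℓ i).replaceZ ℓ hℓ).localPoint) ∧
        (T.level ℓ hℓ i).numLogical = T.numLogical := by
  refine ⟨TannerComplex.surfaceCode_isRegular, fun T hT => ⟨hT.replaceX_hasCochainMap hℓ,
    hT.replaceZ_hasCochainMap hℓ, fun i => ⟨fun _ => ((hT.level hℓ i).replaceX_hasCochainMap hℓ).1,
    fun _ => ((hT.level hℓ i).replaceZ_hasCochainMap hℓ).1, ?_⟩⟩⟩
  induction i with
  | zero => rfl
  | succ i ih =>
    rw [← ih, TannerComplex.level]
    split_ifs
    · exact ((hT.level hℓ i).replaceX_hasCochainMap hℓ).2.symm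
    · exact ((hT.level hℓ i).replaceZ_hasCochainMap hℓ).2.symm
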